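/- Let $G$ be a countable infinite discrete group and let $X$ be a $G$-compact proper $G$-space: $G$ acts on $X$ by homeomorphisms, $X$ is locally compact Hausdorff, $X/G$ is compact Hausdorff, and every point of $X$ has a $G$-invariant neighbourhood that maps continuously and $G$-equivariantly onto a discrete coset space $G/H$ with $H\subseteq G$ a finite subgroup. Let $\mathbb C[G]$ be the complex vector space with basis $G$, with the inner product for which $G$ is orthonormal and with the left translation action of $G$, and let $M[G]$ be the $*$-algebra of complex matrices $[T_{g_1,g_2}]_{g_1,g_2\in G}$ with only finitely many nonzero entries, with $G$-action $(g\cdot T)_{g_1,g_2}=T_{g^{-1}g_1,g^{-1}g_2}$. Let $\mathcal C(X,G)$ be the $*$-algebra of all $G$-equivariant functions $F\colon X\to M[G]$ whose matrix entries $x\mapsto F(x)_{g_1,g_2}$ are continuous and compactly supported and such that, for every compact $K\subseteq X$, all but finitely many of the entries vanish on $K$. Let $C^*(X,G)\supseteq\mathcal C(X,G)$ be the $C^*$-algebra of $G$-equivariant norm-continuous functions from $X$ to the compact operators on $\ell^2(G)$. Projections $P,Q$ in a $*$-algebra are equivalent if $P=U^*U$ and $Q=UU^*$ for some element $U$ of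 the algebra. A $G$-bundle is a $G$-equivariant complex vector bundle on $X$ (locally trivial of finite rank; the rank need not be constant); a hermitian $G$-bundle is one with a continuous $G$-invariant hermitian metric, isomorphisms being isometric. A standard $G$-bundle is a $G$-invariant subset $E\subseteq X\times\mathbb C[G]$ such that for every compact $K\subseteq X$ there is a finite $S\subseteq G$ for which $E\cap(K\times\mathbb C[G])$ is a complex vector subbundle of $K\times\mathbb C[S]$; it carries the induced structure of a $G$-bundle, and the metric inherited from $\mathbb C[G]$ makes it a hermitian $G$-bundle. Standard $G$-bundles are isomorphic if they are isomorphic as $G$-bundles. Then there are bijections between the following sets: (a) equivalence classes of projections in $\mathcal C(X,G)$; (b) equivalence classes of projections in $C^*(X,G)$; (c) isomorphism classes of standard $G$-bundles on $X$; (d) isomorphism classes of hermitian $G$-bundles on $X$. From (a) to (b) the bijection is induced by the inclusion $\mathcal C(X,G)\subseteq C^*(X,G)$; from (a) to (c) it sends the class of $P$ to the class of the range of $P$, the standard $G$-bundle with fibre $P(x)\,\mathbb C[G]$ at $x$; and from (c) to (d) it sends the class of a standard $G$-bundle to the class of its underlying hermitian $G$-bundle. If moreover $X$ is a smooth (finite-dimensional)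 manifold on which $G$ acts by smooth maps, then forgetting the smooth structure induces a bijection from (e) isomorphism classes of smooth hermitian $G$-bundles on $X$ (smooth complex vector bundles with smooth $G$-action and smooth $G$-invariant hermitian metric, isomorphisms being smooth, equivariant and isometric) to the set (d). Furthermore, every $G$-bundle on $X$ has a smooth structure, for which the action of $G$ is smooth, and this structure is unique up to isomorphism: for any two such smooth structures $s,t$ on the same $G$-bundle $V$ there is a $G$-bundle isomorphism $V\to V$ that is a diffeomorphism from $(V,s)$ to $(V,t)$. -/

import Mathlib

open scoped Topology Manifold ContDiff

universe u v

/-! ## Finitely supported matrices -/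

/-- Matrices indexed by `S` with only finitely many nonzero entries, as a linear subspace of all
`S × S` matrices. -/
def finMatSubmodule (S : Type*) : Submodule ℂ (Matrix S S ℂ) where
  carrier := {T | {p : S × S | T p.1 p.2 ≠ 0}.Finite}
  zero_mem' := by simp
  add_mem' := by
    intro A B hA hB
    refine (Set.Finite.union hA hB).subset ?_
    intro p hp
    by_contra h
    simp only [Set.mem_union, Set.mem_ofPred_eq, not_or, not_not] at h
    exact hp (by simp [h.1, h.2])
  smul_mem' := by
    intro c A hA
    refine Set.Finite.subset hA ?_
    intro p hp h
    exact hp (by simp [h])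

/-- `M[S]`: the complex matrices with rows and columns indexed by `S`, all but finitely many of
whose entries are zero. -/
def FinMat (S : Type*) : Type _ := ↥(finMatSubmodule S)

namespace FinMat

variable {S : Type*}

noncomputable instance : AddCommGroup (FinMat S) := inferInstanceAs (AddCommGroup ↥(finMatSubmodule S))

noncomputable instance : Module ℂ (FinMat S) := inferInstanceAs (Module ℂ ↥(finMatSubmodule S))

instance : CoeFun (FinMat S) (fun _ => S → S → ℂ) := ⟨fun T => T.1⟩

theorem ext {A B : FinMat S} (h : ∀ i j, A i j = B i j) : A = B :=
  Subtype.ext (funext fun i => funext fun j => h i j)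

@[simp] theorem add_apply (A B : FinMat S) (i j : S) : (A + B) i j = A i j + B i j := rfl
@[simp] theorem zero_apply (i j : S) : (0 : FinMat S) i j = 0 := rfl
@[simp] theorem neg_apply (A : FinMat S) (i j : S) : (-A) i j = - A i j := rfl
@[simp] theorem smul_apply (c : ℂ) (A : FinMat S) (i j : S) : (c • A) i j = c * A i j := rfl

theorem finite (T : FinMat S) : {p : S × S | T p.1 p.2 ≠ 0}.Finite := T.2

/-- Build an element of `M[S]` from an entry function supported in `s × s`. -/
def ofFinset (s : Finset S) (f : S → S → ℂ) (h : ∀ i j, f i j ≠ 0 → i ∈ s ∧ j ∈ s) : FinMat S :=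
  ⟨f, (s ×ˢ s).finite_toSet.subset fun p hp => by
    simpa using h p.1 p.2 hp⟩

/-- A finite set of indices outside of which all entries of `T` vanish. -/
noncomputable def idx (T : FinMat S) : Finset S :=
  ((T.finite.image Prod.fst).union (T.finite.image Prod.snd)).toFinset

theorem mem_idx (T : FinMat S) {i j : S} (h : T i j ≠ 0) : i ∈ T.idx ∧ j ∈ T.idx := by
  constructor
  · simp only [idx, Set.Finite.mem_toFinset]
    exact Or.inl ⟨(i, j), h, rfl⟩
  · simp only [idx, Set.Finite.mem_toFinset]
    exact Or.inr ⟨(i, j), h, rfl⟩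

/-- Matrix multiplication (each sum has only finitely many nonzero terms). -/
noncomputable instance : Mul (FinMat S) where
  mul A B := ofFinset (A.idx ∪ B.idx : Set S).toFinite.toFinset
    (fun i k => ∑ᶠ j, A i j * B j k) (by
      intro i k h
      obtain ⟨j, hj⟩ : ∃ j, A i j * B j k ≠ 0 := by
        by_contra hc
        push Not at hc
        exact h (by simp [hc])
      simp only [Set.Finite.mem_toFinset, Set.mem_union, Finset.mem_coe]
      exact ⟨Or.inl (A.mem_idx (left_ne_zero_of_mul hj)).1,
        Or.inr (B.mem_idx (right_ne_zero_of_mul hj)).2⟩)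

theorem mul_apply (A B : FinMat S) (i k : S) : (A * B) i k = ∑ᶠ j, A i j * B j k := rfl

theorem mul_apply_sum {A B : FinMat S} {i k : S} (s : Finset S)
    (h : ∀ j, A i j ≠ 0 → B j k ≠ 0 → j ∈ s) : (A * B) i k = ∑ j ∈ s, A i j * B j k := by
  rw [mul_apply]
  apply finsum_eq_sum_of_support_subset
  intro j hj
  exact h j (left_ne_zero_of_mul hj) (right_ne_zero_of_mul hj)

/-- The adjoint is the conjugate transpose. -/
noncomputable instance : Star (FinMat S) where
  star A := ofFinset A.idx (fun i j => star (A j i)) (by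
    intro i j h
    have := A.mem_idx (i := j) (j := i) (by simpa using h)
    exact ⟨this.2, this.1⟩)

@[simp] theorem star_apply (A : FinMat S) (i j : S) : (star A) i j = star (A j i) := rfl

noncomputable instance : NonUnitalRing (FinMat S) where
  left_distrib A B C := ext fun i k => by
    classical
    rw [add_apply, mul_apply_sum A.idx fun j h _ => (A.mem_idx h).2,
      mul_apply_sum A.idx fun j h _ => (A.mem_idx h).2,
      mul_apply_sum A.idx fun j h _ => (A.mem_idx h).2, ← Finset.sum_add_distrib]
    simp [mul_add]
  right_distrib A B C := ext fun i k => by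
    rw [add_apply, mul_apply_sum C.idx fun j _ h => (C.mem_idx h).1,
      mul_apply_sum C.idx fun j _ h => (C.mem_idx h).1,
      mul_apply_sum C.idx fun j _ h => (C.mem_idx h).1, ← Finset.sum_add_distrib]
    simp [add_mul]
  zero_mul A := ext fun i k => by simp [mul_apply]
  mul_zero A := ext fun i k => by simp [mul_apply]
  mul_assoc A B C := ext fun i l => by
    rw [mul_apply_sum B.idx fun j h _ => ?_, mul_apply_sum B.idx fun j _ h => ?_]
    · have h1 : ∀ k, (A * B) i k = ∑ j ∈ B.idx, A i j * B j k := fun k =>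
        mul_apply_sum B.idx fun j _ h => (B.mem_idx h).1
      have h2 : ∀ j, (B * C) j l = ∑ k ∈ B.idx, B j k * C k l := fun k =>
        mul_apply_sum B.idx fun j h _ => (B.mem_idx h).2
      simp only [h1, h2, Finset.sum_mul, Finset.mul_sum]
      rw [Finset.sum_comm]
      simp [mul_assoc]
    · obtain ⟨k, hk⟩ : ∃ k, B j k * C k l ≠ 0 := by
        by_contra hc
        push Not at hc
        exact h (by simp [mul_apply, hc])
      exact (B.mem_idx (left_ne_zero_of_mul hk)).1
    · obtain ⟨k, hk⟩ : ∃ k, A i k * B k j ≠ 0 := by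
        by_contra hc
        push Not at hc
        exact h (by simp [mul_apply, hc])
      exact (B.mem_idx (right_ne_zero_of_mul hk)).2

noncomputable instance : StarRing (FinMat S) where
  star_involutive A := ext fun i j => by simp
  star_add A B := ext fun i j => by simp
  star_mul A B := ext fun i k => by
    rw [star_apply, mul_apply_sum A.idx fun j h _ => (A.mem_idx h).2,
      mul_apply_sum A.idx fun j _ h => (A.mem_idx (by simpa using h)).2, star_sum]
    simp [mul_comm]

instance : StarModule ℂ (FinMat S) where
  star_smul c A := ext fun i j => by simp

instance : IsScalarTower ℂ (FinMat S) (FinMat S) where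
  smul_assoc c A B := ext fun i k => by
    rw [smul_eq_mul, smul_eq_mul, smul_apply, mul_apply_sum A.idx fun j h _ => ?_,
      mul_apply_sum A.idx fun j h _ => (A.mem_idx h).2, Finset.mul_sum]
    · simp [mul_assoc]
    · exact (A.mem_idx (right_ne_zero_of_mul h)).2

instance : SMulCommClass ℂ (FinMat S) (FinMat S) where
  smul_comm c A B := ext fun i k => by
    rw [smul_eq_mul, smul_eq_mul, smul_apply, mul_apply_sum A.idx fun j h _ => (A.mem_idx h).2,
      mul_apply_sum A.idx fun j h _ => (A.mem_idx h).2, Finset.mul_sum]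
    simp [mul_left_comm]

/-- The linear operator on `ℂ[S]` (the finitely supported functions on `S`) given by a matrix. -/
noncomputable def toLin (T : FinMat S) : (S →₀ ℂ) →ₗ[ℂ] (S →₀ ℂ) :=
  Finsupp.linearCombination ℂ fun j =>
    Finsupp.onFinset T.idx (fun i => T i j) fun _ h => (T.mem_idx h).1

theorem toLin_apply (T : FinMat S) (v : S →₀ ℂ) (i : S) (s : Finset S)
    (hs : ∀ j, T i j ≠ 0 → v j ≠ 0 → j ∈ s) : T.toLin v i = ∑ j ∈ s, T i j * v j := by
  classical
  have h1 : T.toLin v i = ∑ j ∈ v.support, T i j * v j := by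
    rw [toLin, Finsupp.linearCombination_apply, Finsupp.sum, Finsupp.finsetSum_apply]
    refine Finset.sum_congr rfl fun j _ => ?_
    simp [mul_comm]
  rw [h1, ← Finset.sum_filter_ne_zero, ← Finset.sum_filter_ne_zero (s := s)]
  refine Finset.sum_congr ?_ fun _ _ => rfl
  ext j
  simp only [Finset.mem_filter, Finsupp.mem_support_iff]
  constructor
  · rintro ⟨h, h'⟩
    exact ⟨hs j (left_ne_zero_of_mul h') h, h'⟩
  · rintro ⟨h, h'⟩
    exact ⟨right_ne_zero_of_mul h', h'⟩

theorem toLin_mul (A B : FinMat S) (v : S →₀ ℂ) : (A * B).toLin v = A.toLin (B.toLin v) := by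
  ext i
  rw [toLin_apply _ _ _ v.support fun j _ h => by simpa using h,
    toLin_apply A _ _ A.idx fun j h _ => (A.mem_idx h).2]
  simp only [toLin_apply B v _ v.support fun j _ h => by simpa using h,
    fun k => mul_apply_sum (A := A) (B := B) (i := i) (k := k) A.idx
      fun j h _ => (A.mem_idx h).2, Finset.mul_sum, Finset.sum_mul]
  rw [Finset.sum_comm]
  simp [mul_assoc]

end FinMat

/-! ## Operators on `ℓ²` -/

/-- The Hilbert space `ℓ²(S)`. -/
abbrev EllTwo (S : Type*) : Type _ := lp (fun _ : S => ℂ) 2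

/-- The standard orthonormal basis vectors of `ℓ²(S)`. -/
noncomputable def EllTwo.delta {S : Type*} (s : S) : EllTwo S :=
  haveI := Classical.decEq S
  lp.single 2 s 1

theorem EllTwo.inner_delta {S : Type*} (s : S) (ξ : EllTwo S) :
    inner ℂ (EllTwo.delta s) ξ = ξ s := by
  let := Classical.decEq S
  exact (lp.inner_single_left (𝕜 := ℂ) (G := fun _ : S => ℂ) s 1 ξ).trans (by simp)

theorem EllTwo.delta_apply {S : Type*} [DecidableEq S] (s t : S) :
    EllTwo.delta s t = if t = s then 1 else 0 := by
  let := Classical.decEq S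
  refine (lp.single_apply (E := fun _ : S => ℂ) 2 s 1 t).trans ?_
  rw [Pi.single_apply]
  congr

namespace FinMat

variable {S : Type*}

/-- The finite rank operator on `ℓ²(S)` with a given finitely supported matrix. -/
noncomputable def toCLM (T : FinMat S) : EllTwo S →L[ℂ] EllTwo S :=
  ∑ i ∈ T.idx, ∑ j ∈ T.idx,
    T i j • InnerProductSpace.rankOne ℂ (EllTwo.delta i) (EllTwo.delta j)

theorem toCLM_eq_sum (T : FinMat S) (s : Finset S) (hs : ∀ i j, T i j ≠ 0 → i ∈ s ∧ j ∈ s) :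
    T.toCLM = ∑ i ∈ s, ∑ j ∈ s,
      T i j • InnerProductSpace.rankOne ℂ (EllTwo.delta i) (EllTwo.delta j) := by
  classical
  have key : ∀ t : Finset S, (∀ i j, T i j ≠ 0 → i ∈ t ∧ j ∈ t) →
      (∑ i ∈ t, ∑ j ∈ t,
        T i j • InnerProductSpace.rankOne ℂ (EllTwo.delta i) (EllTwo.delta j)) =
      ∑ i ∈ t ∪ T.idx ∪ s, ∑ j ∈ t ∪ T.idx ∪ s,
        T i j • InnerProductSpace.rankOne ℂ (EllTwo.delta i) (EllTwo.delta j) := by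
    intro t ht
    have hsub : t ⊆ t ∪ T.idx ∪ s :=
      Finset.subset_union_left.trans Finset.subset_union_left
    rw [← Finset.sum_subset hsub fun i _ hi => ?_]
    · refine Finset.sum_congr rfl fun i _ => Finset.sum_subset hsub fun j _ hj => ?_
      have : T i j = 0 := by
        by_contra h
        exact hj (ht i j h).2
      simp [this]
    · refine Finset.sum_eq_zero fun j _ => ?_
      have : T i j = 0 := by
        by_contra h
        exact hi (ht i j h).1
      simp [this]
  rw [toCLM, key T.idx fun i j h => T.mem_idx h, key s hs, Finset.union_self,
    Finset.union_assoc, Finset.union_comm s, Finset.union_assoc, Finset.union_self]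

theorem toCLM_apply (T : FinMat S) (ξ : EllTwo S) (i : S) (s : Finset S)
    (hs : ∀ j, T i j ≠ 0 → j ∈ s) : T.toCLM ξ i = ∑ j ∈ s, T i j * ξ j := by
  classical
  have h1 : T.toCLM ξ i = ∑ j ∈ T.idx, T i j * ξ j := by
    rw [toCLM]
    simp only [_root_.sum_apply, _root_.smul_apply,
      InnerProductSpace.rankOne_apply, EllTwo.inner_delta]
    rw [lp.coeFn_sum, Finset.sum_apply]
    simp only [lp.coeFn_sum, Finset.sum_apply, lp.coeFn_smul, Pi.smul_apply, smul_eq_mul,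
      EllTwo.delta_apply]
    rw [Finset.sum_comm]
    refine Finset.sum_congr rfl fun j _ => ?_
    by_cases hi : i ∈ T.idx
    · simp [hi]
    · have : T i j = 0 := by
        by_contra h
        exact hi (T.mem_idx h).1
      simp [hi, this]
  rw [h1, ← Finset.sum_filter_ne_zero, ← Finset.sum_filter_ne_zero (s := s)]
  refine Finset.sum_congr ?_ fun _ _ => rfl
  ext j
  simp only [Finset.mem_filter]
  constructor
  · rintro ⟨h, h'⟩
    exact ⟨hs j (left_ne_zero_of_mul h'), h'⟩
  · rintro ⟨h, h'⟩
    exact ⟨(T.mem_idx (left_ne_zero_of_mul h')).2, h'⟩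

theorem toCLM_add (A B : FinMat S) : (A + B).toCLM = A.toCLM + B.toCLM := by
  classical
  ext ξ i
  rw [toCLM_apply _ _ _ (A.idx ∪ B.idx), _root_.add_apply, lp.coeFn_add, Pi.add_apply,
    toCLM_apply A _ _ (A.idx ∪ B.idx), toCLM_apply B _ _ (A.idx ∪ B.idx),
    ← Finset.sum_add_distrib]
  · simp [add_mul]
  · exact fun j h => Finset.mem_union_right _ (B.mem_idx h).2
  · exact fun j h => Finset.mem_union_left _ (A.mem_idx h).2
  · intro j h
    by_cases hA : A i j = 0
    · exact Finset.mem_union_right _ (B.mem_idx (i := i) (by simpa [hA] using h)).2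
    · exact Finset.mem_union_left _ (A.mem_idx hA).2

theorem toCLM_smul (c : ℂ) (A : FinMat S) : (c • A).toCLM = c • A.toCLM := by
  ext ξ i
  rw [toCLM_apply _ _ _ A.idx, _root_.smul_apply, lp.coeFn_smul, Pi.smul_apply,
    toCLM_apply A _ _ A.idx, Finset.smul_sum]
  · simp [mul_assoc]
  · exact fun j h => (A.mem_idx h).2
  · exact fun j h => (A.mem_idx (right_ne_zero_of_mul h)).2

theorem toCLM_mul (A B : FinMat S) : (A * B).toCLM = A.toCLM * B.toCLM := by
  ext ξ i
  rw [toCLM_apply _ _ _ B.idx, mul_apply_eq_comp, toCLM_apply A _ _ A.idx]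
  · simp only [fun j => toCLM_apply B ξ j B.idx fun k h => (B.mem_idx h).2,
      fun k => mul_apply_sum (A := A) (B := B) (i := i) (k := k) A.idx
      fun j h _ => (A.mem_idx h).2, Finset.mul_sum, Finset.sum_mul]
    rw [Finset.sum_comm]
    simp [mul_assoc]
  · exact fun j h => (A.mem_idx h).2
  · intro k h
    obtain ⟨j, hj⟩ : ∃ j, A i j * B j k ≠ 0 := by
      by_contra hc
      push Not at hc
      exact h (by simp [mul_apply, hc])
    exact (B.mem_idx (right_ne_zero_of_mul hj)).2

theorem toCLM_star (A : FinMat S) : (star A).toCLM = star A.toCLM := by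
  rw [toCLM_eq_sum (star A) A.idx fun i j h => by
    have := A.mem_idx (i := j) (j := i) (by simpa using h)
    exact ⟨this.2, this.1⟩, toCLM]
  simp only [star_sum, star_smul, ContinuousLinearMap.star_eq_adjoint,
    InnerProductSpace.adjoint_rankOne, star_apply]
  rw [Finset.sum_comm]

end FinMat

/-! ## Projections and their equivalence -/

/-- The projections (self-adjoint idempotents) of a `*`-algebra. -/
def Proj (A : Type*) [Mul A] [Star A] : Type _ := {p : A // IsStarProjection p}

/-- Two projections `p`, `q` are equivalent if `u^* u = p` and `u u^* = q` for some `u`. -/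
instance Proj.setoid (A : Type*) [NonUnitalRing A] [StarRing A] : Setoid (Proj A) where
  r p q := ∃ w : A, star w * w = p.1 ∧ w * star w = q.1
  iseqv :=
    { refl := fun p => ⟨p.1, by
        rw [p.2.isSelfAdjoint.star_eq]
        exact ⟨p.2.isIdempotentElem, p.2.isIdempotentElem⟩⟩
      symm := by
        rintro p q ⟨w, h1, h2⟩
        exact ⟨star w, by rwa [star_star], by rwa [star_star]⟩
      trans := by
        rintro p q r ⟨w, h1, h2⟩ ⟨z, h3, h4⟩
        refine ⟨z * w, ?_, ?_⟩
        · rw [star_mul, mul_assoc, ← mul_assoc (star z), h3, ← h2, mul_assoc, ← mul_assoc, h1]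
          exact p.2.isIdempotentElem
        · rw [star_mul, mul_assoc, ← mul_assoc w, h2, ← h3, mul_assoc, ← mul_assoc, h4]
          exact r.2.isIdempotentElem }

/-- The image of a projection under a homomorphism of `*`-algebras. -/
def Proj.map {A B : Type*} [NonUnitalRing A] [StarRing A] [Module ℂ A] [NonUnitalRing B]
    [StarRing B] [Module ℂ B] (f : A →⋆ₙₐ[ℂ] B) (p : Proj A) : Proj B :=
  ⟨f p.1, by
    constructor
    · have := congrArg f p.2.isIdempotentElem
      rwa [map_mul] at this
    · have := congrArg f p.2.isSelfAdjoint
      rwa [map_star] at this⟩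

/-! ## Proper actions with compact quotient -/

/-- Every point of `X` has a `G`-invariant neighbourhood that maps continuously and equivariantly
onto a (discrete) coset space `G ⧸ H` with `H` a finite subgroup. -/
def LocallyProperAction (G : Type v) (X : Type u) [Group G] [TopologicalSpace X]
    [MulAction G X] : Prop :=
  ∀ x : X, ∃ U ∈ 𝓝 x, (∀ (g : G), ∀ y ∈ U, g • y ∈ U) ∧
    ∃ H : Subgroup G, Finite H ∧ ∃ f : X → G ⧸ H,
      (∀ (g : G), ∀ y ∈ U, f (g • y) = g • f y) ∧ f '' U = Set.univ ∧
      IsLocallyConstant (fun y : U => f y)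

theorem exists_compact_saturation (G : Type v) (X : Type u) [Group G] [TopologicalSpace X]
    [MulAction G X] [ContinuousConstSMul G X] [LocallyCompactSpace X]
    [CompactSpace (MulAction.orbitRel.Quotient G X)] :
    ∃ K : Set X, IsCompact K ∧ ∀ x : X, ∃ g : G, g • x ∈ K := by
  choose C hC hxC using fun x : X => exists_compact_mem_nhds x
  have hq := MulAction.isOpenQuotientMap_quotientMk (Γ := G) (T := X)
  let q : X → MulAction.orbitRel.Quotient G X := Quotient.mk (MulAction.orbitRel G X)
  obtain ⟨t, ht⟩ := (isCompact_univ (X := MulAction.orbitRel.Quotient G X)).elim_finite_subcover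
    (fun x : X => q '' interior (C x)) (fun x => hq.isOpenMap _ isOpen_interior) (by
      intro y _
      obtain ⟨x, rfl⟩ := hq.surjective y
      exact Set.mem_iUnion.2 ⟨x, x, mem_interior_iff_mem_nhds.2 (hxC x), rfl⟩)
  refine ⟨⋃ x ∈ t, C x, t.isCompact_biUnion fun x _ => hC x, fun x => ?_⟩
  obtain ⟨z, hz, y, hy, hxy⟩ : ∃ z ∈ t, ∃ y ∈ interior (C z), q y = q x := by
    simpa using ht (Set.mem_univ (q x))
  obtain ⟨g, hg⟩ : y ∈ MulAction.orbit G x := Quotient.exact hxy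
  refine ⟨g, Set.mem_biUnion hz ?_⟩
  have : g • x = y := hg
  rw [this]
  exact interior_subset hy

/-! ## The `*`-algebra `𝒞(X, G)` -/

section Algebras

variable (G : Type v) (X : Type u) [Group G] [TopologicalSpace X] [MulAction G X]

/-- A function `F : X → M[G]` is standard if its matrix entries are continuous and compactly
supported, and if for every compact `K ⊆ X` all but finitely many of them vanish on `K`. -/
structure IsStandardFun {G : Type v} {X : Type u} [TopologicalSpace X]
    (F : X → FinMat G) : Prop where
  continuous_entry : ∀ i j, Continuous fun x => F x i j
  compactSupport_entry : ∀ i j, HasCompactSupport fun x => F x i j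
  finite_on : ∀ K : Set X, IsCompact K → {p : G × G | ∃ x ∈ K, F x p.1 p.2 ≠ 0}.Finite

/-- Equivariance for the action `(g • T) i j = T (g⁻¹ i) (g⁻¹ j)` of `G` on `M[G]`. -/
def IsEquivariantFun {G : Type v} {X : Type u} [Group G] [MulAction G X]
    (F : X → FinMat G) : Prop :=
  ∀ (g : G) (x : X) (i j : G), F (g • x) i j = F x (g⁻¹ * i) (g⁻¹ * j)

variable {G X}

theorem IsStandardFun.exists_finset {G : Type v} {X : Type u} [TopologicalSpace X] {F : X → FinMat G} (hF : IsStandardFun F) {K : Set X}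
    (hK : IsCompact K) : ∃ s : Finset G, ∀ x ∈ K, ∀ i j, F x i j ≠ 0 → i ∈ s ∧ j ∈ s := by
  classical
  refine ⟨(hF.finite_on K hK).toFinset.image Prod.fst ∪
    (hF.finite_on K hK).toFinset.image Prod.snd, fun x hx i j h => ?_⟩
  have : (i, j) ∈ (hF.finite_on K hK).toFinset := by
    simpa using ⟨x, hx, h⟩
  exact ⟨Finset.mem_union_left _ (Finset.mem_image_of_mem Prod.fst this),
    Finset.mem_union_right _ (Finset.mem_image_of_mem Prod.snd this)⟩

theorem IsEquivariantFun.hasCompactSupport [T2Space X] [ContinuousConstSMul G X]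
    [LocallyCompactSpace X] [CompactSpace (MulAction.orbitRel.Quotient G X)] {F : X → FinMat G}
    (hF : IsEquivariantFun F)
    (h : ∀ K : Set X, IsCompact K → {p : G × G | ∃ x ∈ K, F x p.1 p.2 ≠ 0}.Finite) (i j : G) :
    HasCompactSupport fun x => F x i j := by
  obtain ⟨K, hK, hKG⟩ := exists_compact_saturation G X
  have hfin : {g : G | ∃ x ∈ K, F x (g * i) (g * j) ≠ 0}.Finite := by
    refine ((h K hK).preimage (f := fun g : G => (g * i, g * j)) ?_)
    intro a _ b _ hab
    exact mul_right_cancel (Prod.ext_iff.1 hab).1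
  refine HasCompactSupport.intro (hfin.isCompact_biUnion fun g _ => hK.image
    (continuous_const_smul g⁻¹)) fun x hx => ?_
  by_contra hne
  apply hx
  obtain ⟨g, hg⟩ := hKG x
  refine Set.mem_biUnion (x := g) ⟨g • x, hg, ?_⟩ ⟨g • x, hg, inv_smul_smul g x⟩
  rw [hF]
  simpa using hne

variable (G X)
variable [ContinuousConstSMul G X] [T2Space X] [LocallyCompactSpace X]
  [CompactSpace (MulAction.orbitRel.Quotient G X)]

/-- `𝒞(X, G)`: the `*`-algebra of all standard `G`-equivariant functions `X → M[G]`, with pointwise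
operations. -/
noncomputable def StdAlg : NonUnitalStarSubalgebra ℂ (X → FinMat G) where
  carrier := {F | IsStandardFun F ∧ IsEquivariantFun F}
  add_mem' := by
    rintro A B ⟨hA, hA'⟩ ⟨hB, hB'⟩
    refine ⟨⟨fun i j => (hA.continuous_entry i j).add (hB.continuous_entry i j),
      fun i j => (hA.compactSupport_entry i j).add (hB.compactSupport_entry i j), fun K hK => ?_⟩,
      fun g x i j => ?_⟩
    · refine ((hA.finite_on K hK).union (hB.finite_on K hK)).subset ?_
      rintro p ⟨x, hx, hp⟩
      by_cases h : A x p.1 p.2 = 0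
      · exact Or.inr ⟨x, hx, by simpa [h] using hp⟩
      · exact Or.inl ⟨x, hx, h⟩
    · simp [hA' g x i j, hB' g x i j]
  zero_mem' := by
    refine ⟨⟨fun i j => ?_, fun i j => ?_, fun K hK => ?_⟩, fun g x i j => ?_⟩
    · simpa using continuous_const
    · exact HasCompactSupport.zero (α := X) (β := ℂ)
    · simp
    · simp
  smul_mem' := by
    rintro c A ⟨hA, hA'⟩
    refine ⟨⟨fun i j => continuous_const.mul (hA.continuous_entry i j),
      fun i j => (hA.compactSupport_entry i j).mul_left (f := fun _ => c), fun K hK => ?_⟩,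
      fun g x i j => ?_⟩
    · refine (hA.finite_on K hK).subset ?_
      rintro p ⟨x, hx, hp⟩
      exact ⟨x, hx, right_ne_zero_of_mul hp⟩
    · simp [hA' g x i j]
  mul_mem' := by
    rintro A B ⟨hA, hA'⟩ ⟨hB, hB'⟩
    have hfin : ∀ K : Set X, IsCompact K → {p : G × G | ∃ x ∈ K, (A * B) x p.1 p.2 ≠ 0}.Finite := by
      intro K hK
      obtain ⟨s, hs⟩ := hA.exists_finset hK
      obtain ⟨t, ht⟩ := hB.exists_finset hK
      refine (s ×ˢ t).finite_toSet.subset ?_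
      rintro ⟨i, k⟩ ⟨x, hx, hp⟩
      obtain ⟨j, hj⟩ : ∃ j, A x i j * B x j k ≠ 0 := by
        by_contra hc
        push Not at hc
        exact hp (by simp [FinMat.mul_apply, hc])
      simpa using ⟨(hs x hx i j (left_ne_zero_of_mul hj)).1,
        (ht x hx j k (right_ne_zero_of_mul hj)).2⟩
    have heq : IsEquivariantFun (A * B) := by
      intro g x i k
      rw [Pi.mul_apply, Pi.mul_apply, FinMat.mul_apply, FinMat.mul_apply]
      simp only [hA' g x, hB' g x]
      exact finsum_eq_of_bijective (fun j => g⁻¹ * j) (Group.mulLeft_bijective g⁻¹) fun j => rfl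
    refine ⟨⟨fun i k => ?_, heq.hasCompactSupport hfin, hfin⟩, heq⟩
    rw [continuous_iff_continuousAt]
    intro x
    obtain ⟨K, hK, hxK⟩ := exists_compact_mem_nhds x
    obtain ⟨s, hs⟩ := hA.exists_finset hK
    have hc : Continuous fun y => ∑ j ∈ s, A y i j * B y j k :=
      continuous_finsetSum _ fun j _ => (hA.continuous_entry i j).mul (hB.continuous_entry j k)
    refine hc.continuousAt.congr ?_
    filter_upwards [hxK] with y hy
    exact (FinMat.mul_apply_sum s fun j h _ => (hs y hy i j h).2).symm
  star_mem' := by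
    rintro A ⟨hA, hA'⟩
    refine ⟨⟨fun i j => continuous_star.comp (hA.continuous_entry j i), fun i j => ?_,
      fun K hK => ?_⟩, fun g x i j => ?_⟩
    · exact (hA.compactSupport_entry j i).comp_left (g := star) (star_zero ℂ)
    · refine ((hA.finite_on K hK).preimage (f := Prod.swap) Prod.swap_injective.injOn).subset ?_
      rintro p ⟨x, hx, hp⟩
      exact ⟨x, hx, by simpa using hp⟩
    · simp [hA' g x j i]

end Algebras

/-! ## The `C^*`-algebra `C^*(X, G)` -/

section LeftRegular

variable {G : Type v} [Group G]

theorem FinMat.isCompactOperator_toCLM {S : Type*} (T : FinMat S) :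
    IsCompactOperator T.toCLM := by
  rw [FinMat.toCLM]
  have h : ∀ s : Finset (S × S), IsCompactOperator
      (∑ p ∈ s, T p.1 p.2 • InnerProductSpace.rankOne ℂ (EllTwo.delta p.1) (EllTwo.delta p.2) :
        EllTwo S →L[ℂ] EllTwo S) := by
    classical
    intro s
    induction s using Finset.induction_on with
    | empty => 
      rw [Finset.sum_empty]
      exact isCompactOperator_zero
    | insert a s ha ih =>
      rw [Finset.sum_insert ha]
      refine IsCompactOperator.add ?_ ih
      refine IsCompactOperator.smul (f := InnerProductSpace.rankOne ℂ _ _) ?_ (T a.1 a.2)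
      rw [InnerProductSpace.rankOne_def']
      exact ((isCompactOperator_id (E := ℂ)).clm_comp
        (ContinuousLinearMap.toSpanSingleton ℂ _)).comp_clm (innerSL ℂ _)
  have := h (T.idx ×ˢ T.idx)
  rwa [Finset.sum_product] at this

/-- The left regular representation of `G` on `ℓ²(G)`: `(λ_g ξ)(h) = ξ(g⁻¹ h)`. -/
noncomputable def leftReg (g : G) : EllTwo G →ₗᵢ[ℂ] EllTwo G where
  toFun ξ := ⟨fun h => ξ (g⁻¹ * h), by
    have h2 : 0 < (2 : ENNReal).toReal := by norm_num
    exact memℓp_gen ((Equiv.mulLeft g⁻¹).summable_iff.2 ((lp.memℓp ξ).summable h2))⟩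
  map_add' ξ η := by
    ext h
    rfl
  map_smul' c ξ := by
    ext h
    rfl
  norm_map' ξ := by
    have h2 : 0 < (2 : ENNReal).toReal := by norm_num
    rw [lp.norm_eq_tsum_rpow h2, lp.norm_eq_tsum_rpow h2]
    congr 1
    exact (Equiv.mulLeft g⁻¹).tsum_eq fun h => ‖ξ h‖ ^ (2 : ENNReal).toReal

@[simp] theorem leftReg_apply (g : G) (ξ : EllTwo G) (h : G) : leftReg g ξ h = ξ (g⁻¹ * h) := rfl

/-- `leftReg g` as a bounded operator. -/
noncomputable abbrev leftRegCLM (g : G) : EllTwo G →L[ℂ] EllTwo G :=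
  (leftReg g).toContinuousLinearMap

theorem leftRegCLM_mul (g h : G) : leftRegCLM g * leftRegCLM h = leftRegCLM (g * h) := by
  ext ξ i
  simp [mul_assoc]

theorem leftRegCLM_one : leftRegCLM (1 : G) = 1 := by
  ext ξ i
  simp

theorem leftRegCLM_star (g : G) : star (leftRegCLM g) = leftRegCLM g⁻¹ := by
  rw [ContinuousLinearMap.star_eq_adjoint, eq_comm, ContinuousLinearMap.eq_adjoint_iff]
  intro ξ η
  have : ξ = leftReg g (leftReg g⁻¹ ξ) := by
    ext i
    simp
  conv_rhs => rw [this]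
  exact ((leftReg g).inner_map_map _ _).symm

end LeftRegular

/-- The adjoint of a compact operator on a Hilbert space is compact. -/
theorem isCompactOperator_adjoint {H : Type*} [NormedAddCommGroup H] [InnerProductSpace ℂ H]
    [CompleteSpace H] {T : H →L[ℂ] H} (hT : IsCompactOperator T) :
    IsCompactOperator (ContinuousLinearMap.adjoint T) := by
  have hTT : IsCompactOperator (T ∘L ContinuousLinearMap.adjoint T) := hT.comp_clm _
  set S := ContinuousLinearMap.adjoint T with hS
  have hcl : IsCompact (closure ((T ∘L S) '' Metric.closedBall (0 : H) 1)) :=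
    hTT.isCompact_closure_image_closedBall (f := ((T ∘L S : H →L[ℂ] H) : H →ₗ[ℂ] H)) 1
  rw [isCompactOperator_iff_exists_mem_nhds_isCompact_closure_image]
  refine ⟨Metric.closedBall 0 1, Metric.closedBall_mem_nhds 0 one_pos, ?_⟩
  refine (TotallyBounded.closure ?_).isCompact_of_isClosed isClosed_closure
  rw [Metric.totallyBounded_iff]
  intro ε hε
  have htb : TotallyBounded ((T ∘L S) '' Metric.closedBall (0 : H) 1) :=
    hcl.totallyBounded.subset subset_closure
  obtain ⟨t, ht, htfin, hcov⟩ :=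
    Metric.finite_approx_of_totallyBounded htb (ε ^ 2 / 2) (by positivity)
  have ht1 : ∀ z ∈ t, ∃ y, y ∈ Metric.closedBall (0 : H) 1 ∧ (T ∘L S) y = z := fun z hz => ht hz
  choose! r hr hr' using ht1
  refine ⟨(fun z => S (r z)) '' t, htfin.image _, ?_⟩
  rintro _ ⟨x, hx, rfl⟩
  obtain ⟨z, hz, hxz⟩ := Set.mem_iUnion₂.1 (hcov ⟨x, hx, rfl⟩)
  refine Set.mem_iUnion₂.2 ⟨S (r z), ⟨z, hz, rfl⟩, ?_⟩
  have hrz := hr z hz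
  have hrz' := hr' z hz
  set y := r z
  have hxy : (T ∘L S) x ∈ Metric.ball ((T ∘L S) y) (ε ^ 2 / 2) := by
    rw [hrz']
    exact hxz
  have hx1 : ‖x‖ ≤ 1 := by simpa using hx
  have hy1 : ‖y‖ ≤ 1 := by simpa using hrz
  have h1 : ‖(T ∘L S) (x - y)‖ < ε ^ 2 / 2 := by
    rw [map_sub, ← dist_eq_norm]
    exact hxy
  have h2 : ‖x - y‖ ≤ 2 := (norm_sub_le x y).trans (by linarith)
  have h3 : ‖S (x - y)‖ ^ 2 ≤ ‖(T ∘L S) (x - y)‖ * ‖x - y‖ := by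
    have h4 : inner ℂ (S (x - y)) (S (x - y)) = inner ℂ ((T ∘L S) (x - y)) (x - y) := by
      rw [hS, ContinuousLinearMap.adjoint_inner_right]
      rfl
    calc ‖S (x - y)‖ ^ 2 = ‖(inner ℂ (S (x - y)) (S (x - y)) : ℂ)‖ := by
          rw [inner_self_eq_norm_sq_to_K]
          simp
      _ ≤ _ := by
          rw [h4]
          exact norm_inner_le_norm _ _
  rw [Metric.mem_ball, dist_eq_norm, ← map_sub]
  have h5 : ‖S (x - y)‖ ^ 2 < ε ^ 2 := by
    refine h3.trans_lt ?_
    calc ‖(T ∘L S) (x - y)‖ * ‖x - y‖ ≤ ‖(T ∘L S) (x - y)‖ * 2 := by gcongr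
      _ < ε ^ 2 := by linarith
  exact lt_of_pow_lt_pow_left₀ 2 hε.le h5

section CstarAlg

variable (G : Type v) (X : Type u) [Group G] [TopologicalSpace X] [MulAction G X]

/-- `C^*(X, G)`: the `*`-algebra of all (norm-)continuous functions `F` from `X` to the compact
operators on `ℓ²(G)` that are `G`-equivariant, `F (g x) = λ_g F(x) λ_g⁻¹`. For `X/G` compact such
functions are bounded and this is a `C^*`-algebra in the supremum norm. -/
noncomputable def CstarAlg :
    NonUnitalStarSubalgebra ℂ (X → (EllTwo G →L[ℂ] EllTwo G)) where
  carrier := {F | Continuous F ∧ (∀ x, IsCompactOperator (F x)) ∧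
    ∀ (g : G) (x : X), F (g • x) = leftRegCLM g * F x * leftRegCLM g⁻¹}
  add_mem' := by
    rintro A B ⟨cA, hA, hA'⟩ ⟨cB, hB, hB'⟩
    exact ⟨cA.add cB, fun x => (hA x).add (hB x),
      fun g x => by simp [hA', hB', mul_add, add_mul]⟩
  zero_mem' := ⟨continuous_zero, fun x => isCompactOperator_zero, fun g x => by simp⟩
  smul_mem' := by
    rintro c A ⟨cA, hA, hA'⟩
    exact ⟨cA.const_smul c, fun x => (hA x).smul c, fun g x => by simp [hA']⟩
  mul_mem' := by
    rintro A B ⟨cA, hA, hA'⟩ ⟨cB, hB, hB'⟩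
    refine ⟨cA.mul cB, fun x => (hA x).comp_clm (B x), fun g x => ?_⟩
    have h1 : leftRegCLM g⁻¹ * leftRegCLM g = 1 := by
      rw [leftRegCLM_mul, inv_mul_cancel, leftRegCLM_one]
    rw [Pi.mul_apply, Pi.mul_apply, hA', hB']
    calc leftRegCLM g * A x * leftRegCLM g⁻¹ * (leftRegCLM g * B x * leftRegCLM g⁻¹)
        = leftRegCLM g * A x * (leftRegCLM g⁻¹ * leftRegCLM g) * B x * leftRegCLM g⁻¹ := by
          simp only [mul_assoc]
      _ = leftRegCLM g * (A x * B x) * leftRegCLM g⁻¹ := by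
          rw [h1]
          simp only [mul_assoc, one_mul]
  star_mem' := by
    rintro A ⟨cA, hA, hA'⟩
    refine ⟨continuous_star.comp cA, fun x => ?_, fun g x => ?_⟩
    · rw [Pi.star_apply, ContinuousLinearMap.star_eq_adjoint]
      exact isCompactOperator_adjoint (hA x)
    · rw [Pi.star_apply, Pi.star_apply, hA', star_mul, star_mul,
        leftRegCLM_star, leftRegCLM_star, inv_inv, mul_assoc]

variable [ContinuousConstSMul G X] [T2Space X] [LocallyCompactSpace X]
  [CompactSpace (MulAction.orbitRel.Quotient G X)]

/-- The inclusion of `𝒞(X, G)` into `C^*(X, G)`: a matrix valued function is regarded as an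
operator valued function. -/
noncomputable def stdAlgToCstarAlg : StdAlg G X →⋆ₙₐ[ℂ] CstarAlg G X where
  toFun F := ⟨fun x => (F.1 x).toCLM, by
    refine ⟨?_, fun x => (F.1 x).isCompactOperator_toCLM, fun g x => ?_⟩
    · rw [continuous_iff_continuousAt]
      intro x
      obtain ⟨K, hK, hxK⟩ := exists_compact_mem_nhds x
      obtain ⟨s, hs⟩ := F.2.1.exists_finset hK
      have hc : Continuous fun y => ∑ i ∈ s, ∑ j ∈ s, F.1 y i j •
          InnerProductSpace.rankOne ℂ (EllTwo.delta i) (EllTwo.delta j) :=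
        continuous_finsetSum _ fun i _ => continuous_finsetSum _ fun j _ =>
          (F.2.1.continuous_entry i j).smul continuous_const
      refine hc.continuousAt.congr ?_
      filter_upwards [hxK] with y hy
      exact ((F.1 y).toCLM_eq_sum s (hs y hy)).symm
    · classical
      have hE := F.2.2 g x
      ext ξ i
      rw [FinMat.toCLM_apply _ _ _ ((F.1 x).idx.image fun j => g * j) fun j h => ?_,
        Finset.sum_image fun a _ b _ h => mul_left_cancel h]
      · simp only [mul_apply_eq_comp, LinearIsometry.coe_toContinuousLinearMap, leftReg_apply]
        rw [FinMat.toCLM_apply _ _ _ (F.1 x).idx fun j h => ((F.1 x).mem_idx h).2]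
        simp [hE]
      · rw [hE] at h
        exact Finset.mem_image.2 ⟨g⁻¹ * j, ((F.1 x).mem_idx h).2, by simp⟩⟩
  map_smul' c A := Subtype.ext <| funext fun x => FinMat.toCLM_smul c (A.1 x)
  map_zero' := Subtype.ext <| funext fun x => by
    have := FinMat.toCLM_smul 0 (0 : FinMat G)
    rw [zero_smul, zero_smul] at this
    exact this
  map_add' A B := Subtype.ext <| funext fun x => FinMat.toCLM_add (A.1 x) (B.1 x)
  map_mul' A B := Subtype.ext <| funext fun x => FinMat.toCLM_mul (A.1 x) (B.1 x)
  map_star' A := Subtype.ext <| funext fun x => FinMat.toCLM_star (A.1 x)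

end CstarAlg

/-! ## Equivariant vector bundles -/

/-- A family of complex vector spaces over `X` with a topology on its total space. -/
structure VectFamily (X : Type u) where
  fib : X → Type v
  [addCommGroup : ∀ x, AddCommGroup (fib x)]
  [module : ∀ x, Module ℂ (fib x)]
  topology : TopologicalSpace (Σ x, fib x)

attribute [instance] VectFamily.addCommGroup VectFamily.module

namespace VectFamily

/-- The total space. -/
def Total {X : Type u} (V : VectFamily.{u, v} X) : Type (max u v) := Σ x, V.fib x

instance {X : Type u} (V : VectFamily.{u, v} X) : TopologicalSpace V.Total := V.topology

/-- The point of the total space given by a vector in the fibre at `x`. -/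
def pt {X : Type u} (V : VectFamily.{u, v} X) (x : X) (w : V.fib x) : V.Total := ⟨x, w⟩

/-- A local trivialization over an open set `base`: fibrewise linear maps to `ℂ^rank` that define a
homeomorphism from the part of the total space over `base` to `base × ℂ^rank`. (The values of
`toFun` at points outside `base` are irrelevant.) -/
structure LocalTriv {X : Type u} [TopologicalSpace X] (V : VectFamily.{u, v} X) where
  rank : ℕ
  base : Set X
  isOpen_base : IsOpen base
  toFun : ∀ x, V.fib x →ₗ[ℂ] (Fin rank → ℂ)
  isHomeomorph : IsHomeomorph fun p : {p : V.Total // p.1 ∈ base} =>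
    ((⟨p.1.1, p.2⟩, toFun p.1.1 p.1.2) : base × (Fin rank → ℂ))

end VectFamily

/-- A `G`-bundle: a (locally trivial, finite rank) complex vector bundle over `X`, together with a
lift of the action of `G` on `X` to an action on the total space by homeomorphisms that are linear
on fibres. -/
structure GBundle (G : Type v) (X : Type u) [Group G] [TopologicalSpace X] [MulAction G X] extends
    VectFamily.{u, v} X where
  continuous_proj : Continuous fun p : toVectFamily.Total => p.1
  locallyTrivial : ∀ x, ∃ e : toVectFamily.LocalTriv, x ∈ e.base
  act : ∀ (g : G) (x : X), fib x →ₗ[ℂ] fib (g • x)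
  act_one : ∀ x (w : fib x),
    toVectFamily.pt ((1 : G) • x) (act 1 x w) = toVectFamily.pt x w
  act_mul : ∀ (g h : G) x (w : fib x), toVectFamily.pt ((g * h) • x) (act (g * h) x w) =
    toVectFamily.pt (g • h • x) (act g (h • x) (act h x w))
  continuous_act : ∀ g : G, Continuous fun p : toVectFamily.Total =>
    toVectFamily.pt (g • p.1) (act g p.1 p.2)

/-- A hermitian `G`-bundle: a `G`-bundle with a continuous `G`-invariant hermitian metric, that is,
an inner product on each fibre that is continuous on the fibre product `V ×_X V`. -/
structure HermBundle (G : Type v) (X : Type u) [Group G] [TopologicalSpace X] [MulAction G X]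
    extends GBundle G X where
  metric : ∀ x, InnerProductSpace.Core ℂ (fib x)
  continuous_metric : Continuous
    fun q : {q : toVectFamily.Total × toVectFamily.Total // q.2.1 = q.1.1} =>
      (metric q.1.1.1).inner q.1.1.2 (q.2 ▸ q.1.2.2)
  metric_act : ∀ (g : G) x (w z : fib x),
    (metric (g • x)).inner (act g x w) (act g x z) = (metric x).inner w z

section Iso

variable {G : Type v} {X : Type u} [Group G] [TopologicalSpace X] [MulAction G X]

/-- An isomorphism of `G`-bundles over `X`. -/
structure GBundle.Iso (V W : GBundle G X) where
  toEquiv : ∀ x, V.fib x ≃ₗ[ℂ] W.fib x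
  continuous_toFun : Continuous fun p : V.Total => W.pt p.1 (toEquiv p.1 p.2)
  continuous_invFun : Continuous fun p : W.Total => V.pt p.1 ((toEquiv p.1).symm p.2)
  map_act : ∀ (g : G) (x : X) (w : V.fib x), toEquiv (g • x) (V.act g x w) = W.act g x (toEquiv x w)

namespace GBundle.Iso

/-- The identity. -/
def refl (V : GBundle G X) : V.Iso V where
  toEquiv _ := LinearEquiv.refl ℂ _
  continuous_toFun := continuous_id
  continuous_invFun := continuous_id
  map_act _ _ _ := rfl

/-- The inverse isomorphism. -/
def symm {V W : GBundle G X} (φ : V.Iso W) : W.Iso V where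
  toEquiv x := (φ.toEquiv x).symm
  continuous_toFun := φ.continuous_invFun
  continuous_invFun := φ.continuous_toFun
  map_act g x w := by
    rw [LinearEquiv.symm_apply_eq, φ.map_act, LinearEquiv.apply_symm_apply]

/-- The composition of isomorphisms. -/
def trans {V W Z : GBundle G X} (φ : V.Iso W) (ψ : W.Iso Z) : V.Iso Z where
  toEquiv x := (φ.toEquiv x).trans (ψ.toEquiv x)
  continuous_toFun := ψ.continuous_toFun.comp φ.continuous_toFun
  continuous_invFun := φ.continuous_invFun.comp ψ.continuous_invFun
  map_act g x w := by simp [φ.map_act, ψ.map_act]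

end GBundle.Iso

/-- An isomorphism of the underlying `G`-bundles is isometric if it preserves the metrics. -/
def HermBundle.IsIsometric {V W : HermBundle G X} (φ : V.toGBundle.Iso W.toGBundle) : Prop :=
  ∀ x (w z : V.fib x),
    (W.metric x).inner (φ.toEquiv x w) (φ.toEquiv x z) = (V.metric x).inner w z

/-- Two hermitian `G`-bundles are isomorphic if there is an isometric isomorphism of `G`-bundles
between them. -/
instance HermBundle.setoid (G : Type v) (X : Type u) [Group G] [TopologicalSpace X]
    [MulAction G X] : Setoid (HermBundle G X) where
  r V W := ∃ φ : V.toGBundle.Iso W.toGBundle, HermBundle.IsIsometric φ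
  iseqv :=
    { refl := fun V => ⟨GBundle.Iso.refl _, fun _ _ _ => rfl⟩
      symm := by
        rintro V W ⟨φ, h⟩
        refine ⟨φ.symm, fun x w z => ?_⟩
        rw [← h x]
        simp [GBundle.Iso.symm]
      trans := by
        rintro V W Z ⟨φ, h⟩ ⟨ψ, h'⟩
        exact ⟨φ.trans ψ, fun x w z => (h' x _ _).trans (h x w z)⟩ }

end Iso

/-! ## Standard bundles -/

/-- The left translation action of `g` on `ℂ[G]` (sending the basis element `h` to `g h`). -/
noncomputable def leftTranslate {G : Type v} [Group G] (g : G) : (G →₀ ℂ) ≃ₗ[ℂ] (G →₀ ℂ) :=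
  Finsupp.domLCongr (Equiv.mulLeft g)

theorem leftTranslate_apply {G : Type v} [Group G] (g : G) (w : G →₀ ℂ) (h : G) :
    leftTranslate g w h = w (g⁻¹ * h) := by
  simp [leftTranslate, Finsupp.domLCongr_apply, Finsupp.domCongr_apply, Finsupp.equivMapDomain_apply]

/-- A standard `G`-bundle: a `G`-invariant subset of `X × ℂ[G]` (given by its fibres) such that for
every compact `K ⊆ X` there is a finite `S ⊆ G` for which the restriction to `K` is a complex vector
subbundle of `K × ℂ[S]`: it is contained in `K × ℂ[S]` and is spanned, near each point of
`K`, by pointwise linearly independent continuous sections. -/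
structure StdBundle (G : Type v) (X : Type u) [Group G] [TopologicalSpace X]
    [MulAction G X] where
  fib : X → Submodule ℂ (G →₀ ℂ)
  invariant : ∀ (g : G) x, ∀ w ∈ fib x, leftTranslate g w ∈ fib (g • x)
  isSubbundle : ∀ K : Set X, IsCompact K → ∃ S : Finset G,
    (∀ x ∈ K, fib x ≤ Finsupp.supported ℂ ℂ (S : Set G)) ∧
    ∀ x₀ ∈ K, ∃ U ∈ 𝓝 x₀, ∃ (n : ℕ) (e : Fin n → X → (G →₀ ℂ)),
      (∀ i h, ContinuousOn (fun x => e i x h) (U ∩ K)) ∧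
      ∀ x ∈ U ∩ K, LinearIndependent ℂ (fun i => e i x) ∧
        Submodule.span ℂ (Set.range fun i => e i x) = fib x

namespace StdBundle

variable {G : Type v} {X : Type u} [Group G] [TopologicalSpace X] [MulAction G X]

/-- The underlying family of vector spaces, with the topology of a subspace of `X × ℂ[G]`. As `E`
is locally contained in some `X × ℂ[S]` with `S` finite, it does not matter that `ℂ[G]` is given
the topology of pointwise convergence here. -/
noncomputable def toVectFamily (E : StdBundle G X) : VectFamily.{u, v} X where
  fib x := E.fib x
  topology := TopologicalSpace.induced
    (fun p : Σ x, E.fib x => ((p.1, fun h => (p.2 : G →₀ ℂ) h) : X × (G → ℂ))) inferInstance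

theorem total_ext (E : StdBundle G X) {p q : Σ x, E.fib x} (h : p.1 = q.1)
    (h' : (p.2 : G →₀ ℂ) = q.2) : p = q := by
  obtain ⟨x, w⟩ := p
  obtain ⟨y, z⟩ := q
  obtain rfl : x = y := h
  obtain rfl : w = z := Subtype.ext h'
  rfl

/-- The vector of `ℂ[G]` underlying a point of the total space. -/
def vec (E : StdBundle G X) (p : E.toVectFamily.Total) : G →₀ ℂ :=
  (show E.fib p.1 from p.2 : E.fib p.1).1

theorem continuous_total (E : StdBundle G X) : Continuous
    fun p : E.toVectFamily.Total => ((p.1, fun h => E.vec p h) : X × (G → ℂ)) :=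
  continuous_induced_dom

theorem continuous_total_proj (E : StdBundle G X) :
    Continuous fun p : E.toVectFamily.Total => p.1 :=
  continuous_fst.comp E.continuous_total

theorem continuous_total_coord (E : StdBundle G X) (h : G) :
    Continuous fun p : E.toVectFamily.Total => E.vec p h :=
  (continuous_apply h).comp (continuous_snd.comp E.continuous_total)

theorem continuous_to_total (E : StdBundle G X) {Y : Type*} [TopologicalSpace Y]
    {f : Y → E.toVectFamily.Total} (h1 : Continuous fun y => (f y).1)
    (h2 : ∀ h : G, Continuous fun y => E.vec (f y) h) :
    Continuous f :=
  continuous_induced_rng.2 (h1.prodMk (continuous_pi h2))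

theorem linear_eq_sum {G : Type v} {n : ℕ} (L : (G →₀ ℂ) →ₗ[ℂ] (Fin n → ℂ)) (S : Finset G) (w : G →₀ ℂ)
    (hw : w ∈ Finsupp.supported ℂ ℂ (S : Set G)) (i : Fin n) :
    L w i = ∑ h ∈ S, w h * L (Finsupp.single h 1) i := by
  have hsub : w.support ⊆ S := by
    simpa [Finsupp.mem_supported] using hw
  have h1 : w = ∑ h ∈ S, w h • Finsupp.single h (1 : ℂ) := by
    conv_lhs => rw [← Finsupp.sum_single w]
    rw [Finsupp.sum_of_support_subset _ hsub _ (by simp)]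
    simp
  conv_lhs => rw [h1]
  rw [map_sum, Finset.sum_apply]
  refine Finset.sum_congr rfl fun h _ => ?_
  rw [map_smul, Pi.smul_apply, smul_eq_mul]

theorem locallyTrivial [LocallyCompactSpace X] (E : StdBundle G X) (x₀ : X) :
    ∃ e : E.toVectFamily.LocalTriv, x₀ ∈ e.base := by
  obtain ⟨K, hK, hxK⟩ := exists_compact_mem_nhds x₀
  obtain ⟨S, hS, hloc⟩ := E.isSubbundle K hK
  obtain ⟨U, hU, n, e, hcont, he⟩ := hloc x₀ (mem_of_mem_nhds hxK)
  obtain ⟨O, hOsub, hO, hxO⟩ := mem_nhds_iff.1 (Filter.inter_mem hU hxK)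
  have hinj : LinearMap.ker (Fintype.linearCombination ℂ (fun i => e i x₀)) = ⊥ :=
    LinearMap.ker_eq_bot.2 (he x₀ (hOsub hxO)).1.fintypeLinearCombination_injective
  obtain ⟨L, hL⟩ := LinearMap.exists_leftInverse_of_injective _ hinj
  have hmem : ∀ x ∈ O, ∀ j, e j x ∈ E.fib x := fun x hx j => by
    rw [← (he x (hOsub hx)).2]
    exact Submodule.subset_span ⟨j, rfl⟩
  let M : X → Matrix (Fin n) (Fin n) ℂ := fun x => Matrix.of fun i j => L (e j x) i
  have hM : ContinuousOn M O := by
    refine continuousOn_pi.2 fun i => continuousOn_pi.2 fun j => ?_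
    have h1 : ContinuousOn (fun x => ∑ h ∈ S, e j x h * L (Finsupp.single h 1) i) O :=
      continuousOn_finsetSum _ fun h _ => ((hcont j h).mono hOsub).mul continuousOn_const
    exact h1.congr fun x hx =>
      linear_eq_sum L S _ (hS x (hOsub hx).2 (hmem x hx j)) i
  have hMx : M x₀ = 1 := by
    ext i j
    have := congrArg (fun f => f (Pi.single j 1) i) hL
    simpa [M, Fintype.linearCombination_apply_single, Matrix.one_apply, Pi.single_apply] using this
  let B : Set X := O ∩ {x | (M x).det ≠ 0}
  have hBo : IsOpen B := by
    have h1 : ContinuousOn (fun x => (M x).det) O := 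
      (continuous_id.matrix_det (n := Fin n) (R := ℂ)).comp_continuousOn hM
    exact h1.isOpen_inter_preimage hO isOpen_ne
  have hxB : x₀ ∈ B := ⟨hxO, by simp [hMx]⟩
  have hMB : Continuous fun x : B => M x :=
    continuousOn_iff_continuous_domRestrict.1 (hM.mono Set.inter_subset_left)
  have hMinv : Continuous fun x : B => (M x)⁻¹ := by
    have h1 : (fun x : B => (M x)⁻¹) = fun x : B => ((M x).det)⁻¹ • (M x).adjugate := by
      funext x
      rw [Matrix.inv_def, Ring.inverse_eq_inv']
    rw [h1]
    exact (hMB.matrix_det.inv₀ fun x => x.2.2).smul hMB.matrix_adjugate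
  let T : ∀ x, E.fib x →ₗ[ℂ] (Fin n → ℂ) := fun x =>
    Matrix.mulVecLin (M x)⁻¹ ∘ₗ L ∘ₗ (E.fib x).subtype
  have hT : ∀ x, ∀ w : E.fib x, T x w = (M x)⁻¹.mulVec (L w) := fun x w => rfl
  have hLe : ∀ x (c : Fin n → ℂ), L (∑ j, c j • e j x) = (M x).mulVec c := by
    intro x c
    ext i
    simp [M, Matrix.mulVec, dotProduct, mul_comm]
  have hTe : ∀ x ∈ B, ∀ (c : Fin n → ℂ), (M x)⁻¹.mulVec (L (∑ j, c j • e j x)) = c := by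
    intro x hx c
    rw [hLe, Matrix.mulVec_mulVec, Matrix.nonsing_inv_mul _ (isUnit_iff_ne_zero.2 hx.2),
      Matrix.one_mulVec]
  have hTv : ∀ x ∈ B, ∀ w : E.fib x, ∑ j, T x w j • e j x = (w : G →₀ ℂ) := by
    intro x hx w
    have hw : (w : G →₀ ℂ) ∈ Submodule.span ℂ (Set.range fun i => e i x) := by
      rw [(he x (hOsub hx.1)).2]
      exact w.2
    obtain ⟨c, hc⟩ := (Submodule.mem_span_range_iff_exists_fun ℂ).1 hw
    have : T x w = c := by
      rw [hT, ← hc, hTe x hx]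
    rw [this, hc]
  refine ⟨⟨n, B, hBo, T, ?_⟩, hxB⟩
  rw [isHomeomorph_iff_exists_inverse]
  refine ⟨?_, fun q => ⟨⟨q.1, ⟨∑ j, q.2 j • e j q.1, Submodule.sum_mem _ fun j _ =>
    Submodule.smul_mem _ _ (hmem _ q.1.2.1 j)⟩⟩, q.1.2⟩, ?_, ?_, ?_⟩
  · have hp : Continuous fun p : {p : E.toVectFamily.Total // p.1 ∈ B} => (⟨p.1.1, p.2⟩ : B) :=
      (E.continuous_total_proj.comp continuous_subtype_val).subtype_mk _
    refine hp.prodMk (continuous_pi fun i => ?_)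
    have hLc : Continuous fun p : {p : E.toVectFamily.Total // p.1 ∈ B} =>
        L (E.vec p.1) := by
      refine continuous_pi fun k => ?_
      have h1 : Continuous fun p : {p : E.toVectFamily.Total // p.1 ∈ B} =>
          ∑ h ∈ S, (E.vec p.1) h * L (Finsupp.single h 1) k :=
        continuous_finsetSum _ fun h _ =>
          ((E.continuous_total_coord h).comp continuous_subtype_val).mul continuous_const
      refine h1.congr fun p => ?_
      exact (linear_eq_sum L S _ (hS _ (hOsub p.2.1).2 (show E.fib p.1.1 from p.1.2).2) k).symm
    exact (continuous_apply i).comp ((hMinv.comp hp).matrix_mulVec hLc)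
  · intro p
    refine Subtype.ext (E.total_ext rfl ?_)
    exact hTv _ p.2 p.1.2
  · intro q
    refine Prod.ext rfl ?_
    exact hTe _ q.1.2 q.2
  · refine Continuous.subtype_mk (E.continuous_to_total
      (continuous_subtype_val.comp continuous_fst) fun h => ?_) _
    have h1 : Continuous fun q : B × (Fin n → ℂ) => ∑ j, q.2 j * e j q.1 h := by
      refine continuous_finsetSum _ fun j _ => ((continuous_apply j).comp continuous_snd).mul ?_
      have : Continuous fun x : B => e j x h :=
        continuousOn_iff_continuous_domRestrict.1
          ((hcont j h).mono (Set.inter_subset_left.trans hOsub))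
      exact this.comp continuous_fst
    refine h1.congr fun q => ?_
    change ∑ j, q.2 j * e j q.1 h = (∑ j, q.2 j • e j (q.1 : X)) h
    simp [Finsupp.finsetSum_apply]

/-- The `G`-bundle defined by a standard `G`-bundle. -/
noncomputable def toGBundle [LocallyCompactSpace X] [ContinuousConstSMul G X]
    (E : StdBundle G X) : GBundle G X where
  toVectFamily := E.toVectFamily
  continuous_proj := E.continuous_total_proj
  locallyTrivial := E.locallyTrivial
  act g x := ((leftTranslate g).toLinearMap ∘ₗ (E.fib x).subtype).codRestrict (E.fib (g • x))
    fun w => E.invariant g x w w.2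
  act_one x w := E.total_ext (one_smul G x) (by
    refine Finsupp.ext fun h => (leftTranslate_apply 1 _ h).trans ?_
    rw [inv_one, one_mul]
    rfl)
  act_mul g h x w := E.total_ext (mul_smul g h x) (by
    refine Finsupp.ext fun k => ?_
    refine (leftTranslate_apply (g * h) _ k).trans ?_
    refine Eq.trans ?_ (leftTranslate_apply g _ k).symm
    refine Eq.trans ?_ (leftTranslate_apply h _ _).symm
    rw [mul_inv_rev, mul_assoc])
  continuous_act g := E.continuous_to_total
    ((continuous_const_smul g).comp E.continuous_total_proj) fun h =>
      (E.continuous_total_coord (g⁻¹ * h)).congr fun p => (leftTranslate_apply g _ h).symm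

/-- The standard inner product on `ℂ[S]`, for which the elements of `S` are orthonormal. -/
noncomputable def stdInner {S : Type*} (w z : S →₀ ℂ) : ℂ := z.sum fun h c => star (w h) * c

theorem stdInner_eq {S : Type*} (w z : S →₀ ℂ) (s : Finset S) (hs : z.support ⊆ s) :
    stdInner w z = ∑ h ∈ s, star (w h) * z h :=
  Finsupp.sum_of_support_subset _ hs _ (by simp)

/-- The standard inner product restricted to a subspace of `ℂ[S]`. -/
@[reducible]
noncomputable def stdCore {S : Type*} (F : Submodule ℂ (S →₀ ℂ)) :
    InnerProductSpace.Core ℂ F where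
  inner w z := stdInner (w : S →₀ ℂ) z
  conj_inner_symm w z := by
    classical
    change star (stdInner (z : S →₀ ℂ) w) = stdInner (w : S →₀ ℂ) z
    rw [stdInner_eq _ _ (w.1.support ∪ z.1.support) Finset.subset_union_left,
      stdInner_eq _ _ (w.1.support ∪ z.1.support) Finset.subset_union_right, star_sum]
    simp [mul_comm]
  re_inner_nonneg w := by
    rw [stdInner_eq _ _ _ subset_rfl, map_sum]
    refine Finset.sum_nonneg fun h _ => ?_
    have : star ((w : S →₀ ℂ) h) * (w : S →₀ ℂ) h = ((‖(w : S →₀ ℂ) h‖ ^ 2 : ℝ) : ℂ) := by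
      simpa using RCLike.conj_mul ((w : S →₀ ℂ) h)
    rw [this]
    exact sq_nonneg ‖(w : S →₀ ℂ) h‖
  add_left w z y := by
    change stdInner ((w : S →₀ ℂ) + (z : S →₀ ℂ)) (y : S →₀ ℂ) =
      stdInner (w : S →₀ ℂ) y + stdInner (z : S →₀ ℂ) y
    simp [stdInner_eq _ _ _ subset_rfl, add_mul, Finset.sum_add_distrib]
  smul_left w z c := by
    change stdInner (c • (w : S →₀ ℂ)) z = star c * stdInner (w : S →₀ ℂ) z
    simp [stdInner_eq _ _ _ subset_rfl, Finset.mul_sum, mul_assoc]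
  definite w hw := by
    have hw' : stdInner (w : S →₀ ℂ) w = 0 := hw
    rw [stdInner_eq _ _ _ subset_rfl] at hw'
    have h1 : ∀ h, star ((w : S →₀ ℂ) h) * (w : S →₀ ℂ) h = ((‖(w : S →₀ ℂ) h‖ ^ 2 : ℝ) : ℂ) := by
      intro h
      simpa using RCLike.conj_mul ((w : S →₀ ℂ) h)
    simp only [h1] at hw'
    rw [← Complex.ofReal_sum, Complex.ofReal_eq_zero,
      Finset.sum_eq_zero_iff_of_nonneg fun _ _ => sq_nonneg _] at hw'
    refine Subtype.ext (Finsupp.ext fun h => ?_)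
    by_contra hne
    have := hw' h (Finsupp.mem_support_iff.2 hne)
    simp at this
    exact hne this

/-- The hermitian `G`-bundle defined by a standard `G`-bundle, with the metric inherited from
`ℂ[G]`. -/
noncomputable def toHermBundle [LocallyCompactSpace X] [ContinuousConstSMul G X]
    (E : StdBundle G X) : HermBundle G X where
  toGBundle := E.toGBundle
  metric x := stdCore (E.fib x)
  continuous_metric := by
    let Q := {q : E.toVectFamily.Total × E.toVectFamily.Total // q.2.1 = q.1.1}
    have hval : ∀ q : Q, ((q.2 ▸ q.1.2.2 : E.toVectFamily.fib q.1.1.1) : E.fib q.1.1.1).1 =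
        (E.vec q.1.2) := by
      rintro ⟨⟨⟨x, w⟩, ⟨y, z⟩⟩, h⟩
      obtain rfl : y = x := h
      rfl
    rw [continuous_iff_continuousAt]
    intro q₀
    obtain ⟨K, hK, hxK⟩ := exists_compact_mem_nhds q₀.1.1.1
    obtain ⟨S, hS, -⟩ := E.isSubbundle K hK
    have hc1 : Continuous fun q : Q => q.1.1 := continuous_fst.comp continuous_subtype_val
    have hc2 : Continuous fun q : Q => q.1.2 := continuous_snd.comp continuous_subtype_val
    have h1 : Continuous fun q : Q =>
        ∑ h ∈ S, star (E.vec q.1.1 h) *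
          E.vec q.1.2 h :=
      continuous_finsetSum _ fun h _ =>
        (continuous_star.comp ((E.continuous_total_coord h).comp hc1)).mul
          ((E.continuous_total_coord h).comp hc2)
    refine h1.continuousAt.congr ?_
    have hev : ∀ᶠ q : Q in 𝓝 q₀, q.1.1.1 ∈ K :=
      (E.continuous_total_proj.comp hc1).continuousAt.eventually_mem hxK
    filter_upwards [hev] with q hq
    have hsub : (E.vec q.1.2).support ⊆ S := by
      have hq' : q.1.2.1 ∈ K := by
        rw [q.2]
        exact hq
      have : E.vec q.1.2 ∈ Finsupp.supported ℂ ℂ (S : Set G) :=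
        hS _ hq' (show E.fib q.1.2.1 from q.1.2.2).2
      exact_mod_cast (Finsupp.mem_supported ℂ _).1 this
    rw [← stdInner_eq _ _ S hsub, ← hval q]
    rfl
  metric_act g x w z := by
    change stdInner (leftTranslate g (w : E.fib x).1) (leftTranslate g (z : E.fib x).1) =
      stdInner (w : E.fib x).1 (z : E.fib x).1
    generalize (w : E.fib x).1 = a
    generalize (z : E.fib x).1 = b
    classical
    rw [stdInner_eq _ _ (b.support.image fun h => g * h), stdInner_eq _ _ _ subset_rfl,
      Finset.sum_image fun _ _ _ _ h => mul_left_cancel h]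
    · simp [leftTranslate_apply]
    · intro h hh
      rw [Finsupp.mem_support_iff, leftTranslate_apply] at hh
      exact Finset.mem_image.2 ⟨g⁻¹ * h, Finsupp.mem_support_iff.2 hh, by simp⟩

/-- Two standard `G`-bundles are isomorphic if they are isomorphic as `G`-bundles. -/
instance setoid [LocallyCompactSpace X] [ContinuousConstSMul G X] : Setoid (StdBundle G X) where
  r E F := Nonempty (E.toGBundle.Iso F.toGBundle)
  iseqv :=
    { refl := fun _ => ⟨GBundle.Iso.refl _⟩
      symm := fun ⟨φ⟩ => ⟨φ.symm⟩
      trans := fun ⟨φ⟩ ⟨ψ⟩ => ⟨φ.trans ψ⟩ }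

end StdBundle

section RangeBundle

variable {G : Type v} {X : Type u} [Group G] [TopologicalSpace X] [MulAction G X]

theorem exists_fin_basis {V : Type*} [AddCommGroup V] [Module ℂ V] (F : Submodule ℂ V)
    [FiniteDimensional ℂ F] : ∃ (n : ℕ) (b : Fin n → V), LinearIndependent ℂ b ∧
      Submodule.span ℂ (Set.range b) = F := by
  let b := Module.finBasis ℂ F
  refine ⟨_, fun i => (b i : V), b.linearIndependent.map' F.subtype F.ker_subtype, ?_⟩
  have h := congrArg (Submodule.map F.subtype) b.span_eq
  rw [Submodule.map_span, Submodule.map_top, Submodule.range_subtype, ← Set.range_comp] at h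
  exact h

/-- Near each point, the ranges of a standard projection valued function are spanned by
continuous linearly independent sections. -/
theorem IsStandardFun.exists_frame {G : Type v} {X : Type u} [TopologicalSpace X] {F : X → FinMat G} (hF : IsStandardFun F)
    (hP : ∀ x, F x * F x = F x) {K : Set X} {S : Finset G}
    (hS : ∀ x ∈ K, ∀ i j, F x i j ≠ 0 → i ∈ S ∧ j ∈ S) {x₀ : X} (hx₀ : x₀ ∈ K) :
    ∃ U ∈ 𝓝 x₀, ∃ (n : ℕ) (e : Fin n → X → (G →₀ ℂ)),
      (∀ i h, ContinuousOn (fun x => e i x h) (U ∩ K)) ∧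
      ∀ x ∈ U ∩ K, LinearIndependent ℂ (fun i => e i x) ∧
        Submodule.span ℂ (Set.range fun i => e i x) = LinearMap.range (F x).toLin := by
  classical
  have hsupp : ∀ x ∈ K, ∀ w i, (F x).toLin w i ≠ 0 → i ∈ S := by
    intro x hx w i h
    by_contra hi
    apply h
    rw [FinMat.toLin_apply _ _ _ S fun j hj _ => (hS x hx i j hj).2]
    refine Finset.sum_eq_zero fun j _ => ?_
    have : F x i j = 0 := by
      by_contra hne
      exact hi (hS x hx i j hne).1
    simp [this]
  have hidem : ∀ x w, (F x).toLin ((F x).toLin w) = (F x).toLin w := fun x w => by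
    rw [← FinMat.toLin_mul, hP]
  let M : X → Matrix S S ℂ := fun x => Matrix.of fun i j => F x i j
  let ρ : (G →₀ ℂ) → (S → ℂ) := fun w i => w i
  have hMρ : ∀ x ∈ K, ∀ w, (M x).mulVec (ρ w) = ρ ((F x).toLin w) := by
    intro x hx w
    ext i
    simp only [ρ, M]
    rw [FinMat.toLin_apply _ _ _ S fun j hj _ => (hS x hx i j hj).2, ← Finset.sum_coe_sort]
    rfl
  have hMM : ∀ x ∈ K, M x * M x = M x := by
    intro x hx
    ext i k
    rw [Matrix.mul_apply]
    have : (F x * F x) i k = F x i k := by rw [hP]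
    rw [FinMat.mul_apply_sum S fun j hj _ => (hS x hx i j hj).2, ← Finset.sum_coe_sort] at this
    exact this
  have hMc : Continuous M := continuous_matrix fun i j => hF.continuous_entry i j
  let W : X → Matrix S S ℂ := fun x => M x * M x₀ + (1 - M x) * (1 - M x₀)
  have hWc : Continuous fun x => (W x).det := by
    refine Continuous.matrix_det ?_
    exact (hMc.mul continuous_const).add ((continuous_const.sub hMc).mul continuous_const)
  have hW0 : W x₀ = 1 := by
    simp only [W]
    have := hMM x₀ hx₀
    rw [mul_sub, sub_mul, sub_mul, this]
    simp
  have hinjρ : ∀ w z : G →₀ ℂ, (∀ i, w i ≠ 0 → i ∈ S) → (∀ i, z i ≠ 0 → i ∈ S) → ρ w = ρ z →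
      w = z := by
    intro w z hw hz h
    refine Finsupp.ext fun i => ?_
    by_cases hi : i ∈ S
    · exact congrFun h ⟨i, hi⟩
    · rw [not_not.1 fun h => hi (hw i h), not_not.1 fun h => hi (hz i h)]
  have hfd : FiniteDimensional ℂ (LinearMap.range (F x₀).toLin) := by
    have h1 : FiniteDimensional ℂ (Finsupp.supported ℂ ℂ (S : Set G)) := by
      rw [Finsupp.supported_eq_span_single]
      exact FiniteDimensional.span_of_finite ℂ (S.finite_toSet.image _)
    refine Submodule.finiteDimensional_of_le (S₂ := Finsupp.supported ℂ ℂ (S : Set G)) ?_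
    rintro _ ⟨w, rfl⟩
    rw [Finsupp.mem_supported]
    intro i hi
    exact hsupp x₀ hx₀ w i (Finsupp.mem_support_iff.1 hi)
  obtain ⟨n, b, hbli, hbspan⟩ := exists_fin_basis (LinearMap.range (F x₀).toLin)
  refine ⟨{x | (W x).det ≠ 0}, (isOpen_ne.preimage hWc).mem_nhds (by simp [hW0]),
    n, fun i x => (F x).toLin (b i), fun i h => ?_, ?_⟩
  · have h1 : Continuous fun x => ∑ j ∈ (b i).support, F x h j * (b i) j :=
      continuous_finsetSum _ fun j _ => (hF.continuous_entry h j).mul continuous_const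
    refine (h1.congr fun x => ?_).continuousOn
    exact (FinMat.toLin_apply _ _ _ _ fun j _ hj => Finsupp.mem_support_iff.2 hj).symm
  · rintro x ⟨hxU, hxK⟩
    have hdet : IsUnit (W x).det := isUnit_iff_ne_zero.2 hxU
    have hfix : ∀ w ∈ LinearMap.range (F x₀).toLin, (F x₀).toLin w = w := by
      rintro _ ⟨w, rfl⟩
      exact hidem _ _
    constructor
    · rw [Fintype.linearIndependent_iff]
      intro c hc
      set w : G →₀ ℂ := ∑ i, c i • b i with hw
      have hwm : w ∈ LinearMap.range (F x₀).toLin := by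
        rw [← hbspan]
        exact Submodule.sum_mem _ fun i _ =>
          Submodule.smul_mem _ _ (Submodule.subset_span ⟨i, rfl⟩)
      have h1 : (F x).toLin w = 0 := by
        rw [← hc, hw]
        simp
      have h2 := hfix w hwm
      have h3 : (W x).mulVec (ρ w) = 0 := by
        have h30 : (1 - M x₀).mulVec (ρ w) = 0 := by
          rw [Matrix.sub_mulVec, Matrix.one_mulVec, hMρ _ hx₀, h2, sub_self]
        change (M x * M x₀ + (1 - M x) * (1 - M x₀)).mulVec (ρ w) = 0
        rw [Matrix.add_mulVec, ← Matrix.mulVec_mulVec (ρ w) (M x),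
          ← Matrix.mulVec_mulVec (ρ w) (1 - M x), h30, Matrix.mulVec_zero,
          hMρ _ hx₀, h2, hMρ _ hxK, h1, add_zero]
        rfl
      have h4 : ρ w = 0 := by
        have := congrArg ((W x)⁻¹).mulVec h3
        rwa [Matrix.mulVec_mulVec, Matrix.nonsing_inv_mul _ hdet, Matrix.one_mulVec,
          Matrix.mulVec_zero] at this
      have h5 : w = 0 := by
        refine hinjρ _ _ (fun i hi => ?_) (fun i hi => absurd rfl hi) (h4.trans rfl)
        rw [← h2] at hi
        exact hsupp x₀ hx₀ _ i hi
      exact Fintype.linearIndependent_iff.1 hbli c h5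
    · refine le_antisymm ?_ ?_
      · rw [Submodule.span_le]
        rintro _ ⟨i, rfl⟩
        exact ⟨_, rfl⟩
      · rintro w ⟨w', rfl⟩
        set w := (F x).toLin w' with hw
        have hww : (F x).toLin w = w := hidem _ _
        let z : S → ℂ := ((W x)⁻¹).mulVec (ρ w)
        let y : G →₀ ℂ := Finsupp.onFinset S (fun h => if hh : h ∈ S then z ⟨h, hh⟩ else 0)
          fun h hne => by
            by_contra hh
            simp [hh] at hne
        have hy : ρ y = z := by
          ext i
          simp [ρ, y]
        have h1 : (W x).mulVec z = ρ w := by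
          simp only [z]
          rw [Matrix.mulVec_mulVec, Matrix.mul_nonsing_inv _ hdet, Matrix.one_mulVec]
        have h2 : M x * W x = M x * M x₀ := by
          have hz : M x * (1 - M x) = 0 := by
            rw [mul_sub, mul_one, hMM x hxK, sub_self]
          simp only [W]
          rw [mul_add, ← mul_assoc, ← mul_assoc, hMM x hxK, hz, zero_mul, add_zero]
        have h3 : ρ w = ρ ((F x).toLin ((F x₀).toLin y)) := by
          calc ρ w = (M x).mulVec (ρ w) := by rw [hMρ x hxK, hww]
            _ = (M x * W x).mulVec z := by rw [← h1, Matrix.mulVec_mulVec]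
            _ = ρ ((F x).toLin ((F x₀).toLin y)) := by
              rw [h2, ← Matrix.mulVec_mulVec, ← hy, hMρ x₀ hx₀, hMρ x hxK]
        have h4 : w = (F x).toLin ((F x₀).toLin y) :=
          hinjρ _ _ (fun i hi => hsupp x hxK _ i hi) (fun i hi => hsupp x hxK _ i hi) h3
        have h5 : (F x₀).toLin y ∈ Submodule.span ℂ (Set.range b) := by
          rw [hbspan]
          exact ⟨y, rfl⟩
        obtain ⟨c, hc⟩ := (Submodule.mem_span_range_iff_exists_fun ℂ).1 h5
        rw [h4, ← hc, map_sum]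
        refine Submodule.sum_mem _ fun i _ => ?_
        rw [map_smul]
        exact Submodule.smul_mem _ _ (Submodule.subset_span ⟨i, rfl⟩)

theorem IsEquivariantFun.toLin_leftTranslate {G : Type v} {X : Type u} [Group G] [MulAction G X]
    {F : X → FinMat G} (hF : IsEquivariantFun F) (g : G)
    (x : X) (w : G →₀ ℂ) :
    (F (g • x)).toLin (leftTranslate g w) = leftTranslate g ((F x).toLin w) := by
  classical
  refine Finsupp.ext fun i => ?_
  rw [leftTranslate_apply, FinMat.toLin_apply _ _ _ (w.support.image fun h => g * h) fun j _ h => ?_,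
    FinMat.toLin_apply _ _ _ w.support fun j _ h => Finsupp.mem_support_iff.2 h,
    Finset.sum_image fun _ _ _ _ h => mul_left_cancel h]
  · simp [hF g x, leftTranslate_apply]
  · rw [leftTranslate_apply] at h
    exact Finset.mem_image.2 ⟨g⁻¹ * j, Finsupp.mem_support_iff.2 h, by simp⟩

variable [ContinuousConstSMul G X] [T2Space X] [LocallyCompactSpace X]
  [CompactSpace (MulAction.orbitRel.Quotient G X)]

/-- The range of a projection `P` in `𝒞(X, G)`: the standard `G`-bundle whose fibre at `x` is the
range of the operator `P(x)` on `ℂ[G]`. -/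
noncomputable def rangeBundle (P : Proj (StdAlg G X)) : StdBundle G X where
  fib x := LinearMap.range (P.1.1 x).toLin
  invariant := by
    rintro g x _ ⟨w, rfl⟩
    exact ⟨leftTranslate g w, IsEquivariantFun.toLin_leftTranslate P.1.2.2 g x w⟩
  isSubbundle K hK := by
    obtain ⟨S, hS⟩ := P.1.2.1.exists_finset hK
    refine ⟨S, ?_, fun x₀ hx₀ => P.1.2.1.exists_frame (fun x => ?_) hS hx₀⟩
    · rintro x hx _ ⟨w, rfl⟩
      rw [Finsupp.mem_supported]
      intro i hi
      by_contra hiS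
      apply Finsupp.mem_support_iff.1 hi
      rw [FinMat.toLin_apply _ _ _ S fun j hj _ => (hS x hx i j hj).2]
      refine Finset.sum_eq_zero fun j _ => ?_
      have : P.1.1 x i j = 0 := by
        by_contra hne
        exact hiS (hS x hx i j hne).1
      simp [this]
    · exact congrFun (congrArg Subtype.val P.2.isIdempotentElem) x

end RangeBundle

/-! ## Smooth bundles -/

section Smooth

variable {E : Type*} [NormedAddCommGroup E] [NormedSpace ℝ E] {M : Type*} [TopologicalSpace M]
  (I : ModelWithCorners ℝ E M) {X : Type u} [TopologicalSpace X] [ChartedSpace M X]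

/-- A fibrewise linear map `φ : V → W` covering `f : X → X` is smooth with respect to given local
trivializations of `V` and `W` if, wherever this makes sense, it is locally given in these
trivializations by a matrix with smooth entries. -/
def VectFamily.SmoothIn {V W : VectFamily.{u, v} X} (e : V.LocalTriv) (e' : W.LocalTriv)
    (f : X → X) (φ : ∀ x, V.fib x →ₗ[ℂ] W.fib (f x)) : Prop :=
  ∀ x ∈ e.base, f x ∈ e'.base → ∃ a : X → Matrix (Fin e'.rank) (Fin e.rank) ℂ,
    (∀ i j, ContMDiffAt I 𝓘(ℝ, ℂ) ∞ (fun y => a y i j) x) ∧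
    ∀ᶠ y in 𝓝 x, ∀ w : V.fib y, e'.toFun (f y) (φ y w) = (a y).mulVec (e.toFun y w)

variable {G : Type v} [Group G] [MulAction G X]

/-- A smooth structure on a `G`-bundle: an atlas of local trivializations with smooth transition
functions for which the action of `G` is smooth. -/
structure SmoothStructure (V : GBundle G X) where
  atlas : Set V.LocalTriv
  cover : ∀ x, ∃ e ∈ atlas, x ∈ e.base
  compatible : ∀ e ∈ atlas, ∀ e' ∈ atlas,
    VectFamily.SmoothIn I e e' id fun _ => LinearMap.id
  smooth_act : ∀ g : G, ∀ e ∈ atlas, ∀ e' ∈ atlas,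
    VectFamily.SmoothIn I e e' (fun x => g • x) (V.act g)

variable {I}

/-- An isomorphism between `G`-bundles with smooth structures is smooth (a diffeomorphism) if it
and its inverse are smooth in all local trivializations of the two atlases. -/
def GBundle.Iso.IsSmooth {V W : GBundle G X} (s : SmoothStructure I V) (t : SmoothStructure I W)
    (φ : V.Iso W) : Prop :=
  (∀ e ∈ s.atlas, ∀ e' ∈ t.atlas,
    VectFamily.SmoothIn I e e' id fun x => (φ.toEquiv x).toLinearMap) ∧
  ∀ e' ∈ t.atlas, ∀ e ∈ s.atlas,
    VectFamily.SmoothIn I e' e id fun x => (φ.toEquiv x).symm.toLinearMap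

theorem VectFamily.SmoothIn.comp {V W Z : VectFamily.{u, v} X} {t : Set W.LocalTriv}
    (ht : ∀ x, ∃ e ∈ t, x ∈ e.base) {e : V.LocalTriv} {e'' : Z.LocalTriv}
    {φ : ∀ x, V.fib x →ₗ[ℂ] W.fib x} {ψ : ∀ x, W.fib x →ₗ[ℂ] Z.fib x}
    (hφ : ∀ e' ∈ t, VectFamily.SmoothIn I e e' id φ)
    (hψ : ∀ e' ∈ t, VectFamily.SmoothIn I e' e'' id ψ) :
    VectFamily.SmoothIn I e e'' id fun x => ψ x ∘ₗ φ x := by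
  intro x hx hx''
  obtain ⟨e', he', hx'⟩ := ht x
  obtain ⟨a, ha, ha'⟩ := hφ e' he' x hx hx'
  obtain ⟨b, hb, hb'⟩ := hψ e' he' x hx' hx''
  refine ⟨fun y => b y * a y, fun i j => ?_, ?_⟩
  · simp only [Matrix.mul_apply]
    refine contMDiffAt_finsetSum fun k _ => ?_
    exact (contDiff_mul (𝕜 := ℝ) (𝔸 := ℂ)).contMDiff.contMDiffAt.comp x
      ((hb i k).prodMk_space (ha k j))
  · filter_upwards [ha', hb'] with y h1 h2 w
    rw [← Matrix.mulVec_mulVec, ← h1]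
    exact h2 _

/-- A smooth hermitian `G`-bundle: a hermitian `G`-bundle with a smooth structure for which the
metric is smooth, i.e. locally given by a Gram matrix with smooth entries. -/
structure SmoothHermBundle {E : Type*} [NormedAddCommGroup E] [NormedSpace ℝ E] {M : Type*}
    [TopologicalSpace M] (I : ModelWithCorners ℝ E M) (G : Type v) (X : Type u)
    [TopologicalSpace X] [ChartedSpace M X] [Group G] [MulAction G X]
    extends HermBundle G X where
  smooth : SmoothStructure I toGBundle
  smooth_metric : ∀ e ∈ smooth.atlas, ∀ x ∈ e.base,
    ∃ h : X → Matrix (Fin e.rank) (Fin e.rank) ℂ,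
      (∀ i j, ContMDiffAt I 𝓘(ℝ, ℂ) ∞ (fun y => h y i j) x) ∧
      ∀ᶠ y in 𝓝 x, ∀ w z : fib y,
        (metric y).inner w z = star (e.toFun y w) ⬝ᵥ (h y).mulVec (e.toFun y z)

/-- Two smooth hermitian `G`-bundles are isomorphic if there is a smooth isometric isomorphism of
`G`-bundles between them. -/
instance SmoothHermBundle.setoid : Setoid (SmoothHermBundle I G X) where
  r V W := ∃ φ : V.toGBundle.Iso W.toGBundle,
    HermBundle.IsIsometric (V := V.toHermBundle) (W := W.toHermBundle) φ ∧
    φ.IsSmooth V.smooth W.smooth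
  iseqv :=
    { refl := fun V => ⟨GBundle.Iso.refl _, fun _ _ _ => rfl,
        V.smooth.compatible, V.smooth.compatible⟩
      symm := by
        rintro V W ⟨φ, h, hs⟩
        refine ⟨φ.symm, fun x w z => ?_, hs.2, hs.1⟩
        rw [← h x]
        simp [GBundle.Iso.symm]
      trans := by
        rintro V W Z ⟨φ, h, hs⟩ ⟨ψ, h', hs'⟩
        refine ⟨φ.trans ψ, fun x w z => (h' x _ _).trans (h x w z), ?_, ?_⟩
        · intro e he e'' he''
          exact VectFamily.SmoothIn.comp W.smooth.cover (hs.1 e he)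
            fun e' he' => hs'.1 e' he' e'' he''
        · intro e'' he'' e he
          exact VectFamily.SmoothIn.comp W.smooth.cover (hs'.2 e'' he'')
            fun e' he' => hs.2 e' he' e he }

end Smooth

/-!
A projection in `𝒞(X, G)` is a family of orthogonal projections in `ℂ[G]`, and a bundle is compared
with projections by embedding it into `X × ℂ[G]`. An embedding `T` of a `G`-bundle
(`GBundle.Embedding`) has a projection onto its range (`GBundle.Embedding.proj`). Two embeddings of
isomorphic bundles differ by an invertible operator between the ranges, whose polar decomposition
is a partial isometry in `𝒞(X, G)`, so that their projections are equivalent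
(`GBundle.Embedding.proj_equiv`). Conversely, a partial isometry between the ranges of two
embeddings gives an isomorphism of the bundles (`GBundle.Embedding.isoOf`), which is isometric if
the embeddings are. As a standard bundle comes with an embedding, this already relates (a) and (c),
and shows that isomorphic standard bundles are isometrically isomorphic. That every bundle has an
embedding (`GBundle.exists_embedding`) is where properness, compactness of `X/G` and the
infiniteness of `G` are used: finitely many coordinate functionals, cut off by bump functions, are
spread over the group `G` by translations that keep their supports apart. Using orthonormal frames,
one obtains isometric embeddings of hermitian bundles (`HermBundle.exists_isometric_embedding`).

For (a) and (b), elements of `C^*(X, G)` are approximated uniformly by elements of `𝒞(X, G)`, with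
an invariant partition of unity (`exists_stdAlg_near`). A self-adjoint element close to a projection
has a spectral projection nearby, which is equivalent to it (`exists_proj_near`), and a partial
isometry in `C^*(X, G)` between projections in `𝒞(X, G)` automatically lies in `𝒞(X, G)`
(`exists_stdAlg_of_partialIsometry`).

Continuous and smooth bundles are treated at the same time. A `RegClass` is a notion of regularity
for complex functions on `X` that is stable under smooth functions of finitely many variables; the
two instances are continuity and smoothness. All constructions preserve regularity. This rests on
the fact that square roots of strictly positive elements of a `C^*`-algebra depend smoothly on the
element (`IsStrictlyPositive.exists_contDiffAt_sqrt`), by the inverse function theorem.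
The approximation theorem provides smooth projections and smooth partial isometries
(`Proj.exists_regular`, `Proj.exists_regular_partialIsometry`). Hence every bundle embeds onto the
range of a smooth projection, which gives it a smooth structure
(`GBundle.Embedding.regStructure`), and smooth bundles that are isomorphic are isomorphic via a
smooth isomorphism.
-/

/-! ### Square roots, polar decomposition and spectral projections -/

section CStar

variable {A : Type*} [CStarAlgebra A]

/-- The norm here is that of the `C^*`-algebra structure, which for operators on `ℓ²(G)` unification
does not find with the general `norm_star`. -/
theorem CStarAlgebra.norm_star (a : A) : ‖star a‖ = ‖a‖ := _root_.norm_star a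

theorem norm_le_one_of_star_mul_self {p u : A} (hp : IsStarProjection p) (h : star u * u = p) :
    ‖u‖ ≤ 1 := by
  have h1 := CStarRing.norm_star_mul_self (x := u)
  rw [h] at h1
  have := hp.norm_le
  by_contra hc
  nlinarith [norm_nonneg u]

theorem commute_polar {p t : A} (hp : IsStarProjection p) (htp : t * p = t) :
    Commute (1 + (star t * t - p)) p := by
  have h1 : p * star t = star t := by
    rw [← hp.isSelfAdjoint.star_eq, ← star_mul, htp]
  refine (Commute.one_left p).add_left (Commute.sub_left ?_ (Commute.refl p))
  change star t * t * p = p * (star t * t)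
  rw [mul_assoc, htp, ← mul_assoc, h1]

theorem isUnit_polar_of_norm_lt {p t : A} (h : ‖star t * t - p‖ < 1) :
    IsUnit (1 + (star t * t - p)) := by
  have := (Units.oneSub (-(star t * t - p)) (by rwa [norm_neg])).isUnit
  rwa [Units.val_oneSub, sub_neg_eq_add] at this

theorem mul_right_eq_of_star_mul_self {p u : A} (hp : IsStarProjection p)
    (hup : star u * u = p) : u * p = u := by
  -- `(u p - u)^* (u p - u) = p p p - p p - p p + p = 0`
  have : star (u * p - u) * (u * p - u) = 0 := by
    rw [star_sub, star_mul, hp.isSelfAdjoint.star_eq]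
    simp only [sub_mul, mul_sub]
    have e1 : p * star u * (u * p) = p * (star u * u) * p := by simp only [mul_assoc]
    have e2 : star u * (u * p) = star u * u * p := by simp only [mul_assoc]
    have e3 : p * star u * u = p * (star u * u) := by simp only [mul_assoc]
    rw [e1, e2, e3, hup, hp.isIdempotentElem.eq, hp.isIdempotentElem.eq]
    abel
  exact sub_eq_zero.1 ((CStarRing.star_mul_self_eq_zero_iff _).1 this)

theorem isUnit_polar_of_near {p q u a : A} (hp : IsStarProjection p) (hq : IsStarProjection q)
    (hup : star u * u = p) (huq : u * star u = q) (h : ‖a - u‖ < 1 / 4) :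
    IsUnit (1 + (star (q * a * p) * (q * a * p) - p)) ∧
      IsUnit (1 + ((q * a * p) * star (q * a * p) - q)) := by
  have hun : ‖u‖ ≤ 1 := norm_le_one_of_star_mul_self hp hup
  have hun' : ‖star u‖ ≤ 1 := by rwa [norm_star]
  have h3 : u * p = u := mul_right_eq_of_star_mul_self hp hup
  have h4 : q * u = u := by rw [← huq, mul_assoc, hup, h3]
  set t := q * a * p with htdef
  have h5 : ‖t - u‖ < 1 / 4 := by
    have : t - u = q * (a - u) * p := by rw [mul_sub, sub_mul, h4, h3]
    rw [this]
    calc ‖q * (a - u) * p‖ ≤ ‖q‖ * ‖a - u‖ * ‖p‖ :=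
          (norm_mul_le _ _).trans (mul_le_mul_of_nonneg_right (norm_mul_le _ _) (norm_nonneg _))
      _ ≤ 1 * ‖a - u‖ * 1 := by
          gcongr
          exacts [hq.norm_le, hp.norm_le]
      _ < 1 / 4 := by simpa using h
  have h5' : ‖star t - star u‖ < 1 / 4 := by rwa [← star_sub, norm_star]
  have hbound : ∀ c d c' d' : A, ‖d‖ ≤ 1 → ‖d'‖ ≤ 1 → ‖c - d‖ < 1 / 4 →
      ‖c' - d'‖ < 1 / 4 → ‖c * c' - d * d'‖ < 1 := by
    intro c d c' d' hd hd' hc hc'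
    have : c * c' - d * d' = (c - d) * (c' - d') + (c - d) * d' + d * (c' - d') := by
      simp only [sub_mul, mul_sub]
      abel
    rw [this]
    have n1 := norm_mul_le (c - d) (c' - d')
    have n2 := norm_mul_le (c - d) d'
    have n3 := norm_mul_le d (c' - d')
    have n4 := norm_add₃_le (a := (c - d) * (c' - d')) (b := (c - d) * d') (c := d * (c' - d'))
    nlinarith [norm_nonneg (c - d), norm_nonneg (c' - d'), norm_nonneg d, norm_nonneg d']
  constructor
  · refine isUnit_polar_of_norm_lt ?_
    rw [← hup]
    exact hbound _ _ _ _ hun' hun h5' h5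
  · have := isUnit_polar_of_norm_lt (p := q) (t := star t) (by
      rw [← huq, star_star]
      exact hbound _ _ _ _ hun hun' h5 h5')
    rwa [star_star] at this

theorem norm_polar_mul_lt {p q : A} (hp : IsStarProjection p) (hq : IsStarProjection q)
    (h : ‖p - q‖ < 1) : ‖star (q * p) * (q * p) - p‖ < 1 := by
  have hpp := hp.isIdempotentElem.eq
  have hqq := hq.isIdempotentElem.eq
  have h1 : star (q * p) * (q * p) - p = -(p * (p - q) * p) := by
    rw [star_mul, hp.isSelfAdjoint.star_eq, hq.isSelfAdjoint.star_eq, mul_sub, sub_mul, hpp, hpp,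
      mul_assoc p q, ← mul_assoc q q, hqq, mul_assoc]
    abel
  rw [h1, norm_neg]
  calc ‖p * (p - q) * p‖ ≤ ‖p‖ * ‖p - q‖ * ‖p‖ :=
        (norm_mul_le _ _).trans (mul_le_mul_of_nonneg_right (norm_mul_le _ _) (norm_nonneg _))
    _ ≤ 1 * ‖p - q‖ * 1 := by
        gcongr
        exacts [hp.norm_le, hp.norm_le]
    _ < 1 := by simpa using h

/-- If `t` has an inverse `t'` as a map from the range of `p` to that of `q`, then
`t' t'^* + 1 - p` is inverse to `t^* t + 1 - p`. -/
theorem isUnit_polar_of_inverse {p q t t' : A} (hp : IsStarProjection p) (hq : IsStarProjection q)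
    (htp : t * p = t) (hpt' : p * t' = t') (ht'q : t' * q = t')
    (h1 : t' * t = p) (h2 : t * t' = q) : IsUnit (1 + (star t * t - p)) := by
  have hpt : p * star t = star t := by
    rw [← hp.isSelfAdjoint.star_eq, ← star_mul, htp]
  have htp' : star t' * p = star t' := by
    rw [← hp.isSelfAdjoint.star_eq, ← star_mul, hpt']
  have hqt' : q * star t' = star t' := by
    rw [← hq.isSelfAdjoint.star_eq, ← star_mul, ht'q]
  have h3 : (star t * t) * (t' * star t') = p := by
    calc (star t * t) * (t' * star t') = star t * ((t * t') * star t') := by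
          simp only [mul_assoc]
      _ = star (t' * t) := by rw [h2, hqt', star_mul]
      _ = p := by rw [h1, hp.isSelfAdjoint.star_eq]
  have h4 : (t' * star t') * (star t * t) = p := by
    have := congrArg star h3
    simpa [star_mul, hp.isSelfAdjoint.star_eq, mul_assoc] using this
  have h5 : star t * t * p = star t * t := by rw [mul_assoc, htp]
  have h6 : p * (star t * t) = star t * t := by rw [← mul_assoc, hpt]
  have h7 : t' * star t' * p = t' * star t' := by rw [mul_assoc, htp']
  have h8 : p * (t' * star t') = t' * star t' := by rw [← mul_assoc, hpt']
  have hpp := hp.isIdempotentElem.eq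
  refine ⟨⟨1 + (star t * t - p), 1 + (t' * star t' - p), ?_, ?_⟩, rfl⟩
  · simp only [add_mul, sub_mul, mul_add, mul_sub, one_mul, mul_one, h3, h5, h8, hpp]
    abel
  · simp only [add_mul, sub_mul, mul_add, mul_sub, one_mul, mul_one, h4, h6, h7, hpp]
    abel

variable [PartialOrder A] [StarOrderedRing A]

theorem IsStrictlyPositive.exists_norm_one_sub_smul_lt {r : A} (hr : IsStrictlyPositive r) :
    ∃ c : ℝ, 0 < c ∧ ‖1 - (c : ℂ)⁻¹ • r‖ < 1 := by
  rcases subsingleton_or_nontrivial A with h | h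
  · exact ⟨1, one_pos, by simp [Subsingleton.elim _ (0 : A)]⟩
  obtain ⟨δ, hδ, h⟩ := (CFC.exists_pos_algebraMap_le_iff (A := A) (a := r)
    hr.isSelfAdjoint).2 (fun x hx => hr.spectrum_pos hx)
  have hr0 : 0 < ‖r‖ := norm_pos_iff.2 hr.isUnit.ne_zero
  have hle := IsSelfAdjoint.le_algebraMap_norm_self hr.isSelfAdjoint
  refine ⟨‖r‖, hr0, ?_⟩
  have hsm : ((‖r‖ : ℝ) : ℂ)⁻¹ • r = (‖r‖⁻¹ : ℝ) • r := by
    rw [← Complex.ofReal_inv, Complex.coe_smul]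
  have h1 : (0 : A) ≤ 1 - (‖r‖⁻¹ : ℝ) • r := by
    have := smul_le_smul_of_nonneg_left hle (inv_nonneg.2 hr0.le)
    rw [Algebra.algebraMap_eq_smul_one, smul_smul, inv_mul_cancel₀ hr0.ne', one_smul] at this
    exact sub_nonneg.2 this
  have h2 : 1 - (‖r‖⁻¹ : ℝ) • r ≤ algebraMap ℝ A (1 - ‖r‖⁻¹ * δ) := by
    have := smul_le_smul_of_nonneg_left h (inv_nonneg.2 hr0.le)
    rw [Algebra.algebraMap_eq_smul_one, smul_smul] at this
    rw [Algebra.algebraMap_eq_smul_one, sub_smul, one_smul]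
    exact sub_le_sub_left this 1
  have hd : 0 < ‖r‖⁻¹ * δ := by positivity
  rw [hsm]
  by_cases h3 : 0 ≤ 1 - ‖r‖⁻¹ * δ
  · have := (CStarAlgebra.norm_le_iff_le_algebraMap _ h3 h1).2 h2
    linarith
  · have h4 : 1 - (‖r‖⁻¹ : ℝ) • r ≤ algebraMap ℝ A 0 := by
      refine h2.trans ?_
      rw [Algebra.algebraMap_eq_smul_one, Algebra.algebraMap_eq_smul_one]
      exact smul_le_smul_of_nonneg_right (not_le.1 h3).le zero_le_one
    have := (CStarAlgebra.norm_le_iff_le_algebraMap _ le_rfl h1).2 h4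
    linarith

/-- For strictly positive `r` the map `X ↦ r X + X r` is invertible: after rescaling, `r = 1 - k`
with `‖k‖ < 1`, and the map is twice a perturbation of the identity of norm less than `1`. -/
theorem IsStrictlyPositive.exists_equiv_mul_add_mul {r : A} (hr : IsStrictlyPositive r) :
    ∃ e : A ≃L[ℂ] A, ∀ x, e x = r * x + x * r := by
  obtain ⟨c, hc, hk⟩ := hr.exists_norm_one_sub_smul_lt
  set k : A := 1 - (c : ℂ)⁻¹ • r with hkdef
  have hc' : (c : ℂ) ≠ 0 := by exact_mod_cast hc.ne'
  have hr' : r = (c : ℂ) • (1 - k) := by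
    rw [hkdef, sub_sub_cancel, smul_smul, mul_inv_cancel₀ hc', one_smul]
  let D : A →L[ℂ] A := (2 : ℂ)⁻¹ •
    (ContinuousLinearMap.mul ℂ A k + (ContinuousLinearMap.mul ℂ A).flip k)
  have hD : ‖D‖ < 1 := by
    refine lt_of_le_of_lt (ContinuousLinearMap.opNorm_le_bound D (norm_nonneg k) fun x => ?_) hk
    have : D x = (2 : ℂ)⁻¹ • (k * x + x * k) := rfl
    rw [this, norm_smul]
    have h1 : ‖k * x + x * k‖ ≤ 2 * (‖k‖ * ‖x‖) := by
      calc ‖k * x + x * k‖ ≤ ‖k * x‖ + ‖x * k‖ := norm_add_le _ _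
        _ ≤ ‖k‖ * ‖x‖ + ‖x‖ * ‖k‖ := add_le_add (norm_mul_le _ _) (norm_mul_le _ _)
        _ = _ := by ring
    have h2 : ‖(2 : ℂ)⁻¹‖ = 2⁻¹ := by simp
    rw [h2]
    linarith
  let u : (A →L[ℂ] A)ˣ := Units.oneSub D hD
  have hu : ∀ x, (u : A →L[ℂ] A) x = x - (2 : ℂ)⁻¹ • (k * x + x * k) := fun x => rfl
  have h2c : (2 * c : ℂ) ≠ 0 := mul_ne_zero two_ne_zero hc'
  refine ⟨(ContinuousLinearEquiv.unitsEquiv ℂ A u).trans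
    (ContinuousLinearEquiv.smulLeft (Units.mk0 (2 * c : ℂ) h2c)), fun x => ?_⟩
  have : ((ContinuousLinearEquiv.unitsEquiv ℂ A u).trans
    (ContinuousLinearEquiv.smulLeft (Units.mk0 (2 * c : ℂ) h2c))) x =
    (2 * c : ℂ) • ((u : A →L[ℂ] A) x) := rfl
  rw [this, hu, hr', smul_sub, smul_smul, mul_right_comm, mul_inv_cancel₀ two_ne_zero, one_mul]
  simp only [smul_mul_assoc, mul_smul_comm, sub_mul, mul_sub, one_mul, mul_one]
  module

/-- The square root of positive elements extends to a smooth function near each strictly positive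
element. -/
theorem IsStrictlyPositive.exists_contDiffAt_sqrt {a : A} (ha : IsStrictlyPositive a) :
    ∃ g : A → A, ContDiffAt ℂ ∞ g a ∧ ∀ᶠ b in 𝓝 a, 0 ≤ b → g b = CFC.sqrt b := by
  set r := CFC.sqrt a with hr
  have hrr : r * r = a := CFC.sqrt_mul_sqrt_self a ha.nonneg
  have hrp : IsStrictlyPositive r := IsStrictlyPositive.sqrt a ha
  obtain ⟨e, he⟩ := hrp.exists_equiv_mul_add_mul
  have hcd : ContDiffAt ℂ ∞ (fun x : A => x * x) r := contDiffAt_id.mul contDiffAt_id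
  have hfd : HasFDerivAt (fun x : A => x * x) (e : A →L[ℂ] A) r := by
    have h1 := (hasFDerivAt_id (𝕜 := ℂ) r).mul' (hasFDerivAt_id r)
    refine h1.congr_fderiv ?_
    ext x
    simp [he]
  have hst := hcd.hasStrictFDerivAt' hfd (by simp)
  refine ⟨hcd.localInverse hfd (by simp), ?_, ?_⟩
  · have := hcd.to_localInverse hfd (by simp)
    rwa [hrr] at this
  · have hcs : Filter.Tendsto CFC.sqrt (𝓝[{b | 0 ≤ b}] a) (𝓝 r) :=
      (CFC.continuousOn_sqrt (A := A)) a ha.nonneg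
    have hev := hcs.eventually hst.eventually_left_inverse
    rw [eventually_nhdsWithin_iff] at hev
    filter_upwards [hev] with b hb hb0
    have h2 := hb hb0
    rw [CFC.sqrt_mul_sqrt_self b hb0] at h2
    exact h2

/-- The inverse square root `a ^ (-1/2)` of a strictly positive element. -/
noncomputable def invSqrt (a : A) : A := Ring.inverse (CFC.sqrt a)

theorem invSqrt_mul_sqrt {a : A} (ha : IsStrictlyPositive a) : invSqrt a * CFC.sqrt a = 1 :=
  Ring.inverse_mul_cancel _ (IsStrictlyPositive.sqrt a ha).isUnit

theorem sqrt_mul_invSqrt {a : A} (ha : IsStrictlyPositive a) : CFC.sqrt a * invSqrt a = 1 :=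
  Ring.mul_inverse_cancel _ (IsStrictlyPositive.sqrt a ha).isUnit

theorem star_invSqrt (a : A) : star (invSqrt a) = invSqrt a := by
  rw [invSqrt, ← Ring.inverse_star, (IsSelfAdjoint.of_nonneg (CFC.sqrt_nonneg a)).star_eq]

theorem mul_invSqrt {a : A} (ha : IsStrictlyPositive a) : a * invSqrt a = CFC.sqrt a := by
  calc a * invSqrt a = CFC.sqrt a * CFC.sqrt a * invSqrt a := by
        rw [CFC.sqrt_mul_sqrt_self a ha.nonneg]
    _ = CFC.sqrt a := by rw [mul_assoc, sqrt_mul_invSqrt ha, mul_one]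

theorem invSqrt_mul_mul_invSqrt {a : A} (ha : IsStrictlyPositive a) :
    invSqrt a * a * invSqrt a = 1 := by
  rw [mul_assoc, mul_invSqrt ha, invSqrt_mul_sqrt ha]

theorem Commute.cfcSqrt {a b : A} (h : Commute a b) : Commute (CFC.sqrt a) b := by
  rw [CFC.sqrt]
  exact h.cfcₙ_nnreal _

theorem Commute.invSqrt {a b : A} (h : Commute a b) : Commute (invSqrt a) b := by
  by_cases hu : IsUnit (CFC.sqrt a)
  · obtain ⟨u, hu⟩ := hu
    rw [_root_.invSqrt, ← hu, Ring.inverse_unit]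
    exact Commute.units_inv_left (hu ▸ h.cfcSqrt)
  · rw [_root_.invSqrt, Ring.inverse_non_unit _ hu]
    exact Commute.zero_left b

theorem invSqrt_one : invSqrt (1 : A) = 1 := by
  rw [invSqrt, CFC.sqrt_one, Ring.inverse_one]

theorem IsStrictlyPositive.exists_contDiffAt_invSqrt {a : A} (ha : IsStrictlyPositive a) :
    ∃ g : A → A, ContDiffAt ℂ ∞ g a ∧ ∀ᶠ b in 𝓝 a, 0 ≤ b → g b = invSqrt b := by
  obtain ⟨g, hg, h⟩ := ha.exists_contDiffAt_sqrt
  have hga : g a = CFC.sqrt a := h.self_of_nhds ha.nonneg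
  refine ⟨fun b => Ring.inverse (g b), ?_, ?_⟩
  · obtain ⟨u, hu⟩ := (IsStrictlyPositive.sqrt a ha).isUnit
    have h1 : ContDiffAt ℂ ∞ Ring.inverse (g a) := by
      rw [hga, ← hu]
      exact contDiffAt_ringInverse ℂ u
    exact h1.comp a hg
  · filter_upwards [h] with b hb hb0
    rw [hb hb0, invSqrt]

theorem isStrictlyPositive_one_add_of_norm_lt {a : A} (ha : IsSelfAdjoint a) (h : ‖a‖ < 1) :
    IsStrictlyPositive (1 + a) := by
  have h1 : (0 : A) ≤ 1 + a := by
    have := ha.neg_algebraMap_norm_le_self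
    have h2 : algebraMap ℝ A ‖a‖ ≤ 1 := by
      rw [Algebra.algebraMap_eq_smul_one]
      simpa using smul_le_smul_of_nonneg_right h.le (zero_le_one (α := A))
    have h3 : (-1 : A) ≤ a := (neg_le_neg h2).trans this
    simpa [add_comm] using neg_le_iff_add_nonneg.1 h3
  refine IsUnit.isStrictlyPositive ?_ h1
  have := (Units.oneSub (-a) (by rwa [norm_neg])).isUnit
  simpa using this

/-- The operator whose inverse square root is used in the polar decomposition of `t = t p`: it is
`t^* t` on the range of `p` and the identity on its complement. -/
theorem isStrictlyPositive_polar {p t : A} (hp : IsStarProjection p)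
    (hu : IsUnit (1 + (star t * t - p))) : IsStrictlyPositive (1 + (star t * t - p)) := by
  refine hu.isStrictlyPositive ?_
  have h : 1 + (star t * t - p) = star t * t + (1 - p) := by abel
  rw [h]
  exact add_nonneg (star_mul_self_nonneg t) hp.one_sub.nonneg

/-- Polar decomposition: if `t` maps the range of the projection `p` isomorphically onto that of
`q`, then `t (t^* t + 1 - p)^(-1/2)` is a partial isometry from `p` to `q`. -/
theorem polar_decomposition {p q t : A} (hp : IsStarProjection p)
    (hq : IsStarProjection q) (htp : t * p = t)
    (hqt : q * t = t) (hu : IsUnit (1 + (star t * t - p))) (hu' : IsUnit (1 + (t * star t - q))) :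
    star (t * invSqrt (1 + (star t * t - p))) * (t * invSqrt (1 + (star t * t - p))) = p ∧
      (t * invSqrt (1 + (star t * t - p))) * star (t * invSqrt (1 + (star t * t - p))) = q := by
  have hB := isStrictlyPositive_polar hp hu
  have hc := (commute_polar hp htp).invSqrt
  set B := 1 + (star t * t - p) with hBdef
  set s := invSqrt B with hs
  have hpt : p * star t = star t := by
    rw [← hp.isSelfAdjoint.star_eq, ← star_mul, htp]
  have hss : star s = s := star_invSqrt B
  have hBp : B * p = star t * t := by
    rw [hBdef, add_mul, sub_mul, one_mul, mul_assoc, htp, hp.isIdempotentElem.eq]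
    abel
  have h1 : star (t * s) * (t * s) = p := by
    calc star (t * s) * (t * s) = s * (star t * t) * s := by
          rw [star_mul, hss]
          simp only [mul_assoc]
      _ = s * B * (p * s) := by rw [← hBp]; simp only [mul_assoc]
      _ = s * B * s * p := by rw [← hc.eq]; simp only [mul_assoc]
      _ = p := by rw [hs, invSqrt_mul_mul_invSqrt hB, one_mul]
  refine ⟨h1, ?_⟩
  set w := t * s with hw
  have hwp : w * p = w := by rw [hw, mul_assoc, hc.eq, ← mul_assoc, htp]
  have hqw : q * w = w := by rw [hw, ← mul_assoc, hqt]
  have ht : t = w * CFC.sqrt B := by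
    rw [hw, mul_assoc, hs, invSqrt_mul_sqrt hB, mul_one]
  have h2 : (q - w * star w) * t = 0 := by
    rw [ht, ← mul_assoc, sub_mul, hqw, mul_assoc w, h1, hwp, sub_self, zero_mul]
  -- the projection `q - w w^*` is annihilated by an invertible element
  have h3 : (q - w * star w) * (1 + (t * star t - q)) = (q - w * star w) * (1 - q) := by
    have : (1 + (t * star t - q)) = t * star t + (1 - q) := by abel
    rw [this, mul_add, ← mul_assoc, h2, zero_mul, zero_add]
  have hwq : star w * q = star w := by
    rw [← hq.isSelfAdjoint.star_eq, ← star_mul, hqw]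
  have h4 : (q - w * star w) * (1 - q) = 0 := by
    rw [sub_mul, hq.mul_one_sub_self, mul_assoc, mul_sub, hwq, mul_one, sub_self, mul_zero,
      sub_zero]
  rw [h4] at h3
  exact (sub_eq_zero.1 ((hu'.mul_left_eq_zero).1 h3)).symm

/-- The spectral projection of `a` for the half line `t > 1/2`, provided that `(2 a - 1)²` is
invertible: it is `(1 + s) / 2` for the sign `s = b (b²)^(-1/2)` of `b = 2 a - 1`. -/
noncomputable def spectralProj (a : A) : A :=
  a + (a * (invSqrt (1 + (4 : ℂ) • (a * a - a)) - 1) -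
    (2 : ℂ)⁻¹ • (invSqrt (1 + (4 : ℂ) • (a * a - a)) - 1))

theorem isStarProjection_spectralProj {a : A} (ha : IsSelfAdjoint a)
    (h : IsStrictlyPositive (1 + (4 : ℂ) • (a * a - a))) : IsStarProjection (spectralProj a) := by
  have hca : Commute (1 + (4 : ℂ) • (a * a - a)) a :=
    (Commute.one_left a).add_left ((((Commute.refl a).mul_left (Commute.refl a)).sub_left
      (Commute.refl a)).smul_left 4)
  have hc := hca.invSqrt
  have hB := invSqrt_mul_mul_invSqrt h
  have hP : spectralProj a = (2 : ℂ)⁻¹ • (1 + ((2 : ℂ) • a - 1) *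
      invSqrt (1 + (4 : ℂ) • (a * a - a))) := by
    rw [spectralProj]
    simp only [sub_mul, mul_sub, smul_mul_assoc, one_mul, mul_one]
    module
  set s := invSqrt (1 + (4 : ℂ) • (a * a - a)) with hs
  set b := (2 : ℂ) • a - 1 with hb
  have hbb : 1 + (4 : ℂ) • (a * a - a) = b * b := by
    rw [hb]
    simp only [sub_mul, mul_sub, smul_mul_assoc, mul_smul_comm, one_mul, mul_one]
    module
  have hcb : Commute s b := (hc.smul_right 2).sub_right (Commute.one_right s)
  have hbs : (b * s) * (b * s) = 1 := by
    calc (b * s) * (b * s) = (s * b) * (b * s) := by rw [hcb.eq]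
      _ = s * (b * b) * s := by simp only [mul_assoc]
      _ = 1 := by rw [← hbb, hB]
  have hsb : star (b * s) = b * s := by
    have : star b = b := by
      rw [hb, star_sub, star_smul, ha.star_eq, star_one]
      congr 2
      exact RCLike.conj_ofReal (K := ℂ) 2
    rw [star_mul, this, hs, star_invSqrt, ← hs, hcb.eq]
  rw [hP]
  constructor
  · change _ * _ = _
    simp only [smul_mul_assoc, mul_smul_comm, add_mul, mul_add, one_mul, mul_one, hbs]
    module
  · change star _ = _
    rw [star_smul, star_add, star_one, hsb]
    congr 1
    simp

/-- Self-adjoint elements close to a projection have a spectral projection close to it, by a bound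
that does not depend on the projection. -/
theorem exists_spectralProj_near (A : Type*) [CStarAlgebra A] [PartialOrder A]
    [StarOrderedRing A] : ∃ ε > 0, ∀ p a : A, IsStarProjection p → IsSelfAdjoint a → ‖a - p‖ < ε →
      IsStrictlyPositive (1 + (4 : ℂ) • (a * a - a)) ∧ ‖spectralProj a - p‖ < 1 := by
  obtain ⟨g, hg, hg'⟩ := IsStrictlyPositive.exists_contDiffAt_invSqrt (isStrictlyPositive_one (A := A))
  have hg1 : g 1 = 1 := by rw [hg'.self_of_nhds zero_le_one, invSqrt_one]
  have h1 : ∀ᶠ b in 𝓝 (1 : A), ‖g b - 1‖ < 1 / 10 := by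
    have := hg.continuousAt.eventually (Metric.ball_mem_nhds (g 1) (ε := 1 / 10) (by norm_num))
    simpa [hg1, dist_eq_norm] using this
  obtain ⟨η, hη, h2⟩ := Metric.eventually_nhds_iff.1 (h1.and hg')
  refine ⟨min (1 / 4) (min (η / 16) (1 / 17)), by positivity, fun p a hp ha h => ?_⟩
  have e1 : ‖a - p‖ < 1 / 4 := h.trans_le (min_le_left _ _)
  have e2 : ‖a - p‖ < η / 16 := h.trans_le ((min_le_right _ _).trans (min_le_left _ _))
  have e3 : ‖a - p‖ < 1 / 17 := h.trans_le ((min_le_right _ _).trans (min_le_right _ _))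
  have hpn := hp.norm_le
  have hpp := hp.isIdempotentElem.eq
  have hF : ‖(4 : ℂ) • (a * a - a)‖ ≤ 16 * ‖a - p‖ := by
    set d := a - p with hd
    have : a * a - a = p * d + d * p + d * d - d := by
      have : a = p + d := by rw [hd]; abel
      rw [this]
      simp only [add_mul, mul_add, hpp]
      abel
    rw [this, norm_smul]
    have h4 : ‖(4 : ℂ)‖ = 4 := by simp
    have n1 := norm_mul_le p d
    have n2 := norm_mul_le d p
    have n3 := norm_mul_le d d
    have n4 : ‖p * d + d * p + d * d - d‖ ≤ ‖p * d‖ + ‖d * p‖ + ‖d * d‖ + ‖d‖ :=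
      (norm_sub_le _ _).trans (by gcongr; exact norm_add₃_le)
    have d0 := norm_nonneg d
    rw [h4]
    nlinarith
  have hFsa : IsSelfAdjoint ((4 : ℂ) • (a * a - a)) := by
    have : star ((4 : ℂ) • (a * a - a)) = (4 : ℂ) • (a * a - a) := by
      rw [star_smul, star_sub, star_mul, ha.star_eq]
      congr 1
      exact RCLike.conj_ofReal (K := ℂ) 4
    exact this
  have hpos := isStrictlyPositive_one_add_of_norm_lt hFsa (by linarith)
  refine ⟨hpos, ?_⟩
  have h3 := @h2 (1 + (4 : ℂ) • (a * a - a)) (by rw [dist_eq_norm, add_sub_cancel_left]; linarith)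
  rw [h3.2 hpos.nonneg] at h3
  set K := invSqrt (1 + (4 : ℂ) • (a * a - a)) - 1 with hK
  have hKn : ‖K‖ < 1 / 10 := h3.1
  have : spectralProj a - p = (a - p) + (p * K + (a - p) * K - (2 : ℂ)⁻¹ • K) := by
    rw [spectralProj, ← hK, sub_mul]
    abel
  rw [this]
  have m1 := norm_mul_le p K
  have m2 := norm_mul_le (a - p) K
  have m3 : ‖(2 : ℂ)⁻¹ • K‖ = 2⁻¹ * ‖K‖ := by rw [norm_smul]; simp
  have m4 : ‖p * K + (a - p) * K - (2 : ℂ)⁻¹ • K‖ ≤ ‖p * K‖ + ‖(a - p) * K‖ + ‖(2 : ℂ)⁻¹ • K‖ :=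
    (norm_sub_le _ _).trans (by gcongr; exact norm_add_le _ _)
  have m5 := norm_add_le (a - p) (p * K + (a - p) * K - (2 : ℂ)⁻¹ • K)
  have k0 := norm_nonneg K
  nlinarith [norm_nonneg (a - p)]

end CStar

/-! ### Regularity classes -/

/-- A regularity class for complex functions on a `G`-space, such as continuity or smoothness: a
local notion of regularity at a point that is stable under smooth functions of finitely many
variables and under translation, and that admits compactly supported bump functions. -/
structure RegClass (G : Type v) (X : Type u) [Group G] [TopologicalSpace X] [MulAction G X] where
  RegAt : (X → ℂ) → X → Prop
  continuousAt : ∀ {f x}, RegAt f x → ContinuousAt f x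
  congr : ∀ {f g x}, RegAt f x → f =ᶠ[𝓝 x] g → RegAt g x
  comp_fin : ∀ {n : ℕ} {f : Fin n → X → ℂ} {x} {Φ : (Fin n → ℂ) → ℂ}, (∀ i, RegAt (f i) x) →
    ContDiffAt ℝ ∞ Φ (fun i => f i x) → RegAt (fun y => Φ fun i => f i y) x
  translate : ∀ {f} (g : G) {x}, RegAt f (g • x) → RegAt (fun y => f (g • y)) x
  bump : ∀ x, ∀ U ∈ 𝓝 x, ∃ f : X → ℝ, (∀ y, 0 ≤ f y) ∧ f x ≠ 0 ∧ HasCompactSupport f ∧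
    tsupport f ⊆ U ∧ ∀ y, RegAt (fun z => (f z : ℂ)) y

namespace RegClass

variable {G : Type v} {X : Type u} [Group G] [TopologicalSpace X] [MulAction G X]

/-- Continuity as a regularity class. -/
def cont (G : Type v) (X : Type u) [Group G] [TopologicalSpace X] [MulAction G X]
    [ContinuousConstSMul G X] [T2Space X] [LocallyCompactSpace X] : RegClass G X where
  RegAt f x := ContinuousAt f x
  continuousAt h := h
  congr h h' := h.congr h'
  comp_fin h hΦ := ContinuousAt.comp (f := fun y i => _) hΦ.continuousAt (continuousAt_pi.2 h)
  translate {f} g {x} h := ContinuousAt.comp (f := fun y => g • y) h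
    (continuous_const_smul g).continuousAt
  bump x U hU := by
    obtain ⟨f, h1, h2, h3, h4⟩ := exists_continuous_one_zero_of_isCompact
      (isCompact_singleton (x := x)) (t := (interior U)ᶜ) isOpen_interior.isClosed_compl
      (Set.disjoint_singleton_left.2 fun h => h (mem_interior_iff_mem_nhds.2 hU))
    -- shrinking the support: `max (f - 1/2) 0` vanishes near the complement of `U`
    refine ⟨fun y => max (f y - 1 / 2) 0, fun y => le_max_right _ _, ?_, ?_, ?_, fun y => ?_⟩
    · have : f x = 1 := h1 rfl
      simp only [this]
      norm_num
    · exact h3.comp_left (g := fun t : ℝ => max (t - 1 / 2) 0) (by norm_num)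
    · have hcl : IsClosed {y | 1 / 2 ≤ f y} := isClosed_le continuous_const f.continuous
      have hs : tsupport (fun y => max (f y - 1 / 2) 0) ⊆ {y | 1 / 2 ≤ f y} := by
        refine closure_minimal (fun y hy => ?_) hcl
        by_contra hc
        exact hy (max_eq_right (by linarith [not_le.1 (show ¬ (1 / 2 ≤ f y) from hc)]))
      intro y hy
      by_contra hc
      have h5 : f y = 0 := h2 fun h => hc (interior_subset h)
      have h6 : 1 / 2 ≤ f y := hs hy
      rw [h5] at h6
      norm_num at h6
    · exact (Complex.continuous_ofReal.comp
        ((f.continuous.sub continuous_const).max continuous_const)).continuousAt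

/-- Smoothness as a regularity class. -/
def smooth {E : Type*} [NormedAddCommGroup E] [NormedSpace ℝ E] [FiniteDimensional ℝ E]
    {M : Type*} [TopologicalSpace M] (I : ModelWithCorners ℝ E M) [T2Space X] [ChartedSpace M X]
    [IsManifold I ∞ X] (hG : ∀ g : G, ContMDiff I I ∞ fun x : X => g • x) : RegClass G X where
  RegAt f x := ContMDiffAt I 𝓘(ℝ, ℂ) ∞ f x
  continuousAt h := h.continuousAt
  congr h h' := h.congr_of_eventuallyEq h'.symm
  comp_fin {n f x Φ} h hΦ := ContMDiffAt.comp (I' := 𝓘(ℝ, Fin n → ℂ)) (f := fun y i => f i y) x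
    hΦ.contMDiffAt (contMDiffAt_pi_space.2 h)
  translate {f} g {x} h := ContMDiffAt.comp (f := fun y => g • y) x h (hG g x)
  bump x U hU := by
    obtain ⟨f, -, hf⟩ := (SmoothBumpFunction.nhds_basis_tsupport (I := I) x).mem_iff.1 hU
    refine ⟨f, fun y => f.nonneg, ?_, f.hasCompactSupport, hf, fun y => ?_⟩
    · rw [f.eq_one]
      exact one_ne_zero
    · exact ContMDiffAt.comp (I' := 𝓘(ℝ, ℝ)) (g := fun t : ℝ => (t : ℂ)) y
        Complex.ofRealCLM.contDiff.contMDiff.contMDiffAt f.contMDiffAt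

variable (R : RegClass G X) {x : X}

variable {R}

theorem comp {ι : Type*} [Fintype ι] {f : ι → X → ℂ} {Φ : (ι → ℂ) → ℂ} (h : ∀ i, R.RegAt (f i) x)
    (hΦ : ContDiffAt ℝ ∞ Φ (fun i => f i x)) : R.RegAt (fun y => Φ fun i => f i y) x := by
  let e := (Fintype.equivFin ι).symm
  let L : (Fin (Fintype.card ι) → ℂ) →L[ℝ] (ι → ℂ) :=
    ContinuousLinearMap.pi fun i => ContinuousLinearMap.proj (e.symm i)
  have hL : ∀ y, L (fun k => f (e k) y) = fun i => f i y := fun y => by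
    ext i
    simp [L]
  have h1 : ContDiffAt ℝ ∞ (Φ ∘ L) (fun k => f (e k) x) := by
    refine ContDiffAt.comp _ ?_ L.contDiff.contDiffAt
    rw [hL]
    exact hΦ
  refine R.congr (R.comp_fin (fun k => h (e k)) h1) (Filter.Eventually.of_forall fun y => ?_)
  simp only [Function.comp_apply, hL]

theorem const (c : ℂ) : R.RegAt (fun _ => c) x :=
  R.comp_fin (n := 0) (f := fun i _ => i.elim0) (Φ := fun _ => c) (fun i => i.elim0) contDiffAt_const

theorem comp₁ {f : X → ℂ} {φ : ℂ → ℂ} (hf : R.RegAt f x) (hφ : ContDiffAt ℝ ∞ φ (f x)) :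
    R.RegAt (fun y => φ (f y)) x :=
  R.comp_fin (n := 1) (f := fun _ => f) (Φ := fun t => φ (t 0)) (fun _ => hf)
    (ContDiffAt.comp (g := φ) (f := fun t : Fin 1 → ℂ => t 0) _ hφ (contDiffAt_apply ℝ ℂ _ _))

theorem comp₂ {f g : X → ℂ} {φ : ℂ × ℂ → ℂ} (hf : R.RegAt f x) (hg : R.RegAt g x)
    (hφ : ContDiff ℝ ∞ φ) : R.RegAt (fun y => φ (f y, g y)) x :=
  R.comp_fin (n := 2) (f := ![f, g]) (Φ := fun t => φ (t 0, t 1))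
    (fun i => by fin_cases i <;> assumption)
    (hφ.comp ((contDiff_apply ℝ ℂ 0).prodMk (contDiff_apply ℝ ℂ 1))).contDiffAt

theorem add {f g : X → ℂ} (hf : R.RegAt f x) (hg : R.RegAt g x) :
    R.RegAt (fun y => f y + g y) x :=
  comp₂ (φ := fun p => p.1 + p.2) hf hg (contDiff_fst.add contDiff_snd)

theorem mul {f g : X → ℂ} (hf : R.RegAt f x) (hg : R.RegAt g x) :
    R.RegAt (fun y => f y * g y) x :=
  comp₂ (φ := fun p => p.1 * p.2) hf hg (contDiff_fst.mul contDiff_snd)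

theorem sub {f g : X → ℂ} (hf : R.RegAt f x) (hg : R.RegAt g x) :
    R.RegAt (fun y => f y - g y) x :=
  comp₂ (φ := fun p => p.1 - p.2) hf hg (contDiff_fst.sub contDiff_snd)

theorem star {f : X → ℂ} (hf : R.RegAt f x) : R.RegAt (fun y => star (f y)) x :=
  comp₁ (φ := fun t => Star.star t) hf (Complex.conjCLE.contDiff.contDiffAt)

theorem inv {f : X → ℂ} (hf : R.RegAt f x) (h : f x ≠ 0) : R.RegAt (fun y => (f y)⁻¹) x :=
  comp₁ (φ := fun t => t⁻¹) hf (contDiffAt_inv ℝ h)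

theorem sum {ι : Type*} (s : Finset ι) {f : ι → X → ℂ} (h : ∀ i ∈ s, R.RegAt (f i) x) :
    R.RegAt (fun y => ∑ i ∈ s, f i y) x := by
  classical
  induction s using Finset.induction_on with
  | empty => simpa using const 0
  | insert a s ha ih =>
    simp only [Finset.sum_insert ha]
    exact add (h a (Finset.mem_insert_self a s))
      (ih fun i hi => h i (Finset.mem_insert_of_mem hi))

theorem prod {ι : Type*} (s : Finset ι) {f : ι → X → ℂ} (h : ∀ i ∈ s, R.RegAt (f i) x) :
    R.RegAt (fun y => ∏ i ∈ s, f i y) x := by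
  classical
  induction s using Finset.induction_on with
  | empty => simpa using const 1
  | insert a s ha ih =>
    simp only [Finset.prod_insert ha]
    exact mul (h a (Finset.mem_insert_self a s)) (ih fun i hi => h i (Finset.mem_insert_of_mem hi))

theorem det {n : Type*} [Fintype n] [DecidableEq n] {a : X → Matrix n n ℂ}
    (h : ∀ i j, R.RegAt (fun y => a y i j) x) : R.RegAt (fun y => (a y).det) x := by
  simp only [Matrix.det_apply']
  exact sum _ fun σ _ => mul (const _) (prod _ fun i _ => h _ _)

theorem matrix_inv {n : Type*} [Fintype n] [DecidableEq n] {a : X → Matrix n n ℂ}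
    (h : ∀ i j, R.RegAt (fun y => a y i j) x) (hx : (a x).det ≠ 0) (i j : n) :
    R.RegAt (fun y => (a y)⁻¹ i j) x := by
  simp only [Matrix.inv_def, Ring.inverse_eq_inv', Matrix.smul_apply, smul_eq_mul,
    Matrix.adjugate_apply]
  refine mul (inv (det h) hx) (det fun k l => ?_)
  by_cases hk : k = j
  · subst hk
    simpa using const _
  · simpa [Matrix.updateRow_ne hk] using h k l

end RegClass

/-! ### Operators with finitely supported matrices -/

section Operators

variable {S : Type*}

theorem FinMat.toCLM_delta (T : FinMat S) (i j : S) : T.toCLM (EllTwo.delta j) i = T i j := by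
  classical
  rw [FinMat.toCLM_apply _ _ _ T.idx fun k h => (T.mem_idx h).2]
  simp only [EllTwo.delta_apply, mul_ite, mul_one, mul_zero, Finset.sum_ite_eq']
  split_ifs with h
  · rfl
  · by_contra hc
    exact h (T.mem_idx (Ne.symm hc)).2

theorem EllTwo.hasSum_delta (ξ : EllTwo S) : HasSum (fun i => ξ i • EllTwo.delta i) ξ := by
  let := Classical.decEq S
  have := lp.hasSum_single (E := fun _ : S => ℂ) (p := 2) (by norm_num) ξ
  convert this using 2 with i
  rw [EllTwo.delta, ← lp.single_smul]
  simp

theorem EllTwo.clm_ext {A B : EllTwo S →L[ℂ] EllTwo S}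
    (h : ∀ i j, A (EllTwo.delta j) i = B (EllTwo.delta j) i) : A = B := by
  have h1 : ∀ j, A (EllTwo.delta j) = B (EllTwo.delta j) := fun j => lp.ext (funext fun i => h i j)
  ext1 ξ
  have hA := (EllTwo.hasSum_delta ξ).mapL A
  have hB := (EllTwo.hasSum_delta ξ).mapL B
  simp only [map_smul, h1] at hA hB
  exact hA.unique hB

theorem FinMat.toCLM_injective : Function.Injective (FinMat.toCLM (S := S)) := fun A B h =>
  FinMat.ext fun i j => by rw [← FinMat.toCLM_delta, ← FinMat.toCLM_delta, h]

/-- The matrix entry functional `T ↦ ⟨δ_i, T δ_j⟩`. -/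
noncomputable def EllTwo.entry (i j : S) : (EllTwo S →L[ℂ] EllTwo S) →L[ℂ] ℂ :=
  (innerSL ℂ (EllTwo.delta i)).comp (ContinuousLinearMap.apply ℂ (EllTwo S) (EllTwo.delta j))

theorem EllTwo.entry_apply (i j : S) (T : EllTwo S →L[ℂ] EllTwo S) :
    EllTwo.entry i j T = T (EllTwo.delta j) i :=
  EllTwo.inner_delta i _

theorem EllTwo.entry_toCLM (i j : S) (T : FinMat S) : EllTwo.entry i j T.toCLM = T i j := by
  rw [EllTwo.entry_apply, FinMat.toCLM_delta]

/-- An operator whose matrix is supported in `s × s` is given by a matrix in `M[S]`. -/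
theorem FinMat.exists_toCLM_eq {T : EllTwo S →L[ℂ] EllTwo S} {s : Finset S}
    (h : ∀ i j, EllTwo.entry i j T ≠ 0 → i ∈ s ∧ j ∈ s) : ∃ F : FinMat S, F.toCLM = T :=
  ⟨FinMat.ofFinset s (fun i j => EllTwo.entry i j T) h, EllTwo.clm_ext fun i j => by
    rw [FinMat.toCLM_delta, ← EllTwo.entry_apply]
    rfl⟩

theorem EllTwo.entry_star (i j : S) (T : EllTwo S →L[ℂ] EllTwo S) :
    EllTwo.entry i j (star T) = star (EllTwo.entry j i T) := by
  rw [EllTwo.entry_apply, EllTwo.entry_apply, ← EllTwo.inner_delta, ← EllTwo.inner_delta,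
    ContinuousLinearMap.star_eq_adjoint, ContinuousLinearMap.adjoint_inner_right]
  exact (inner_conj_symm _ _).symm

end Operators

section StdAlg

variable {G : Type v} {X : Type u} [Group G] [TopologicalSpace X] [MulAction G X]
  [ContinuousConstSMul G X] [T2Space X] [LocallyCompactSpace X]
  [CompactSpace (MulAction.orbitRel.Quotient G X)]

/-- The entries of a matrix valued function belong to a regularity class. -/
def RegClass.IsRegular (R : RegClass G X) (F : X → FinMat G) : Prop :=
  ∀ i j x, R.RegAt (fun y => F y i j) x

theorem leftRegCLM_delta (g h : G) : leftRegCLM g (EllTwo.delta h) = EllTwo.delta (g * h) := by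
  classical
  ext i
  change EllTwo.delta h (g⁻¹ * i) = _
  rw [EllTwo.delta_apply, EllTwo.delta_apply]
  simp only [inv_mul_eq_iff_eq_mul]

theorem EllTwo.entry_conj (g i j : G) (T : EllTwo G →L[ℂ] EllTwo G) :
    EllTwo.entry i j (leftRegCLM g * T * leftRegCLM g⁻¹) =
      EllTwo.entry (g⁻¹ * i) (g⁻¹ * j) T := by
  rw [EllTwo.entry_apply, EllTwo.entry_apply, mul_apply_eq_comp, mul_apply_eq_comp,
    leftRegCLM_delta]
  rfl

/-- Equivariant operator valued functions with continuous entries, all but finitely many of which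
vanish on each compact set, come from `𝒞(X, G)`. -/
theorem exists_stdAlg_of_entries {F : X → (EllTwo G →L[ℂ] EllTwo G)}
    (hc : ∀ i j, Continuous fun x => EllTwo.entry i j (F x))
    (he : ∀ (g : G) (x : X), F (g • x) = leftRegCLM g * F x * leftRegCLM g⁻¹)
    (hf : ∀ K : Set X, IsCompact K → ∃ s : Finset G, ∀ x ∈ K, ∀ i j,
      EllTwo.entry i j (F x) ≠ 0 → i ∈ s ∧ j ∈ s) :
    ∃ F' : StdAlg G X, ∀ x, (F'.1 x).toCLM = F x := by
  have h1 : ∀ x, ∃ A : FinMat G, A.toCLM = F x := fun x => by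
    obtain ⟨s, hs⟩ := hf {x} isCompact_singleton
    exact FinMat.exists_toCLM_eq (hs x rfl)
  choose F' hF' using h1
  have hent : ∀ x i j, F' x i j = EllTwo.entry i j (F x) := fun x i j => by
    rw [← hF', EllTwo.entry_toCLM]
  have heq : IsEquivariantFun F' := fun g x i j => by
    rw [hent, hent, he, EllTwo.entry_conj]
  have hfin : ∀ K : Set X, IsCompact K → {p : G × G | ∃ x ∈ K, F' x p.1 p.2 ≠ 0}.Finite := by
    intro K hK
    obtain ⟨s, hs⟩ := hf K hK
    refine (s ×ˢ s).finite_toSet.subset ?_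
    rintro ⟨i, j⟩ ⟨x, hx, h⟩
    rw [hent] at h
    simpa using hs x hx i j h
  refine ⟨⟨F', ⟨fun i j => ?_, heq.hasCompactSupport hfin, hfin⟩, heq⟩, hF'⟩
  simp only [hent]
  exact hc i j

theorem invSqrt_conj {A : Type*} [CStarAlgebra A] [PartialOrder A] [StarOrderedRing A] {u b : A}
    (hb : IsStrictlyPositive b) (h1 : star u * u = 1) (h2 : u * star u = 1) :
    invSqrt (u * b * star u) = u * invSqrt b * star u := by
  have hm : ∀ c d : A, (u * c * star u) * (u * d * star u) = u * (c * d) * star u := fun c d => by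
    calc (u * c * star u) * (u * d * star u) = u * c * (star u * u) * d * star u := by
          simp only [mul_assoc]
      _ = u * (c * d) * star u := by rw [h1, mul_one]; simp only [mul_assoc]
  have h3 : CFC.sqrt (u * b * star u) = u * CFC.sqrt b * star u := by
    refine CFC.sqrt_unique ?_ (star_right_conjugate_nonneg (CFC.sqrt_nonneg b) u)
    rw [hm, CFC.sqrt_mul_sqrt_self b hb.nonneg]
  have h4 : (u * invSqrt b * star u) * (u * CFC.sqrt b * star u) = 1 := by
    rw [hm, invSqrt_mul_sqrt hb, mul_one, h2]
  have h5 : (u * CFC.sqrt b * star u) * (u * invSqrt b * star u) = 1 := by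
    rw [hm, sqrt_mul_invSqrt hb, mul_one, h2]
  rw [invSqrt, h3]
  exact Ring.inverse_unit ⟨_, _, h5, h4⟩

/-- `(1 + f)^(-1/2) - 1` is a left multiple of `f`. -/
theorem exists_invSqrt_sub_one_eq {A : Type*} [CStarAlgebra A] [PartialOrder A] [StarOrderedRing A]
    {f : A} (h : IsStrictlyPositive (1 + f)) : ∃ c : A, invSqrt (1 + f) - 1 = c * f := by
  have hu : IsUnit (1 + CFC.sqrt (1 + f)) :=
    (isStrictlyPositive_one.add_nonneg (CFC.sqrt_nonneg _)).isUnit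
  obtain ⟨u, hu⟩ := hu
  refine ⟨-(invSqrt (1 + f) * (↑u⁻¹ : A)), ?_⟩
  set r := CFC.sqrt (1 + f) with hr
  have h1 : r * r = 1 + f := CFC.sqrt_mul_sqrt_self _ h.nonneg
  have h2 : -f = (u : A) * (1 - r) := by
    rw [hu, add_mul, mul_sub, mul_sub, h1]
    simp only [one_mul, mul_one]
    abel
  have h3 : (↑u⁻¹ : A) * -f = 1 - r := by rw [h2, ← mul_assoc, Units.inv_mul, one_mul]
  calc invSqrt (1 + f) - 1 = invSqrt (1 + f) * (1 - r) := by
        rw [mul_sub, mul_one, invSqrt_mul_sqrt h]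
    _ = _ := by rw [← h3]; simp [mul_assoc]

theorem stdAlg_continuous (F : StdAlg G X) : Continuous fun x => (F.1 x).toCLM :=
  (stdAlgToCstarAlg G X F).2.1

theorem stdAlg_equivariant (F : StdAlg G X) (g : G) (x : X) :
    (F.1 (g • x)).toCLM = leftRegCLM g * (F.1 x).toCLM * leftRegCLM g⁻¹ :=
  (stdAlgToCstarAlg G X F).2.2.2 g x

theorem RegClass.regAt_invSqrt {R : RegClass G X} (F : StdAlg G X) {x₀ : X}
    (h : IsStrictlyPositive (1 + (F.1 x₀).toCLM)) (h' : ∀ x, 0 ≤ 1 + (F.1 x).toCLM)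
    (hF : ∀ i j, R.RegAt (fun x => F.1 x i j) x₀) (i j : G) :
    R.RegAt (fun x => EllTwo.entry i j (invSqrt (1 + (F.1 x).toCLM))) x₀ := by
  obtain ⟨N, hN, hxN⟩ := exists_compact_mem_nhds x₀
  obtain ⟨S, hS⟩ := F.2.1.exists_finset hN
  let L : ((S × S) → ℂ) →L[ℂ] (EllTwo G →L[ℂ] EllTwo G) := ∑ p : S × S,
    (ContinuousLinearMap.proj p : ((S × S) → ℂ) →L[ℂ] ℂ).smulRight
      (InnerProductSpace.rankOne ℂ (EllTwo.delta (p.1 : G)) (EllTwo.delta (p.2 : G)))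
  have hL : ∀ x ∈ N, L (fun p => F.1 x p.1 p.2) = (F.1 x).toCLM := by
    intro x hx
    have h1 : L (fun p => F.1 x p.1 p.2) = ∑ p : S × S, F.1 x p.1 p.2 •
        InnerProductSpace.rankOne ℂ (EllTwo.delta (p.1 : G)) (EllTwo.delta (p.2 : G)) := by
      simp [L]
    refine h1.trans (Eq.trans ?_ ((F.1 x).toCLM_eq_sum S (hS x hx)).symm)
    rw [Fintype.sum_prod_type, ← Finset.sum_coe_sort S]
    exact Finset.sum_congr rfl fun i _ => Finset.sum_coe_sort S fun j : G => F.1 x i j •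
      InnerProductSpace.rankOne ℂ (EllTwo.delta (i : G)) (EllTwo.delta j)
  obtain ⟨g, hg, hg'⟩ := h.exists_contDiffAt_invSqrt
  have h1 : ContDiffAt ℂ ∞ (fun m : (S × S) → ℂ => EllTwo.entry i j (g (1 + L m)))
      (fun p => F.1 x₀ p.1 p.2) := by
    refine (EllTwo.entry i j).contDiff.contDiffAt.comp _ ?_
    refine ContDiffAt.comp (g := g) _ ?_ (contDiffAt_const.add L.contDiff.contDiffAt)
    rw [hL x₀ (mem_of_mem_nhds hxN)]
    exact hg
  refine R.congr (R.comp (fun p : S × S => hF p.1 p.2) (h1.restrict_scalars ℝ)) ?_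
  have hB : Continuous fun x => 1 + (F.1 x).toCLM := continuous_const.add (stdAlg_continuous F)
  filter_upwards [hxN, hB.continuousAt.eventually hg'] with x hx hgx
  rw [hL x hx, hgx (h' x)]

/-- `𝒞(X, G)` with a unit adjoined is closed under inverse square roots of strictly positive
elements, and these preserve regularity. -/
theorem exists_stdAlg_invSqrt (F : StdAlg G X)
    (h : ∀ x, IsStrictlyPositive (1 + (F.1 x).toCLM)) :
    ∃ K : StdAlg G X, (∀ x, (K.1 x).toCLM = invSqrt (1 + (F.1 x).toCLM) - 1) ∧
      ∀ R : RegClass G X, R.IsRegular F.1 → R.IsRegular K.1 := by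
  have hstar : ∀ x, star (invSqrt (1 + (F.1 x).toCLM) - 1) = invSqrt (1 + (F.1 x).toCLM) - 1 :=
    fun x => by rw [star_sub, star_invSqrt, star_one]
  have hex : ∃ K : StdAlg G X, ∀ x, (K.1 x).toCLM = invSqrt (1 + (F.1 x).toCLM) - 1 := by
    refine exists_stdAlg_of_entries ?_ ?_ ?_
    · intro i j
      rw [continuous_iff_continuousAt]
      intro x
      simp only [map_sub]
      refine ContinuousAt.sub ?_ continuousAt_const
      exact (RegClass.cont G X).regAt_invSqrt F (h x) (fun y => (h y).nonneg)
        (fun i j => (F.2.1.continuous_entry i j).continuousAt) i j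
    · intro g x
      have hu1 : leftRegCLM g * leftRegCLM g⁻¹ = 1 := by
        rw [leftRegCLM_mul, mul_inv_cancel, leftRegCLM_one]
      have hu2 : leftRegCLM g⁻¹ * leftRegCLM g = 1 := by
        rw [leftRegCLM_mul, inv_mul_cancel, leftRegCLM_one]
      have h1 : 1 + (F.1 (g • x)).toCLM =
          leftRegCLM g * (1 + (F.1 x).toCLM) * star (leftRegCLM g) := by
        rw [stdAlg_equivariant, leftRegCLM_star, mul_add, add_mul, mul_one, hu1]
      rw [h1, invSqrt_conj (h x) (by rw [leftRegCLM_star, hu2]) (by rw [leftRegCLM_star, hu1]),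
        leftRegCLM_star, mul_sub, sub_mul, mul_one, hu1]
    · intro C hC
      obtain ⟨S, hS⟩ := F.2.1.exists_finset hC
      have key : ∀ x ∈ C, ∀ i j, EllTwo.entry i j (invSqrt (1 + (F.1 x).toCLM) - 1) ≠ 0 → j ∈ S := by
        intro x hx i j hne
        by_contra hj
        obtain ⟨c, hc⟩ := exists_invSqrt_sub_one_eq (h x)
        apply hne
        have h0 : (F.1 x).toCLM (EllTwo.delta j) = 0 := lp.ext (funext fun k => by
          rw [FinMat.toCLM_delta]
          by_contra h2
          exact hj (hS x hx k j h2).2)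
        rw [EllTwo.entry_apply, hc, mul_apply_eq_comp, h0, map_zero]
        rfl
      refine ⟨S, fun x hx i j hne => ⟨?_, key x hx i j hne⟩⟩
      refine key x hx j i fun h0 => hne ?_
      rw [← hstar, EllTwo.entry_star, h0, star_zero]
  obtain ⟨K, hK⟩ := hex
  refine ⟨K, hK, fun R hR i j x => ?_⟩
  have h1 := R.regAt_invSqrt F (h x) (fun y => (h y).nonneg) (fun i j => hR i j x) i j
  refine R.congr (RegClass.sub h1 (RegClass.const (EllTwo.entry i j 1)))
    (Filter.Eventually.of_forall fun y => ?_)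
  simp only
  rw [← EllTwo.entry_toCLM i j (K.1 y), hK, map_sub]

end StdAlg

/-! ### Projections and partial isometries in `𝒞(X, G)` and `C^*(X, G)` -/

section StdAlg

variable {G : Type v} {X : Type u} [Group G] [TopologicalSpace X] [MulAction G X]

namespace RegClass

variable {R : RegClass G X}

theorem IsRegular.add {A B : X → FinMat G} (hA : R.IsRegular A) (hB : R.IsRegular B) :
    R.IsRegular (A + B) := fun i j x => RegClass.add (hA i j x) (hB i j x)

theorem IsRegular.sub {A B : X → FinMat G} (hA : R.IsRegular A) (hB : R.IsRegular B) :
    R.IsRegular (A - B) := fun i j x => R.congr (RegClass.sub (hA i j x) (hB i j x))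
      (Filter.Eventually.of_forall fun y => by
        simp only [Pi.sub_apply, sub_eq_add_neg, FinMat.add_apply, FinMat.neg_apply])

theorem IsRegular.smul {A : X → FinMat G} (c : ℂ) (hA : R.IsRegular A) :
    R.IsRegular (c • A) := fun i j x => RegClass.mul (RegClass.const c) (hA i j x)

theorem IsRegular.star {A : X → FinMat G} (hA : R.IsRegular A) :
    R.IsRegular (Star.star A) := fun i j x => RegClass.star (hA j i x)

theorem IsRegular.mul [LocallyCompactSpace X] {A B : X → FinMat G} (hA : R.IsRegular A)
    (hB : R.IsRegular B) (h : IsStandardFun A) : R.IsRegular (A * B) := by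
  intro i k x
  obtain ⟨K, hK, hxK⟩ := exists_compact_mem_nhds x
  obtain ⟨s, hs⟩ := h.exists_finset hK
  refine R.congr (RegClass.sum s fun j _ => RegClass.mul (hA i j x) (hB j k x)) ?_
  filter_upwards [hxK] with y hy
  exact (FinMat.mul_apply_sum s fun j h _ => (hs y hy i j h).2).symm

end RegClass

/-- Polar decomposition in `C^*(X, G)`. -/
theorem exists_cstarAlg_polar {P Q : Proj (CstarAlg G X)} {T : CstarAlg G X} (hTP : T * P.1 = T)
    (hQT : Q.1 * T = T)
    (hu : ∀ x, IsUnit (1 + (star (T.1 x) * T.1 x - P.1.1 x)))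
    (hu' : ∀ x, IsUnit (1 + (T.1 x * star (T.1 x) - Q.1.1 x))) :
    ∃ W : CstarAlg G X, star W * W = P.1 ∧ W * star W = Q.1 := by
  have hp : ∀ x, IsStarProjection (P.1.1 x) := fun x =>
    ⟨congrFun (congrArg Subtype.val P.2.isIdempotentElem.eq) x,
      congrFun (congrArg Subtype.val P.2.isSelfAdjoint.star_eq) x⟩
  have hq : ∀ x, IsStarProjection (Q.1.1 x) := fun x =>
    ⟨congrFun (congrArg Subtype.val Q.2.isIdempotentElem.eq) x,
      congrFun (congrArg Subtype.val Q.2.isSelfAdjoint.star_eq) x⟩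
  have h1 : ∀ x, T.1 x * P.1.1 x = T.1 x := fun x => congrFun (congrArg Subtype.val hTP) x
  have h2 : ∀ x, Q.1.1 x * T.1 x = T.1 x := fun x => congrFun (congrArg Subtype.val hQT) x
  have hpos := fun x => isStrictlyPositive_polar (hp x) (hu x)
  have hpol := fun x => polar_decomposition (hp x) (hq x) (h1 x) (h2 x) (hu x) (hu' x)
  set B : X → (EllTwo G →L[ℂ] EllTwo G) := fun x => 1 + (star (T.1 x) * T.1 x - P.1.1 x) with hB
  have hBc : Continuous B := continuous_const.add
    (((continuous_star.comp T.2.1).mul T.2.1).sub P.1.2.1)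
  have hsc : Continuous fun x => invSqrt (B x) := by
    rw [continuous_iff_continuousAt]
    intro x
    obtain ⟨g, hg, hg'⟩ := (hpos x).exists_contDiffAt_invSqrt
    refine (ContinuousAt.comp (f := B) hg.continuousAt hBc.continuousAt).congr ?_
    filter_upwards [hBc.continuousAt.eventually hg'] with y hy
    exact hy (hpos y).nonneg
  refine ⟨⟨fun x => T.1 x * invSqrt (B x), T.2.1.mul hsc,
    fun x => (T.2.2.1 x).comp_clm _, fun g x => ?_⟩, Subtype.ext (funext fun x => (hpol x).1),
      Subtype.ext (funext fun x => (hpol x).2)⟩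
  have hu1 : leftRegCLM g * leftRegCLM g⁻¹ = 1 := by
    rw [leftRegCLM_mul, mul_inv_cancel, leftRegCLM_one]
  have hu2 : leftRegCLM g⁻¹ * leftRegCLM g = 1 := by
    rw [leftRegCLM_mul, inv_mul_cancel, leftRegCLM_one]
  have hBg : B (g • x) = leftRegCLM g * B x * star (leftRegCLM g) := by
    have h3 := (star T * T - P.1).2.2.2 g x
    have h4 : B (g • x) = 1 + (star T * T - P.1).1 (g • x) := rfl
    have h5 : B x = 1 + (star T * T - P.1).1 x := rfl
    rw [h4, h5, h3, leftRegCLM_star, mul_add, add_mul, mul_one, hu1]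
  simp only
  rw [hBg, invSqrt_conj (hpos x) (by rw [leftRegCLM_star, hu2]) (by rw [leftRegCLM_star, hu1]),
    leftRegCLM_star, T.2.2.2 g x]
  calc leftRegCLM g * T.1 x * leftRegCLM g⁻¹ * (leftRegCLM g * invSqrt (B x) * leftRegCLM g⁻¹)
      = leftRegCLM g * T.1 x * (leftRegCLM g⁻¹ * leftRegCLM g) * invSqrt (B x) *
          leftRegCLM g⁻¹ := by simp only [mul_assoc]
    _ = _ := by rw [hu2, mul_one]; simp only [mul_assoc]

variable [ContinuousConstSMul G X] [T2Space X] [LocallyCompactSpace X]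
  [CompactSpace (MulAction.orbitRel.Quotient G X)]

/-- The value of an element of `𝒞(X, G)` at a point, as an operator on `ℓ²(G)`. -/
noncomputable def stdEval (x : X) : StdAlg G X →⋆ₙₐ[ℂ] (EllTwo G →L[ℂ] EllTwo G) where
  toFun F := (F.1 x).toCLM
  map_smul' c A := FinMat.toCLM_smul c (A.1 x)
  map_zero' := congrFun (congrArg Subtype.val (map_zero (stdAlgToCstarAlg G X))) x
  map_add' A B := FinMat.toCLM_add (A.1 x) (B.1 x)
  map_mul' A B := FinMat.toCLM_mul (A.1 x) (B.1 x)
  map_star' A := FinMat.toCLM_star (A.1 x)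

theorem stdEval_apply (x : X) (F : StdAlg G X) : stdEval x F = (F.1 x).toCLM := rfl

theorem stdEval_ext {A B : StdAlg G X} (h : ∀ x, stdEval x A = stdEval x B) : A = B :=
  Subtype.ext (funext fun x => FinMat.toCLM_injective (h x))

theorem Proj.eval {A : Type*} [NonUnitalRing A] [StarRing A] [Module ℂ A] (P : Proj A) {B : Type*}
    [NonUnitalRing B] [StarRing B] [Module ℂ B] (f : A →⋆ₙₐ[ℂ] B) : IsStarProjection (f P.1) :=
  (P.map f).2

/-- If `T` maps the range of `P` isomorphically onto that of `Q`, then its polar decomposition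
gives a partial isometry in `𝒞(X, G)` that is as regular as `P` and `T` are. -/
theorem exists_stdAlg_polar {P Q : Proj (StdAlg G X)} {T : StdAlg G X} (hTP : T * P.1 = T)
    (hQT : Q.1 * T = T)
    (hu : ∀ x, IsUnit (1 + stdEval x (star T * T - P.1)))
    (hu' : ∀ x, IsUnit (1 + stdEval x (T * star T - Q.1))) :
    ∃ W : StdAlg G X, star W * W = P.1 ∧ W * star W = Q.1 ∧
      ∀ R : RegClass G X, R.IsRegular P.1.1 → R.IsRegular T.1 → R.IsRegular W.1 := by
  have hp : ∀ x, IsStarProjection (stdEval x P.1) := fun x => P.eval (stdEval x)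
  have hq : ∀ x, IsStarProjection (stdEval x Q.1) := fun x => Q.eval (stdEval x)
  have he : ∀ x, stdEval x (star T * T - P.1) =
      star (stdEval x T) * stdEval x T - stdEval x P.1 := fun x => by
    rw [map_sub, map_mul, map_star]
  have he' : ∀ x, stdEval x (T * star T - Q.1) =
      stdEval x T * star (stdEval x T) - stdEval x Q.1 := fun x => by
    rw [map_sub, map_mul, map_star]
  have h1 : ∀ x, stdEval x T * stdEval x P.1 = stdEval x T := fun x => by rw [← map_mul, hTP]
  have h2 : ∀ x, stdEval x Q.1 * stdEval x T = stdEval x T := fun x => by rw [← map_mul, hQT]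
  obtain ⟨K, hK, hKR⟩ := exists_stdAlg_invSqrt (star T * T - P.1) fun x => by
    have := isStrictlyPositive_polar (hp x) (t := stdEval x T) (by rw [← he]; exact hu x)
    rw [← he] at this
    exact this
  have hpol := fun x => polar_decomposition (hp x) (hq x) (h1 x) (h2 x)
    (by rw [← he]; exact hu x) (by rw [← he']; exact hu' x)
  have hW : ∀ x, stdEval x (T + T * K) = stdEval x T *
      invSqrt (1 + (star (stdEval x T) * stdEval x T - stdEval x P.1)) := fun x => by
    have : stdEval x K = invSqrt (1 + stdEval x (star T * T - P.1)) - 1 := hK x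
    rw [map_add, map_mul, this, he, mul_sub, mul_one, add_sub_cancel]
  refine ⟨T + T * K, stdEval_ext fun x => ?_, stdEval_ext fun x => ?_, fun R hP hT => ?_⟩
  · rw [map_mul, map_star, hW]
    exact (hpol x).1
  · rw [map_mul, map_star, hW]
    exact (hpol x).2
  · exact hT.add (hT.mul (hKR R (((RegClass.IsRegular.star hT).mul hT (star T).2.1).sub hP)) T.2.1)

/-- A partial isometry can be replaced by the polar part of a nearby element. -/
theorem exists_partialIsometry_near {P Q : Proj (StdAlg G X)} {U A : StdAlg G X}
    (h1 : star U * U = P.1) (h2 : U * star U = Q.1)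
    (h : ∀ x, ‖stdEval x A - stdEval x U‖ < 1 / 4) :
    ∃ W : StdAlg G X, star W * W = P.1 ∧ W * star W = Q.1 ∧
      ∀ R : RegClass G X, R.IsRegular P.1.1 → R.IsRegular Q.1.1 → R.IsRegular A.1 →
        R.IsRegular W.1 := by
  have hpp := P.2.isIdempotentElem.eq
  have hqq := Q.2.isIdempotentElem.eq
  have key : ∀ x, IsUnit (1 + stdEval x (star (Q.1 * A * P.1) * (Q.1 * A * P.1) - P.1)) ∧
      IsUnit (1 + stdEval x ((Q.1 * A * P.1) * star (Q.1 * A * P.1) - Q.1)) := by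
    intro x
    have hp := P.eval (stdEval x)
    have hq := Q.eval (stdEval x)
    set p := stdEval x P.1 with hpdef
    set q := stdEval x Q.1 with hqdef
    set a := stdEval x A with hadef
    set u := stdEval x U with hudef
    have hup : star u * u = p := by rw [hpdef, ← h1, map_mul, map_star]
    have huq : u * star u = q := by rw [hqdef, ← h2, map_mul, map_star]
    have hw : stdEval x (Q.1 * A * P.1) = q * a * p := by rw [map_mul, map_mul]
    rw [map_sub, map_sub, map_mul, map_mul _ _ (star _), map_star, hw, ← hpdef, ← hqdef]
    exact isUnit_polar_of_near hp hq hup huq (h x)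
  obtain ⟨W, hW1, hW2, hW⟩ := exists_stdAlg_polar (P := P) (Q := Q) (T := Q.1 * A * P.1)
    (by rw [mul_assoc, hpp]) (by rw [← mul_assoc, ← mul_assoc, hqq]) (fun x => (key x).1)
    (fun x => (key x).2)
  exact ⟨W, hW1, hW2, fun R hP hQ hA =>
    hW R hP ((hQ.mul hA Q.1.2.1).mul hP (Q.1 * A).2.1)⟩

end StdAlg

section StdAlg

variable {G : Type v} {X : Type u} [Group G] [TopologicalSpace X] [MulAction G X]
  [ContinuousConstSMul G X] [T2Space X] [LocallyCompactSpace X]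
  [CompactSpace (MulAction.orbitRel.Quotient G X)]

/-- A partial isometry in `C^*(X, G)` between projections in `𝒞(X, G)` lies in `𝒞(X, G)`: it
satisfies `w = q w p`, so its entries are as locally finite as those of `p` and `q`. -/
theorem exists_stdAlg_of_partialIsometry {P Q : Proj (StdAlg G X)} {w : CstarAlg G X}
    (h1 : star w * w = stdAlgToCstarAlg G X P.1) (h2 : w * star w = stdAlgToCstarAlg G X Q.1) :
    ∃ W : StdAlg G X, star W * W = P.1 ∧ W * star W = Q.1 := by
  have hp : ∀ x, IsStarProjection (stdEval x P.1) := fun x => P.eval (stdEval x)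
  have hq : ∀ x, IsStarProjection (stdEval x Q.1) := fun x => Q.eval (stdEval x)
  have e1 : ∀ x, star (w.1 x) * w.1 x = stdEval x P.1 := fun x =>
    congrFun (congrArg Subtype.val h1) x
  have e2 : ∀ x, w.1 x * star (w.1 x) = stdEval x Q.1 := fun x =>
    congrFun (congrArg Subtype.val h2) x
  have h3 : ∀ x, w.1 x * stdEval x P.1 = w.1 x := fun x =>
    mul_right_eq_of_star_mul_self (hp x) (e1 x)
  have h4 : ∀ x, star (w.1 x) * stdEval x Q.1 = star (w.1 x) := fun x =>
    mul_right_eq_of_star_mul_self (hq x) (by rw [star_star]; exact e2 x)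
  have hz : ∀ (T : EllTwo G →L[ℂ] EllTwo G) (F : StdAlg G X) (K : Set X) (S : Finset G),
      (∀ x ∈ K, ∀ i j, F.1 x i j ≠ 0 → i ∈ S ∧ j ∈ S) → ∀ x ∈ K, T * stdEval x F = T →
      ∀ i j, EllTwo.entry i j T ≠ 0 → j ∈ S := by
    intro T F K S hS x hx hT i j hne
    by_contra hj
    apply hne
    have h0 : (F.1 x).toCLM (EllTwo.delta j) = 0 := lp.ext (funext fun k => by
      rw [FinMat.toCLM_delta]
      by_contra h2
      exact hj (hS x hx k j h2).2)
    rw [EllTwo.entry_apply, ← hT, stdEval_apply, mul_apply_eq_comp, h0, map_zero]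
    rfl
  obtain ⟨W, hW⟩ := exists_stdAlg_of_entries (F := w.1)
    (fun i j => (EllTwo.entry i j).continuous.comp w.2.1) w.2.2.2 (by
      classical
      intro K hK
      obtain ⟨S, hS⟩ := P.1.2.1.exists_finset hK
      obtain ⟨S', hS'⟩ := Q.1.2.1.exists_finset hK
      refine ⟨S ∪ S', fun x hx i j hne => ⟨Finset.mem_union_right _ ?_,
        Finset.mem_union_left _ (hz _ _ K S hS x hx (h3 x) i j hne)⟩⟩
      refine hz _ _ K S' hS' x hx (h4 x) j i ?_
      rw [EllTwo.entry_star]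
      exact star_ne_zero.2 hne)
  have hW' : ∀ x, stdEval x W = w.1 x := hW
  refine ⟨W, stdEval_ext fun x => ?_, stdEval_ext fun x => ?_⟩
  · rw [map_mul, map_star, hW', e1]
  · rw [map_mul, map_star, hW', e2]

/-- A self-adjoint element of `𝒞(X, G)` close to a projection in `C^*(X, G)` yields an equivalent
projection in `𝒞(X, G)`. -/
theorem exists_proj_near (G : Type v) (X : Type u) [Group G] [TopologicalSpace X] [MulAction G X]
    [ContinuousConstSMul G X] [T2Space X] [LocallyCompactSpace X]
    [CompactSpace (MulAction.orbitRel.Quotient G X)] :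
    ∃ ε > 0, ∀ (P : Proj (CstarAlg G X)) (A : StdAlg G X), IsSelfAdjoint A →
      (∀ x, ‖stdEval x A - P.1.1 x‖ < ε) →
      ∃ P' : Proj (StdAlg G X), P ≈ P'.map (stdAlgToCstarAlg G X) ∧
        ∀ R : RegClass G X, R.IsRegular A.1 → R.IsRegular P'.1.1 := by
  obtain ⟨ε, hε, hnear⟩ := exists_spectralProj_near (EllTwo G →L[ℂ] EllTwo G)
  refine ⟨ε, hε, fun P A hA h => ?_⟩
  have hp : ∀ x, IsStarProjection (P.1.1 x) := fun x =>
    ⟨congrFun (congrArg Subtype.val P.2.isIdempotentElem.eq) x,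
      congrFun (congrArg Subtype.val P.2.isSelfAdjoint.star_eq) x⟩
  have ha : ∀ x, IsSelfAdjoint (stdEval x A) := fun x => hA.map (stdEval x)
  have h1 := fun x => hnear _ _ (hp x) (ha x) (h x)
  have he : ∀ x, stdEval x ((4 : ℂ) • (A * A - A)) =
      (4 : ℂ) • (stdEval x A * stdEval x A - stdEval x A) := fun x => by
    rw [map_smul, map_sub, map_mul]
  obtain ⟨K, hK, hKR⟩ := exists_stdAlg_invSqrt ((4 : ℂ) • (A * A - A)) fun x => by
    have := (h1 x).1
    rw [← he] at this
    exact this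
  have hK' : ∀ x, stdEval x K = invSqrt (1 +
      (4 : ℂ) • (stdEval x A * stdEval x A - stdEval x A)) - 1 := fun x => by
    rw [← he]
    exact hK x
  have hP' : ∀ x, stdEval x (A + (A * K - (2 : ℂ)⁻¹ • K)) = spectralProj (stdEval x A) := fun x => by
    rw [map_add, map_sub, map_mul, map_smul, hK', spectralProj]
  have hq := fun x => isStarProjection_spectralProj (ha x) (h1 x).1
  let P' : Proj (StdAlg G X) := ⟨A + (A * K - (2 : ℂ)⁻¹ • K),
    stdEval_ext fun x => by rw [map_mul, hP']; exact (hq x).isIdempotentElem,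
    stdEval_ext fun x => by rw [map_star, hP']; exact (hq x).isSelfAdjoint⟩
  refine ⟨P', ?_, fun R hR => hR.add ((hR.mul (hKR R ?_) A.2.1).sub ((hKR R ?_).smul _))⟩
  · have hQ : ∀ x, (P'.map (stdAlgToCstarAlg G X)).1.1 x = spectralProj (stdEval x A) := hP'
    have hQn : ∀ x, ‖P.1.1 x - spectralProj (stdEval x A)‖ < 1 := fun x => by
      rw [norm_sub_rev]
      exact (h1 x).2
    refine exists_cstarAlg_polar (T := (P'.map (stdAlgToCstarAlg G X)).1 * P.1) ?_ ?_ ?_ ?_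
    · rw [mul_assoc, P.2.isIdempotentElem.eq]
    · rw [← mul_assoc, (P'.map (stdAlgToCstarAlg G X)).2.isIdempotentElem.eq]
    · intro x
      have : ((P'.map (stdAlgToCstarAlg G X)).1 * P.1).1 x =
        spectralProj (stdEval x A) * P.1.1 x := by rw [← hQ]; rfl
      rw [this]
      exact isUnit_polar_of_norm_lt (norm_polar_mul_lt (hp x) (hq x) (hQn x))
    · intro x
      have : ((P'.map (stdAlgToCstarAlg G X)).1 * P.1).1 x =
        spectralProj (stdEval x A) * P.1.1 x := by rw [← hQ]; rfl
      rw [this, hQ]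
      have h5 := isUnit_polar_of_norm_lt (norm_polar_mul_lt (hq x) (hp x) (h1 x).2)
      rwa [star_mul, (hp x).isSelfAdjoint.star_eq, (hq x).isSelfAdjoint.star_eq] at h5 ⊢
  · exact RegClass.IsRegular.smul 4 ((hR.mul hR A.2.1).sub hR)
  · exact RegClass.IsRegular.smul 4 ((hR.mul hR A.2.1).sub hR)

end StdAlg

/-! ### Approximation of compact operators by finite matrices -/

section Approximation

variable {S : Type*}

/-- The projection of `ℓ²(S)` onto `ℂ[s]` for a finite subset `s`. -/
noncomputable def EllTwo.cutoff (s : Finset S) : EllTwo S →L[ℂ] EllTwo S :=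
  ∑ i ∈ s, InnerProductSpace.rankOne ℂ (EllTwo.delta i) (EllTwo.delta i)

theorem EllTwo.cutoff_eq (s : Finset S) (ξ : EllTwo S) :
    EllTwo.cutoff s ξ = ∑ i ∈ s, ξ i • EllTwo.delta i := by
  simp [EllTwo.cutoff, EllTwo.inner_delta]

theorem EllTwo.cutoff_apply [DecidableEq S] (s : Finset S) (ξ : EllTwo S) (i : S) :
    EllTwo.cutoff s ξ i = if i ∈ s then ξ i else 0 := by
  rw [EllTwo.cutoff_eq, lp.coeFn_sum, Finset.sum_apply]
  simp [EllTwo.delta_apply]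

theorem EllTwo.isStarProjection_cutoff (s : Finset S) : IsStarProjection (EllTwo.cutoff s) := by
  classical
  constructor
  · refine EllTwo.clm_ext fun i j => ?_
    rw [mul_apply_eq_comp]
    simp only [EllTwo.cutoff_apply]
    split_ifs <;> rfl
  · change star _ = _
    simp [EllTwo.cutoff, star_sum, ContinuousLinearMap.star_eq_adjoint]

theorem IsCompactOperator.exists_cutoff_near {T : EllTwo S →L[ℂ] EllTwo S}
    (hT : IsCompactOperator T) {ε : ℝ} (hε : 0 < ε) :
    ∀ᶠ s in Filter.atTop, ‖EllTwo.cutoff s * T - T‖ ≤ ε := by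
  have hcl : IsCompact (closure (T '' Metric.closedBall (0 : EllTwo S) 1)) :=
    hT.isCompact_closure_image_closedBall (f := (T : EllTwo S →ₗ[ℂ] EllTwo S)) 1
  have htb : TotallyBounded (T '' Metric.closedBall (0 : EllTwo S) 1) :=
    hcl.totallyBounded.subset subset_closure
  obtain ⟨t, htfin, hcov⟩ := Metric.totallyBounded_iff.1 htb (ε / 3) (by positivity)
  have h1 : ∀ z ∈ t, ∀ᶠ s : Finset S in Filter.atTop, ‖EllTwo.cutoff s z - z‖ < ε / 3 := by
    intro z _
    have := (EllTwo.hasSum_delta z).eventually (Metric.ball_mem_nhds z (show 0 < ε / 3 by positivity))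
    filter_upwards [this] with s hs
    rw [EllTwo.cutoff_eq]
    simpa [dist_eq_norm] using hs
  filter_upwards [(Filter.eventually_all_finite htfin).2 h1] with s hs
  refine ContinuousLinearMap.opNorm_le_of_unit_norm hε.le fun ξ hξ => ?_
  obtain ⟨z, hz, hξz⟩ := Set.mem_iUnion₂.1 (hcov ⟨ξ, by simp [hξ], rfl⟩)
  have h2 : ‖T ξ - z‖ < ε / 3 := by simpa [dist_eq_norm] using hξz
  have h3 : ‖EllTwo.cutoff s (T ξ - z)‖ ≤ ‖T ξ - z‖ :=
    ((EllTwo.cutoff s).le_of_opNorm_le (EllTwo.isStarProjection_cutoff s).norm_le _).trans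
      (by rw [one_mul])
  have h4 : (EllTwo.cutoff s * T - T) ξ =
      EllTwo.cutoff s (T ξ - z) + (EllTwo.cutoff s z - z) - (T ξ - z) := by
    rw [map_sub]
    change EllTwo.cutoff s (T ξ) - T ξ = _
    abel
  rw [h4]
  have h5 := norm_sub_le (EllTwo.cutoff s (T ξ - z) + (EllTwo.cutoff s z - z)) (T ξ - z)
  have h6 := norm_add_le (EllTwo.cutoff s (T ξ - z)) (EllTwo.cutoff s z - z)
  have h7 := hs z hz
  linarith

/-- Compact operators on `ℓ²(S)` are limits of finitely supported matrices. -/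
theorem IsCompactOperator.exists_finMat_near {T : EllTwo S →L[ℂ] EllTwo S}
    (hT : IsCompactOperator T) {ε : ℝ} (hε : 0 < ε) : ∃ B : FinMat S, ‖B.toCLM - T‖ < ε := by
  classical
  have hT' : IsCompactOperator (star T : EllTwo S →L[ℂ] EllTwo S) := by
    rw [ContinuousLinearMap.star_eq_adjoint]
    exact isCompactOperator_adjoint hT
  obtain ⟨s, hs, hs'⟩ := ((hT.exists_cutoff_near (show 0 < ε / 3 by positivity)).and
    (hT'.exists_cutoff_near (show 0 < ε / 3 by positivity))).exists
  set p := EllTwo.cutoff s with hp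
  have hpp := EllTwo.isStarProjection_cutoff s
  have h1 : ‖T * p - T‖ ≤ ε / 3 := by
    have : T * p - T = star (p * star T - star T) := by
      rw [star_sub, star_mul, star_star, hpp.isSelfAdjoint.star_eq]
    rw [this, CStarAlgebra.norm_star]
    exact hs'
  have h2 : ‖p * T * p - T‖ < ε := by
    have : p * T * p - T = p * (T * p - T) + (p * T - T) := by
      rw [mul_sub, mul_assoc]
      abel
    rw [this]
    have h3 := norm_add_le (p * (T * p - T)) (p * T - T)
    have h4 : ‖p * (T * p - T)‖ ≤ 1 * ‖T * p - T‖ :=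
      (norm_mul_le _ _).trans (by gcongr; exact hpp.norm_le)
    linarith
  obtain ⟨B, hB⟩ := FinMat.exists_toCLM_eq (T := p * T * p) (s := s) (fun i j h => by
    rw [EllTwo.entry_apply, mul_apply_eq_comp, mul_apply_eq_comp, EllTwo.cutoff_apply] at h
    refine ⟨by by_contra hi; simp [hi] at h, ?_⟩
    by_contra hj
    have h0 : p (EllTwo.delta j) = 0 := by
      rw [hp, EllTwo.cutoff_eq]
      refine Finset.sum_eq_zero fun k hk => ?_
      rw [EllTwo.delta_apply, if_neg (fun h' : k = j => hj (h' ▸ hk)), zero_smul]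
    rw [h0, map_zero] at h
    simp at h)
  exact ⟨B, by rwa [hB]⟩

end Approximation

/-! ### Properness and equivariant approximation -/

section Proper

variable {G : Type v} {X : Type u} [Group G] [TopologicalSpace X] [MulAction G X]
  [ContinuousConstSMul G X]

theorem LocallyProperAction.exists_nhds [T2Space (MulAction.orbitRel.Quotient G X)]
    (hX : LocallyProperAction G X) (x y : X) :
    ∃ A ∈ 𝓝 x, ∃ B ∈ 𝓝 y, {g : G | ∃ z ∈ A, g • z ∈ B}.Finite := by
  let q : X → MulAction.orbitRel.Quotient G X := Quotient.mk (MulAction.orbitRel G X)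
  have hq : Continuous q := continuous_quotient_mk'
  have hqg : ∀ (g : G) z, q (g • z) = q z := fun g z => Quotient.sound ⟨g, rfl⟩
  by_cases hxy : q y = q x
  · obtain ⟨g₀, hg₀⟩ : y ∈ MulAction.orbit G x := Quotient.exact hxy
    have hg₀ : g₀ • x = y := hg₀
    obtain ⟨U, hU, -, H, hH, f, hf, -, hloc⟩ := hX x
    have hxU := mem_of_mem_nhds hU
    obtain ⟨V, hV, hxV, hVf⟩ := (IsLocallyConstant.iff_exists_open _).1 hloc ⟨x, hxU⟩
    have hA : Subtype.val '' V ∈ 𝓝 x := by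
      have h1 : V ∈ 𝓝 (⟨x, hxU⟩ : U) := hV.mem_nhds hxV
      rw [nhds_subtype_eq_comap] at h1
      obtain ⟨W, hW, hWV⟩ := h1
      filter_upwards [hW, hU] with z hz hzU
      exact ⟨⟨z, hzU⟩, hWV hz, rfl⟩
    have hAf : ∀ z ∈ Subtype.val '' V, z ∈ U ∧ f z = f x := by
      rintro _ ⟨z, hz, rfl⟩
      exact ⟨z.2, hVf z hz⟩
    have hfin : {g : G | g • f x = f x}.Finite := by
      obtain ⟨k, hk⟩ := QuotientGroup.mk_surjective (f x)
      refine ((Set.toFinite (H : Set G)).image fun h => k * h * k⁻¹).subset ?_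
      intro g hg
      have hg : g • f x = f x := hg
      rw [← hk] at hg
      have hg : ((g * k : G) : G ⧸ H) = (k : G ⧸ H) := hg
      refine ⟨k⁻¹ * g * k, ?_, by group⟩
      have := QuotientGroup.eq.1 hg.symm
      simpa [mul_assoc] using this
    refine ⟨_, hA, (fun z => g₀⁻¹ • z) ⁻¹' (Subtype.val '' V), ?_, ?_⟩
    · refine (continuous_const_smul g₀⁻¹).continuousAt.preimage_mem_nhds ?_
      rw [← hg₀, inv_smul_smul]
      exact hA
    · refine (hfin.image fun g => g₀ * g).subset ?_
      rintro g ⟨z, hz, hgz⟩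
      refine ⟨g₀⁻¹ * g, ?_, by group⟩
      have h1 := hAf z hz
      have h2 := hAf _ hgz
      simp only [← mul_smul] at h2
      have h3 := hf (g₀⁻¹ * g) z h1.1
      rw [h2.2, h1.2] at h3
      exact h3.symm
  · obtain ⟨A, B, hA, hB, hxA, hyB, hAB⟩ := t2_separation hxy
    refine ⟨q ⁻¹' B, (hB.preimage hq).mem_nhds hyB, q ⁻¹' A, (hA.preimage hq).mem_nhds hxA, ?_⟩
    convert Set.finite_empty
    refine Set.eq_empty_of_forall_notMem ?_
    rintro g ⟨z, hz, hgz⟩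
    refine Set.disjoint_left.1 hAB hgz ?_
    rw [hqg]
    exact hz

/-- The action is proper: only finitely many translates of a compact set meet another one. -/
theorem LocallyProperAction.finite_inter [T2Space (MulAction.orbitRel.Quotient G X)]
    (hX : LocallyProperAction G X) {C D : Set X} (hC : IsCompact C) (hD : IsCompact D) :
    {g : G | ∃ z ∈ C, g • z ∈ D}.Finite := by
  have h1 : ∀ x, ∃ A ∈ 𝓝 x, {g : G | ∃ z ∈ A, g • z ∈ D}.Finite := by
    intro x
    choose A hA B hB hfin using hX.exists_nhds x
    obtain ⟨t, -, ht⟩ := hD.elim_nhds_subcover B fun y _ => hB y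
    refine ⟨⋂ y ∈ t, A y, (Filter.biInter_finset_mem t).2 fun y _ => hA y,
      (t.finite_toSet.biUnion fun y _ => hfin y).subset ?_⟩
    rintro g ⟨z, hz, hgz⟩
    obtain ⟨y, hy, hgy⟩ := Set.mem_iUnion₂.1 (ht hgz)
    exact Set.mem_biUnion hy ⟨z, Set.mem_iInter₂.1 hz y hy, hgy⟩
  choose A hA hfin using h1
  obtain ⟨t, -, ht⟩ := hC.elim_nhds_subcover A fun y _ => hA y
  refine (t.finite_toSet.biUnion fun y _ => hfin y).subset ?_
  rintro g ⟨z, hz, hgz⟩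
  obtain ⟨y, hy, hgy⟩ := Set.mem_iUnion₂.1 (ht hz)
  exact Set.mem_biUnion hy ⟨z, hgy, hgz⟩

variable [T2Space X] [LocallyCompactSpace X]
  [CompactSpace (MulAction.orbitRel.Quotient G X)] [T2Space (MulAction.orbitRel.Quotient G X)]

/-- Elements of `C^*(X, G)` are uniformly approximated by regular elements of `𝒞(X, G)`. Locally
one takes constant matrices; they are combined by a `G`-invariant partition of unity
whose members are the translates of finitely many bump functions. -/
theorem exists_stdAlg_near (hX : LocallyProperAction G X) (R : RegClass G X) (F : CstarAlg G X)
    {ε : ℝ} (hε : 0 < ε) :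
    ∃ A : StdAlg G X, R.IsRegular A.1 ∧ ∀ x, ‖stdEval x A - F.1 x‖ < ε := by
  classical
  obtain ⟨K, hK, hKG⟩ := exists_compact_saturation G X
  choose B hB using fun x => (F.2.2.1 x).exists_finMat_near (half_pos hε)
  have hU : ∀ x, {y | ‖(B x).toCLM - F.1 y‖ < ε / 2} ∈ 𝓝 x := fun x =>
    (isOpen_lt (continuous_const.sub F.2.1).norm continuous_const).mem_nhds (hB x)
  choose f hf0 hfx hfc hfU hfR using fun x => R.bump x _ (hU x)
  have hfcont : ∀ x, Continuous (f x) := fun x => by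
    have : Continuous fun z => ((f x z : ℝ) : ℂ) :=
      continuous_iff_continuousAt.2 fun y => R.continuousAt (hfR x y)
    exact (Complex.continuous_re.comp this).congr fun z => Complex.ofReal_re _
  obtain ⟨t, -, ht⟩ := hK.elim_nhds_subcover (fun x => {y | f x y ≠ 0})
    fun x _ => (isOpen_ne.preimage (hfcont x)).mem_nhds (hfx x)
  -- the index set of the partition of unity, and its unnormalized members
  let ι := G × t
  let c : ι → X → ℝ := fun p y => f p.2 (p.1⁻¹ • y)
  have hc0 : ∀ p y, 0 ≤ c p y := fun p y => hf0 _ _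
  have hloc : ∀ L : Set X, IsCompact L → ∃ T : Finset ι, ∀ y ∈ L, ∀ p, c p y ≠ 0 → p ∈ T := by
    intro L hL
    have h1 : ∀ k : t, {g : G | ∃ z ∈ tsupport (f k), g • z ∈ L}.Finite := fun k =>
      hX.finite_inter (hfc k) hL
    refine ⟨Finset.univ.biUnion fun k : t => (h1 k).toFinset.image fun g => (g, k), ?_⟩
    rintro y hy ⟨g, k⟩ hne
    simp only [Finset.mem_biUnion, Finset.mem_univ, true_and, Finset.mem_image,
      Set.Finite.mem_toFinset]
    exact ⟨k, g, ⟨g⁻¹ • y, subset_tsupport _ hne, by simpa using hy⟩, rfl⟩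
  have hRc : ∀ p y, R.RegAt (fun z => (c p z : ℂ)) y := fun p y =>
    R.translate (f := fun z => (f p.2 z : ℂ)) p.1⁻¹ (hfR _ _)
  let N : X → ℝ := fun y => ∑ᶠ p, c p y
  have hN : ∀ (T : Finset ι) (y : X), (∀ p, c p y ≠ 0 → p ∈ T) → N y = ∑ p ∈ T, c p y :=
    fun T y h => finsum_eq_sum_of_support_subset _ fun p hp => h p hp
  have hNpos : ∀ y, 0 < N y := by
    intro y
    obtain ⟨T, hT⟩ := hloc {y} isCompact_singleton
    obtain ⟨g, hg⟩ := hKG y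
    obtain ⟨k, hk, hky⟩ := Set.mem_iUnion₂.1 (ht hg)
    have hcp : c (g⁻¹, ⟨k, hk⟩) y ≠ 0 := by
      simp only [c, inv_inv]
      exact hky
    rw [hN T y (hT y rfl)]
    exact Finset.sum_pos' (fun p _ => hc0 p y)
      ⟨_, hT y rfl _ hcp, lt_of_le_of_ne (hc0 _ _) (Ne.symm hcp)⟩
  let Z : ι → (EllTwo G →L[ℂ] EllTwo G) := fun p =>
    leftRegCLM p.1 * (B p.2).toCLM * leftRegCLM p.1⁻¹
  let D : X → (EllTwo G →L[ℂ] EllTwo G) := fun y => ∑ᶠ p, ((c p y : ℂ) * (N y : ℂ)⁻¹) • Z p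
  have hD : ∀ (T : Finset ι) (y : X), (∀ p, c p y ≠ 0 → p ∈ T) →
      D y = ∑ p ∈ T, ((c p y : ℂ) * (N y : ℂ)⁻¹) • Z p := fun T y h =>
    finsum_eq_sum_of_support_subset _ fun p hp => h p fun h0 => hp (by simp [h0])
  have hRN : ∀ y, R.RegAt (fun z => (N z : ℂ)) y := by
    intro y
    obtain ⟨L, hL, hyL⟩ := exists_compact_mem_nhds y
    obtain ⟨T, hT⟩ := hloc L hL
    refine R.congr (RegClass.sum T fun p _ => hRc p y) ?_
    filter_upwards [hyL] with z hz
    rw [hN T z (hT z hz), Complex.ofReal_sum]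
  have hRD : ∀ i j y, R.RegAt (fun z => EllTwo.entry i j (D z)) y := by
    intro i j y
    obtain ⟨L, hL, hyL⟩ := exists_compact_mem_nhds y
    obtain ⟨T, hT⟩ := hloc L hL
    refine R.congr (RegClass.sum T fun p _ => RegClass.mul (RegClass.mul (hRc p y)
      (RegClass.inv (hRN y) (by exact_mod_cast (hNpos y).ne')))
      (RegClass.const (EllTwo.entry i j (Z p)))) ?_
    filter_upwards [hyL] with z hz
    rw [hD T z (hT z hz), map_sum]
    simp only [map_smul, smul_eq_mul]
  have hcg : ∀ (g : G) (p : ι) y, c (g * p.1, p.2) (g • y) = c p y := fun g p y => by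
    simp only [c, mul_inv_rev, mul_smul, inv_smul_smul]
  have hmap : ∀ (g : G) (T : Finset ι) y, (∀ p, c p y ≠ 0 → p ∈ T) →
      ∀ p, c p (g • y) ≠ 0 → p ∈ T.map
        ⟨fun p : ι => (g * p.1, p.2), fun p q h => by
          have h' := Prod.ext_iff.1 h
          exact Prod.ext (mul_left_cancel h'.1) h'.2⟩ := by
    intro g T y hT p hp
    refine Finset.mem_map.2 ⟨(g⁻¹ * p.1, p.2), hT _ ?_, Prod.ext (mul_inv_cancel_left g p.1) rfl⟩
    rw [← hcg g]
    simp only [mul_inv_cancel_left]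
    exact hp
  have hNg : ∀ (g : G) y, N (g • y) = N y := by
    intro g y
    obtain ⟨T, hT⟩ := hloc {y} isCompact_singleton
    rw [hN T y (hT y rfl), hN _ _ (hmap g T y (hT y rfl)), Finset.sum_map]
    exact Finset.sum_congr rfl fun p _ => hcg g p y
  have hZg : ∀ (g : G) (p : ι), Z (g * p.1, p.2) = leftRegCLM g * Z p * leftRegCLM g⁻¹ := by
    intro g p
    simp only [Z, mul_inv_rev, ← leftRegCLM_mul, mul_assoc]
  have hDg : ∀ (g : G) y, D (g • y) = leftRegCLM g * D y * leftRegCLM g⁻¹ := by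
    intro g y
    obtain ⟨T, hT⟩ := hloc {y} isCompact_singleton
    rw [hD T y (hT y rfl), hD _ _ (hmap g T y (hT y rfl)), Finset.sum_map, Finset.mul_sum,
      Finset.sum_mul]
    refine Finset.sum_congr rfl fun p _ => ?_
    change ((c (g * p.1, p.2) (g • y) : ℂ) * (N (g • y) : ℂ)⁻¹) • Z (g * p.1, p.2) = _
    rw [hcg, hNg, hZg, mul_smul_comm, smul_mul_assoc]
  obtain ⟨A, hA⟩ := exists_stdAlg_of_entries (F := D)
    (fun i j => continuous_iff_continuousAt.2 fun y => R.continuousAt (hRD i j y)) hDg (by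
      intro L hL
      obtain ⟨T, hT⟩ := hloc L hL
      refine ⟨T.biUnion fun p => (B p.2).idx.image fun h => p.1 * h, fun y hy i j hne => ?_⟩
      rw [hD T y (hT y hy), map_sum] at hne
      obtain ⟨p, hp, hne⟩ := Finset.exists_ne_zero_of_sum_ne_zero hne
      rw [map_smul, smul_eq_mul] at hne
      have h1 := right_ne_zero_of_mul hne
      rw [EllTwo.entry_conj, EllTwo.entry_toCLM] at h1
      have h2 := (B p.2).mem_idx h1
      exact ⟨Finset.mem_biUnion.2 ⟨p, hp, Finset.mem_image.2 ⟨_, h2.1, by simp⟩⟩,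
        Finset.mem_biUnion.2 ⟨p, hp, Finset.mem_image.2 ⟨_, h2.2, by simp⟩⟩⟩)
  refine ⟨A, fun i j y => R.congr (hRD i j y) (Filter.Eventually.of_forall fun z => ?_),
    fun y => ?_⟩
  · exact (congrArg (EllTwo.entry i j) (hA z).symm).trans (EllTwo.entry_toCLM i j _)
  · obtain ⟨T, hT⟩ := hloc {y} isCompact_singleton
    have hNy : (N y : ℂ) ≠ 0 := by exact_mod_cast (hNpos y).ne'
    have hsum : ∑ p ∈ T, (c p y : ℂ) * (N y : ℂ)⁻¹ = 1 := by
      rw [← Finset.sum_mul, ← Complex.ofReal_sum, ← hN T y (hT y rfl), mul_inv_cancel₀ hNy]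
    have h1 : stdEval y A - F.1 y = ∑ p ∈ T, ((c p y : ℂ) * (N y : ℂ)⁻¹) • (Z p - F.1 y) := by
      rw [stdEval_apply, hA, hD T y (hT y rfl)]
      simp only [smul_sub]
      rw [Finset.sum_sub_distrib, ← Finset.sum_smul, hsum, one_smul]
    have h2 : ∀ p ∈ T, ‖((c p y : ℂ) * (N y : ℂ)⁻¹) • (Z p - F.1 y)‖ ≤
        c p y * (N y)⁻¹ * (ε / 2) := by
      intro p _
      have h3 : ‖(c p y : ℂ) * (N y : ℂ)⁻¹‖ = c p y * (N y)⁻¹ := by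
        rw [norm_mul, norm_inv, Complex.norm_real, Complex.norm_real, Real.norm_of_nonneg (hc0 p y),
          Real.norm_of_nonneg (hNpos y).le]
      rw [norm_smul, h3]
      by_cases hp : c p y = 0
      · simp [hp]
      · refine mul_le_mul_of_nonneg_left ?_ (mul_nonneg (hc0 p y) (inv_nonneg.2 (hNpos y).le))
        have h4 : ‖(B p.2).toCLM - F.1 (p.1⁻¹ • y)‖ < ε / 2 :=
          hfU p.2 (subset_tsupport _ hp)
        have h5 : F.1 y = leftRegCLM p.1 * F.1 (p.1⁻¹ • y) * leftRegCLM p.1⁻¹ := by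
          rw [← F.2.2.2, smul_inv_smul]
        have h6 : Z p - F.1 y =
            leftRegCLM p.1 * ((B p.2).toCLM - F.1 (p.1⁻¹ • y)) * leftRegCLM p.1⁻¹ := by
          rw [h5, mul_sub, sub_mul]
        have h7 : ∀ g : G, ‖leftRegCLM g‖ ≤ 1 := fun g =>
          (leftReg g).norm_toContinuousLinearMap_le
        rw [h6]
        calc _ ≤ ‖leftRegCLM p.1‖ * ‖(B p.2).toCLM - F.1 (p.1⁻¹ • y)‖ * ‖leftRegCLM p.1⁻¹‖ :=
              (norm_mul_le _ _).trans (mul_le_mul_of_nonneg_right (norm_mul_le _ _) (norm_nonneg _))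
          _ ≤ 1 * ‖(B p.2).toCLM - F.1 (p.1⁻¹ • y)‖ * 1 := by
              gcongr
              exacts [h7 _, h7 _]
          _ ≤ ε / 2 := by simpa using h4.le
    rw [h1]
    refine ((norm_sum_le _ _).trans (Finset.sum_le_sum h2)).trans_lt ?_
    rw [← Finset.sum_mul, ← Finset.sum_mul, ← hN T y (hT y rfl), mul_inv_cancel₀ (hNpos y).ne']
    linarith

/-- Every projection in `C^*(X, G)` is equivalent to a regular projection in `𝒞(X, G)`. -/
theorem exists_regular_proj (hX : LocallyProperAction G X) (R : RegClass G X)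
    (P : Proj (CstarAlg G X)) :
    ∃ P' : Proj (StdAlg G X), P ≈ P'.map (stdAlgToCstarAlg G X) ∧ R.IsRegular P'.1.1 := by
  obtain ⟨ε, hε, h⟩ := exists_proj_near G X
  obtain ⟨A, hA, hAP⟩ := exists_stdAlg_near hX R P.1 hε
  have hsa : ∀ x, star (P.1.1 x) = P.1.1 x := fun x =>
    congrFun (congrArg Subtype.val P.2.isSelfAdjoint.star_eq) x
  obtain ⟨P', h1, h2⟩ := h P ((2 : ℂ)⁻¹ • (A + star A)) (by
    change star _ = _
    rw [star_smul, star_add, star_star, add_comm]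
    congr 1
    simp) (fun x => by
    have h3 : stdEval x ((2 : ℂ)⁻¹ • (A + star A)) - P.1.1 x =
        (2 : ℂ)⁻¹ • ((stdEval x A - P.1.1 x) + star (stdEval x A - P.1.1 x)) := by
      rw [map_smul, map_add, map_star, star_sub, hsa]
      module
    have h4 : ‖star (stdEval x A - P.1.1 x)‖ = ‖stdEval x A - P.1.1 x‖ := CStarAlgebra.norm_star _
    have h5 := norm_add_le (stdEval x A - P.1.1 x) (star (stdEval x A - P.1.1 x))
    have h6 := hAP x
    have h7 : ‖(2 : ℂ)⁻¹‖ = 2⁻¹ := by simp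
    rw [h3, norm_smul, h7]
    linarith)
  exact ⟨P', h1, h2 R (RegClass.IsRegular.smul _ (hA.add (RegClass.IsRegular.star hA)))⟩

end Proper

/-! ### Local trivializations and regular structures -/

theorem continuousAt_mulVec {Y : Type*} [TopologicalSpace Y] {m n : ℕ}
    {b : Y → Matrix (Fin m) (Fin n) ℂ} {c : Y → Fin n → ℂ} {y : Y} (hb : ContinuousAt b y)
    (hc : ContinuousAt c y) : ContinuousAt (fun z => (b z).mulVec (c z)) y := by
  refine continuousAt_pi.2 fun i => ?_
  have h : ContinuousAt (fun z => ∑ j, b z i j * c z j) y := tendsto_finsetSum _ fun j _ =>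
    (continuousAt_pi.1 (continuousAt_pi.1 hb i) j).mul (continuousAt_pi.1 hc j)
  exact h

namespace VectFamily.LocalTriv

variable {X : Type u} [TopologicalSpace X] {V : VectFamily.{u, v} X} (e : V.LocalTriv)

theorem bijective {x : X} (hx : x ∈ e.base) : Function.Bijective (e.toFun x) := by
  constructor
  · intro w z h
    have := e.isHomeomorph.injective (a₁ := ⟨V.pt x w, hx⟩) (a₂ := ⟨V.pt x z, hx⟩)
      (Prod.ext rfl h)
    have h2 : V.pt x w = V.pt x z := congrArg Subtype.val this
    exact eq_of_heq (Sigma.mk.inj h2).2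
  · intro c
    obtain ⟨⟨⟨y, w⟩, hy⟩, h⟩ := e.isHomeomorph.surjective (⟨x, hx⟩, c)
    have h1 : y = x := congrArg Subtype.val (Prod.ext_iff.1 h).1
    subst h1
    exact ⟨w, (Prod.ext_iff.1 h).2⟩

open Classical in
/-- The inverse of a local trivialization on the fibre at `x`, with value zero if `x` is not in its
domain. -/
noncomputable def symm (x : X) : (Fin e.rank → ℂ) →ₗ[ℂ] V.fib x :=
  if hx : x ∈ e.base then (LinearEquiv.ofBijective (e.toFun x) (e.bijective hx)).symm.toLinearMap
  else 0

theorem toFun_symm {x : X} (hx : x ∈ e.base) (c : Fin e.rank → ℂ) :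
    e.toFun x (e.symm x c) = c := by
  rw [symm, dif_pos hx]
  exact (LinearEquiv.ofBijective (e.toFun x) (e.bijective hx)).apply_symm_apply c

theorem symm_toFun {x : X} (hx : x ∈ e.base) (w : V.fib x) : e.symm x (e.toFun x w) = w :=
  (e.bijective hx).1 (e.toFun_symm hx _)

theorem eventually_mem {x : X} (hx : x ∈ e.base) : ∀ᶠ y in 𝓝 x, y ∈ e.base :=
  e.isOpen_base.mem_nhds hx

/-- The frame of `V` over the domain of a local trivialization. -/
noncomputable def frame (j : Fin e.rank) (x : X) : V.fib x := e.symm x (Pi.single j 1)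

theorem symm_eq_sum (x : X) (c : Fin e.rank → ℂ) : e.symm x c = ∑ j, c j • e.frame j x := by
  conv_lhs => rw [pi_eq_sum_univ' c, map_sum]
  refine Finset.sum_congr rfl fun j _ => ?_
  rw [map_smul]
  congr 2

theorem eq_sum_frame {x : X} (hx : x ∈ e.base) (w : V.fib x) :
    w = ∑ j, e.toFun x w j • e.frame j x := by
  rw [← symm_eq_sum, e.symm_toFun hx]

theorem continuousAt_to {Y : Type*} [TopologicalSpace Y] {f : Y → V.Total} {y₀ : Y}
    (hy : (f y₀).1 ∈ e.base) (h1 : ContinuousAt (fun y => (f y).1) y₀)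
    (h2 : ContinuousAt (fun y => e.toFun (f y).1 (f y).2) y₀) : ContinuousAt f y₀ := by
  classical
  let H := e.isHomeomorph.homeomorph
  let F : Y → e.base × (Fin e.rank → ℂ) := fun y =>
    (if h : (f y).1 ∈ e.base then ⟨(f y).1, h⟩ else ⟨(f y₀).1, hy⟩, e.toFun (f y).1 (f y).2)
  have hev : ∀ᶠ y in 𝓝 y₀, (f y).1 ∈ e.base := h1.eventually (e.eventually_mem hy)
  have hF : ContinuousAt F y₀ := by
    refine ContinuousAt.prodMk ?_ h2
    rw [Topology.IsInducing.subtypeVal.continuousAt_iff]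
    refine h1.congr ?_
    filter_upwards [hev] with y hy'
    simp [hy']
  have hc : ContinuousAt (fun y => (H.symm (F y)).1) y₀ :=
    (continuous_subtype_val.comp H.symm.continuous).continuousAt.comp hF
  refine hc.congr ?_
  filter_upwards [hev] with y hy'
  have : F y = H ⟨f y, hy'⟩ := by
    simp only [F, dif_pos hy']
    rfl
  rw [this, H.symm_apply_apply]

theorem continuousAt_coord (hV : Continuous fun p : V.Total => p.1) {p : V.Total}
    (hp : p.1 ∈ e.base) : ContinuousAt (fun p : V.Total => e.toFun p.1 p.2) p := by
  have h1 : ContinuousOn (fun p : V.Total => e.toFun p.1 p.2) {p | p.1 ∈ e.base} := by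
    rw [continuousOn_iff_continuous_domRestrict]
    exact continuous_snd.comp e.isHomeomorph.continuous
  exact h1.continuousAt ((e.isOpen_base.preimage hV).mem_nhds hp)

theorem continuousAt_symm {Y : Type*} [TopologicalSpace Y] {f : Y → X} {c : Y → Fin e.rank → ℂ}
    {y₀ : Y} (hy : f y₀ ∈ e.base) (hf : ContinuousAt f y₀) (hc : ContinuousAt c y₀) :
    ContinuousAt (fun y => V.pt (f y) (e.symm (f y) (c y))) y₀ := by
  refine e.continuousAt_to hy hf (hc.congr ?_)
  filter_upwards [hf.eventually (e.eventually_mem hy)] with y hy'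
  exact (e.toFun_symm hy' (c y)).symm

/-- A local trivialization multiplied with a continuous invertible matrix over an open subset of
its domain. -/
noncomputable def adjust (hV : Continuous fun p : V.Total => p.1) {U : Set X} (hU : IsOpen U)
    (hsub : U ⊆ e.base) (b : X → Matrix (Fin e.rank) (Fin e.rank) ℂ)
    (hb : ∀ x ∈ U, ∀ i j, ContinuousAt (fun y => b y i j) x) (hdet : ∀ x ∈ U, (b x).det ≠ 0) :
    V.LocalTriv where
  rank := e.rank
  base := U
  isOpen_base := hU
  toFun x := (b x).mulVecLin ∘ₗ e.toFun x
  isHomeomorph := by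
    have hbm : ∀ x ∈ U, ContinuousAt b x := fun x hx =>
      continuousAt_pi.2 fun i => continuousAt_pi.2 fun j => hb x hx i j
    rw [isHomeomorph_iff_exists_inverse]
    refine ⟨?_, fun q => ⟨V.pt q.1 (e.symm q.1 ((b q.1)⁻¹.mulVec q.2)), q.1.2⟩, ?_, ?_, ?_⟩
    · refine Continuous.prodMk ((hV.comp continuous_subtype_val).subtype_mk _) ?_
      rw [continuous_iff_continuousAt]
      intro p
      have h1 : ContinuousAt (fun p : {p : V.Total // p.1 ∈ U} => b p.1.1) p :=
        ContinuousAt.comp (f := fun p : {p : V.Total // p.1 ∈ U} => p.1.1) (hbm _ p.2)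
          (hV.comp continuous_subtype_val).continuousAt
      have h2 : ContinuousAt (fun p : {p : V.Total // p.1 ∈ U} => e.toFun p.1.1 p.1.2) p :=
        ContinuousAt.comp (f := Subtype.val) (e.continuousAt_coord hV (hsub p.2))
          continuous_subtype_val.continuousAt
      exact continuousAt_mulVec h1 h2
    · intro p
      refine Subtype.ext ?_
      change V.pt p.1.1 (e.symm p.1.1 ((b p.1.1)⁻¹.mulVec ((b p.1.1).mulVec
        (e.toFun p.1.1 p.1.2)))) = p.1
      rw [Matrix.mulVec_mulVec, Matrix.nonsing_inv_mul _ (isUnit_iff_ne_zero.2 (hdet _ p.2)),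
        Matrix.one_mulVec, e.symm_toFun (hsub p.2)]
      rfl
    · intro q
      refine Prod.ext rfl ?_
      change (b q.1).mulVec (e.toFun q.1 (e.symm q.1 ((b q.1)⁻¹.mulVec q.2))) = q.2
      rw [e.toFun_symm (hsub q.1.2), Matrix.mulVec_mulVec,
        Matrix.mul_nonsing_inv _ (isUnit_iff_ne_zero.2 (hdet _ q.1.2)), Matrix.one_mulVec]
    · refine Continuous.subtype_mk ?_ _
      rw [continuous_iff_continuousAt]
      intro q
      have hq : ContinuousAt (fun q : U × (Fin e.rank → ℂ) => (q.1 : X)) q :=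
        (continuous_subtype_val.comp continuous_fst).continuousAt
      refine e.continuousAt_symm (hsub q.1.2) hq ?_
      have h1 : ContinuousAt (fun y => (b y)⁻¹) q.1 := by
        simp only [Matrix.inv_def, Ring.inverse_eq_inv']
        have h2 := hbm _ q.1.2
        exact ((continuous_id.matrix_det.continuousAt.comp h2).inv₀ (hdet _ q.1.2)).smul
          (continuous_id.matrix_adjugate.continuousAt.comp h2)
      have h2 : ContinuousAt (fun q : U × (Fin e.rank → ℂ) => (b q.1)⁻¹) q :=
        ContinuousAt.comp (f := fun q : U × (Fin e.rank → ℂ) => (q.1 : X)) h1 hq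
      exact continuousAt_mulVec h2 continuous_snd.continuousAt

end VectFamily.LocalTriv

namespace RegClass

variable {G : Type v} {X : Type u} [Group G] [TopologicalSpace X] [MulAction G X]

/-- The two-sided inverse of a matrix with regular entries has regular entries. -/
theorem regAt_of_inverse (R : RegClass G X) {m n : ℕ} {a : X → Matrix (Fin m) (Fin n) ℂ}
    {b : X → Matrix (Fin n) (Fin m) ℂ} {x : X} (ha : ∀ i j, R.RegAt (fun y => a y i j) x)
    (hab : ∀ᶠ y in 𝓝 x, a y * b y = 1) (hba : ∀ᶠ y in 𝓝 x, b y * a y = 1) (i : Fin n)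
    (j : Fin m) : R.RegAt (fun y => b y i j) x := by
  have hmn : m = n := by
    have e : (Fin n → ℂ) ≃ₗ[ℂ] (Fin m → ℂ) := LinearEquiv.ofLinearMap (Matrix.mulVecLin (a x))
      (Matrix.mulVecLin (b x)) (by rw [← Matrix.mulVecLin_mul, hab.self_of_nhds,
        Matrix.mulVecLin_one]) (by rw [← Matrix.mulVecLin_mul, hba.self_of_nhds,
        Matrix.mulVecLin_one])
    simpa using e.finrank_eq.symm
  subst hmn
  have hdet : (a x).det ≠ 0 := fun h => by
    have := congrArg Matrix.det hab.self_of_nhds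
    simp [h] at this
  refine R.congr (matrix_inv ha hdet i j) ?_
  filter_upwards [hab] with y hy
  rw [Matrix.inv_eq_right_inv hy]

/-- A fibrewise linear map covering `f` is regular with respect to given local trivializations if
its matrix entries are. -/
def RegIn (R : RegClass G X) {V W : VectFamily.{u, v} X} (e : V.LocalTriv) (e' : W.LocalTriv)
    (f : X → X) (φ : ∀ x, V.fib x →ₗ[ℂ] W.fib (f x)) : Prop :=
  ∀ x ∈ e.base, f x ∈ e'.base → ∀ i j, R.RegAt (fun y => e'.toFun (f y) (φ y (e.frame j y)) i) x

variable {R : RegClass G X} {V W Z : VectFamily.{u, v} X}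

theorem toFun_eq_sum {e : V.LocalTriv} {x : X} (hx : x ∈ e.base) {f : X → X} {e' : W.LocalTriv}
    (φ : V.fib x →ₗ[ℂ] W.fib (f x)) (w : V.fib x) (i : Fin e'.rank) :
    e'.toFun (f x) (φ w) i = ∑ j, e'.toFun (f x) (φ (e.frame j x)) i * e.toFun x w j := by
  conv_lhs => rw [e.eq_sum_frame hx w]
  simp only [map_sum, map_smul, Finset.sum_apply, Pi.smul_apply, smul_eq_mul, mul_comm]

/-- The inverse of a regular fibrewise isomorphism is regular. -/
theorem RegIn.symm {e : V.LocalTriv} {e' : W.LocalTriv} {φ : ∀ x, V.fib x ≃ₗ[ℂ] W.fib x}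
    (h : R.RegIn e e' id fun x => (φ x).toLinearMap) :
    R.RegIn e' e id fun x => (φ x).symm.toLinearMap := by
  intro x hx' hx i j
  have key : ∀ {V W : VectFamily.{u, v} X} (e : V.LocalTriv) (e' : W.LocalTriv)
      (φ : ∀ x, V.fib x ≃ₗ[ℂ] W.fib x) (y : X) (_ : y ∈ e.base) (_ : y ∈ e'.base),
      (Matrix.of fun i j => e'.toFun y (φ y (e.frame j y)) i) *
        (Matrix.of fun i j => e.toFun y ((φ y).symm (e'.frame j y)) i) = 1 := by
    intro V W e e' φ y hy hy'
    ext i j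
    rw [Matrix.mul_apply]
    refine (toFun_eq_sum (f := id) (e := e) (e' := e') hy (φ y).toLinearMap
      ((φ y).symm (e'.frame j y)) i).symm.trans ?_
    have : (φ y).toLinearMap ((φ y).symm (e'.frame j y)) = e'.frame j y :=
      (φ y).apply_symm_apply _
    rw [this]
    refine (congrFun (e'.toFun_symm hy' (Pi.single j 1)) i).trans ?_
    rw [Matrix.one_apply, Pi.single_apply]
  have hev := (e.eventually_mem hx).and (e'.eventually_mem hx')
  exact R.regAt_of_inverse (a := fun y => Matrix.of fun i j => e'.toFun y (φ y (e.frame j y)) i)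
    (b := fun y => Matrix.of fun i j => e.toFun y ((φ y).symm (e'.frame j y)) i)
    (fun i j => h x hx hx' i j)
    (hev.mono fun y hy => key e e' φ y hy.1 hy.2)
    (hev.mono fun y hy => key e' e (fun x => (φ x).symm) y hy.2 hy.1) i j

section Cont

variable [ContinuousConstSMul G X] [T2Space X] [LocallyCompactSpace X]

/-- Continuous bundle maps are regular for the class of continuous functions. -/
theorem regIn_cont {e : V.LocalTriv} {e' : W.LocalTriv} {f : X → X}
    {φ : ∀ x, V.fib x →ₗ[ℂ] W.fib (f x)} (hW : Continuous fun p : W.Total => p.1)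
    (hφ : Continuous fun p : V.Total => W.pt (f p.1) (φ p.1 p.2)) :
    (cont G X).RegIn e e' f φ := by
  intro x hx hx' i j
  have h1 : ContinuousAt (fun y => V.pt y (e.frame j y)) x :=
    e.continuousAt_symm hx continuousAt_id continuousAt_const
  have h2 : ContinuousAt (fun y => W.pt (f y) (φ y (e.frame j y))) x :=
    ContinuousAt.comp (f := fun y => V.pt y (e.frame j y)) hφ.continuousAt h1
  have h3 := ContinuousAt.comp (f := fun y => W.pt (f y) (φ y (e.frame j y)))
    (e'.continuousAt_coord hW hx') h2
  exact continuousAt_pi.1 h3 i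

theorem continuous_of_regIn (hV : Continuous fun p : V.Total => p.1)
    {φ : ∀ x, V.fib x →ₗ[ℂ] W.fib x}
    (h : ∀ x, ∃ (e : V.LocalTriv) (e' : W.LocalTriv), x ∈ e.base ∧ x ∈ e'.base ∧
      (cont G X).RegIn e e' id φ) :
    Continuous fun p : V.Total => W.pt p.1 (φ p.1 p.2) := by
  rw [continuous_iff_continuousAt]
  intro p
  obtain ⟨e, e', hx, hx', hφ⟩ := h p.1
  refine e'.continuousAt_to hx' hV.continuousAt (continuousAt_pi.2 fun i => ?_)
  have h1 : ContinuousAt (fun q : V.Total => ∑ j, e'.toFun q.1 (φ q.1 (e.frame j q.1)) i *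
      e.toFun q.1 q.2 j) p := by
    refine tendsto_finsetSum _ fun j _ => ContinuousAt.mul ?_ ?_
    · exact ContinuousAt.comp (f := fun q : V.Total => q.1) (hφ p.1 hx hx' i j) hV.continuousAt
    · exact continuousAt_pi.1 (e.continuousAt_coord hV hx) j
  refine h1.congr ?_
  filter_upwards [hV.continuousAt.eventually (e.eventually_mem hx)] with q hq
  exact (toFun_eq_sum (f := id) (e := e) (e' := e') hq (φ q.1) q.2 i).symm

/-- A continuous fibrewise isomorphism has a continuous inverse. -/
theorem continuous_symm (G : Type v) [Group G] [MulAction G X] [ContinuousConstSMul G X]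
    (hW : Continuous fun p : W.Total => p.1) (hV' : ∀ x, ∃ e : V.LocalTriv, x ∈ e.base)
    (hW' : ∀ x, ∃ e : W.LocalTriv, x ∈ e.base) {φ : ∀ x, V.fib x ≃ₗ[ℂ] W.fib x}
    (h : Continuous fun p : V.Total => W.pt p.1 (φ p.1 p.2)) :
    Continuous fun p : W.Total => V.pt p.1 ((φ p.1).symm p.2) := by
  refine continuous_of_regIn (G := G) (φ := fun x => (φ x).symm.toLinearMap) hW fun x => ?_
  obtain ⟨e, hx⟩ := hV' x
  obtain ⟨e', hx'⟩ := hW' x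
  refine ⟨e', e, hx', hx, RegIn.symm ?_⟩
  exact regIn_cont (f := id) (φ := fun x => (φ x).toLinearMap) hW h

end Cont

/-- A regular structure on a `G`-bundle: an atlas of local trivializations for which the transition
functions and the action of `G` are regular. -/
structure RegStructure (R : RegClass G X) (V : GBundle.{u, v} G X) where
  atlas : Set V.LocalTriv
  cover : ∀ x, ∃ e ∈ atlas, x ∈ e.base
  compatible : ∀ e ∈ atlas, ∀ e' ∈ atlas, R.RegIn e e' id fun _ => LinearMap.id
  regular_act : ∀ g : G, ∀ e ∈ atlas, ∀ e' ∈ atlas, R.RegIn e e' (fun x => g • x) (V.act g)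

/-- Every `G`-bundle is regular for the class of continuous functions. -/
def RegStructure.cont [ContinuousConstSMul G X] [T2Space X] [LocallyCompactSpace X]
    (V : GBundle.{u, v} G X) : (cont G X).RegStructure V where
  atlas := Set.univ
  cover x := (V.locallyTrivial x).imp fun _ he => ⟨trivial, he⟩
  compatible _ _ _ _ := regIn_cont (f := id) (φ := fun _ => LinearMap.id) V.continuous_proj
    continuous_id
  regular_act g _ _ _ _ := regIn_cont V.continuous_proj (V.continuous_act g)

end RegClass

/-! ### Embeddings of bundles into `X × ℂ[G]` -/

section StdInner

variable {S : Type*}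

open StdBundle

theorem stdInner_eq_linearCombination (w z : S →₀ ℂ) :
    stdInner w z = Finsupp.linearCombination ℂ (fun h => star (w h)) z := by
  rw [Finsupp.linearCombination_apply, stdInner]
  simp [mul_comm]

theorem star_stdInner (w z : S →₀ ℂ) : star (stdInner z w) = stdInner w z :=
  (stdCore (⊤ : Submodule ℂ (S →₀ ℂ))).conj_inner_symm ⟨w, trivial⟩ ⟨z, trivial⟩

theorem eq_zero_of_stdInner_self {w : S →₀ ℂ} (h : stdInner w w = 0) : w = 0 :=
  congrArg Subtype.val ((stdCore (⊤ : Submodule ℂ (S →₀ ℂ))).definite ⟨w, trivial⟩ h)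

theorem stdInner_add_right (w z z' : S →₀ ℂ) :
    stdInner w (z + z') = stdInner w z + stdInner w z' := by
  simp only [stdInner_eq_linearCombination, map_add]

theorem stdInner_smul_right (w z : S →₀ ℂ) (c : ℂ) : stdInner w (c • z) = c * stdInner w z := by
  simp only [stdInner_eq_linearCombination, map_smul, smul_eq_mul]

theorem stdInner_sub_right (w z z' : S →₀ ℂ) :
    stdInner w (z - z') = stdInner w z - stdInner w z' := by
  simp only [stdInner_eq_linearCombination, map_sub]

theorem stdInner_sum_right {ι : Type*} (s : Finset ι) (w : S →₀ ℂ) (z : ι → S →₀ ℂ) :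
    stdInner w (∑ i ∈ s, z i) = ∑ i ∈ s, stdInner w (z i) := by
  simp only [stdInner_eq_linearCombination, map_sum]

theorem stdInner_sum_left {ι : Type*} (s : Finset ι) (w : S →₀ ℂ) (z : ι → S →₀ ℂ) :
    stdInner (∑ i ∈ s, z i) w = ∑ i ∈ s, stdInner (z i) w := by
  rw [← star_stdInner, stdInner_sum_right, star_sum]
  simp only [star_stdInner]

theorem stdInner_smul_left (w z : S →₀ ℂ) (c : ℂ) :
    stdInner (c • w) z = star c * stdInner w z := by
  rw [← star_stdInner, stdInner_smul_right, star_mul', star_stdInner]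

theorem stdInner_single_right (w : S →₀ ℂ) (h : S) :
    stdInner w (Finsupp.single h 1) = star (w h) := by
  simp [stdInner_eq_linearCombination]

theorem stdInner_single_left (w : S →₀ ℂ) (h : S) :
    stdInner (Finsupp.single h 1) w = w h := by
  rw [← star_stdInner, stdInner_single_right, star_star]

theorem stdInner_leftTranslate {G : Type v} [Group G] (g : G) (a b : G →₀ ℂ) :
    stdInner (leftTranslate g a) (leftTranslate g b) = stdInner a b := by
  classical
  rw [stdInner_eq _ _ (b.support.image fun h => g * h), stdInner_eq _ _ _ subset_rfl,
    Finset.sum_image fun _ _ _ _ h => mul_left_cancel h]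
  · simp [leftTranslate_apply]
  · intro h hh
    rw [Finsupp.mem_support_iff, leftTranslate_apply] at hh
    exact Finset.mem_image.2 ⟨g⁻¹ * h, Finsupp.mem_support_iff.2 hh, by simp⟩

theorem FinMat.toLin_single (A : FinMat S) (i j : S) :
    A.toLin (Finsupp.single j 1) i = A i j := by
  classical
  rw [FinMat.toLin_apply A _ i {j} fun k _ h => ?_]
  · simp
  · rw [Finset.mem_singleton]
    by_contra hc
    exact h (Finsupp.single_eq_of_ne hc)

theorem FinMat.toLin_injective {A B : FinMat S} (h : ∀ w, A.toLin w = B.toLin w) : A = B :=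
  FinMat.ext fun i j => by rw [← toLin_single, h, toLin_single]

theorem FinMat.star_eq_of_stdInner {A B : FinMat S}
    (h : ∀ w z, stdInner (A.toLin w) z = stdInner w (B.toLin z)) : star A = B :=
  FinMat.ext fun i j => by
    have := h (Finsupp.single i 1) (Finsupp.single j 1)
    rwa [stdInner_single_right, stdInner_single_left, toLin_single, toLin_single] at this

end StdInner

namespace GBundle

variable {G : Type v} {X : Type u} [Group G] [TopologicalSpace X] [MulAction G X]

theorem act_surjective (V : GBundle.{u, v} G X) (g : G) (x : X) :
    Function.Surjective (V.act g x) := by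
  intro u
  have key : ∀ q : V.Total, q.1 = x → V.pt (g • q.1) (V.act g q.1 q.2) = V.pt (g • x) u →
      ∃ w, V.act g x w = u := by
    rintro ⟨y, w⟩ hy h
    obtain rfl : y = x := hy
    exact ⟨w, eq_of_heq (Sigma.mk.inj h).2⟩
  refine key (V.pt (g⁻¹ • g • x) (V.act g⁻¹ (g • x) u)) (inv_smul_smul g x) ?_
  have h1 := V.act_mul g g⁻¹ (g • x) u
  have h2 : ∀ k : G, k = 1 → V.pt (k • g • x) (V.act k (g • x) u) = V.pt (g • x) u := by
    rintro _ rfl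
    exact V.act_one _ _
  exact h1.symm.trans (h2 _ (mul_inv_cancel g))

/-- An embedding of a `G`-bundle into `X × ℂ[G]`: a continuous equivariant family of injective
linear maps into `ℂ[G]` that take values in some `ℂ[S]`, with `S` finite, over each compact set. -/
structure Embedding (V : GBundle.{u, v} G X) where
  toLin : ∀ x, V.fib x →ₗ[ℂ] (G →₀ ℂ)
  injective : ∀ x, Function.Injective (toLin x)
  map_act : ∀ g x w, toLin (g • x) (V.act g x w) = leftTranslate g (toLin x w)
  finite_on : ∀ K : Set X, IsCompact K → ∃ S : Finset G, ∀ x ∈ K, ∀ w,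
    toLin x w ∈ Finsupp.supported ℂ ℂ (S : Set G)
  continuous : ∀ h, Continuous fun p : V.Total => toLin p.1 p.2 h

namespace Embedding

open StdBundle

variable {V W : GBundle.{u, v} G X} (T : V.Embedding) (T' : W.Embedding)

/-- The Gram matrix of the image of the frame belonging to a local trivialization. -/
noncomputable def gram (e : V.LocalTriv) (x : X) : Matrix (Fin e.rank) (Fin e.rank) ℂ :=
  Matrix.of fun a b => stdInner (T.toLin x (e.frame a x)) (T.toLin x (e.frame b x))

theorem gram_mulVec (e : V.LocalTriv) (x : X) (c : Fin e.rank → ℂ) (a : Fin e.rank) :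
    (T.gram e x).mulVec c a = stdInner (T.toLin x (e.frame a x)) (T.toLin x (e.symm x c)) := by
  rw [e.symm_eq_sum, map_sum, stdInner_sum_right]
  simp [gram, Matrix.mulVec, dotProduct, stdInner_smul_right, mul_comm]

theorem gram_det_ne_zero (e : V.LocalTriv) {x : X} (hx : x ∈ e.base) : (T.gram e x).det ≠ 0 := by
  intro h
  obtain ⟨c, hc, h0⟩ := Matrix.exists_mulVec_eq_zero_iff.2 h
  have h1 : stdInner (T.toLin x (e.symm x c)) (T.toLin x (e.symm x c)) = 0 := by
    conv_lhs => enter [1]; rw [e.symm_eq_sum, map_sum]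
    rw [stdInner_sum_left]
    refine Finset.sum_eq_zero fun a _ => ?_
    rw [map_smul, stdInner_smul_left, ← gram_mulVec, h0]
    simp
  have h2 : e.symm x c = 0 := T.injective x ((eq_zero_of_stdInner_self h1).trans (map_zero _).symm)
  have h3 := e.toFun_symm hx c
  rw [h2, map_zero] at h3
  exact hc h3.symm

theorem eq_of_stdInner {x : X} {v v' : V.fib x}
    (h : ∀ u, stdInner (T.toLin x u) (T.toLin x v) = stdInner (T.toLin x u) (T.toLin x v')) :
    v = v' := by
  have h1 := h (v - v')
  rw [← sub_eq_zero, ← stdInner_sub_right, ← map_sub] at h1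
  exact sub_eq_zero.1 (T.injective x ((eq_zero_of_stdInner_self h1).trans (map_zero _).symm))

theorem exists_pinv (x : X) (w : G →₀ ℂ) :
    ∃ v, ∀ u, stdInner (T.toLin x u) w = stdInner (T.toLin x u) (T.toLin x v) := by
  obtain ⟨e, hx⟩ := V.locallyTrivial x
  refine ⟨e.symm x ((T.gram e x)⁻¹.mulVec fun a => stdInner (T.toLin x (e.frame a x)) w),
    fun u => ?_⟩
  have h1 : ∀ a, stdInner (T.toLin x (e.frame a x)) w = stdInner (T.toLin x (e.frame a x))
      (T.toLin x (e.symm x ((T.gram e x)⁻¹.mulVec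
        fun a => stdInner (T.toLin x (e.frame a x)) w))) := by
    intro a
    rw [← gram_mulVec, Matrix.mulVec_mulVec,
      Matrix.mul_nonsing_inv _ (isUnit_iff_ne_zero.2 (T.gram_det_ne_zero e hx)),
      Matrix.one_mulVec]
  rw [e.eq_sum_frame hx u, map_sum, stdInner_sum_left, stdInner_sum_left]
  refine Finset.sum_congr rfl fun a _ => ?_
  rw [map_smul, stdInner_smul_left, stdInner_smul_left, ← h1]

/-- The pseudo-inverse of an embedding: it inverts `T` on the range of `T` and vanishes on the
orthogonal complement. -/
noncomputable def pinv (x : X) : (G →₀ ℂ) →ₗ[ℂ] V.fib x where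
  toFun w := (T.exists_pinv x w).choose
  map_add' w z := T.eq_of_stdInner fun u => by
    rw [map_add, stdInner_add_right, ← (T.exists_pinv x w).choose_spec,
      ← (T.exists_pinv x z).choose_spec, ← (T.exists_pinv x (w + z)).choose_spec,
      stdInner_add_right]
  map_smul' c w := T.eq_of_stdInner fun u => by
    rw [map_smul, stdInner_smul_right, ← (T.exists_pinv x _).choose_spec,
      ← (T.exists_pinv x _).choose_spec, stdInner_smul_right, RingHom.id_apply]

theorem stdInner_pinv (x : X) (u : V.fib x) (w : G →₀ ℂ) :
    stdInner (T.toLin x u) (T.toLin x (T.pinv x w)) = stdInner (T.toLin x u) w :=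
  ((T.exists_pinv x w).choose_spec u).symm

@[simp] theorem pinv_toLin (x : X) (v : V.fib x) : T.pinv x (T.toLin x v) = v :=
  T.eq_of_stdInner fun u => T.stdInner_pinv x u _

theorem pinv_eq_zero {x : X} {w : G →₀ ℂ} (h : ∀ u, stdInner (T.toLin x u) w = 0) :
    T.pinv x w = 0 :=
  T.eq_of_stdInner fun u => by
    rw [stdInner_pinv, h, map_zero, stdInner_eq_linearCombination, map_zero]

theorem pinv_leftTranslate (g : G) (x : X) (w : G →₀ ℂ) :
    T.pinv (g • x) (leftTranslate g w) = V.act g x (T.pinv x w) := by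
  refine T.eq_of_stdInner fun u => ?_
  obtain ⟨u, rfl⟩ := V.act_surjective g x u
  rw [stdInner_pinv, T.map_act, T.map_act, stdInner_leftTranslate, stdInner_leftTranslate,
    stdInner_pinv]

theorem toLin_pinv_single_ne_zero {T T' : V.Embedding} {x : X} {S S' : Finset G}
    (hS : ∀ w, T.toLin x w ∈ Finsupp.supported ℂ ℂ (S : Set G))
    (hS' : ∀ w, T'.toLin x w ∈ Finsupp.supported ℂ ℂ (S' : Set G)) {g h : G}
    (hne : T'.toLin x (T.pinv x (Finsupp.single h 1)) g ≠ 0) : g ∈ S' ∧ h ∈ S := by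
  constructor
  · exact (Finsupp.mem_supported ℂ _).1 (hS' _) (Finsupp.mem_support_iff.2 hne)
  · by_contra hh
    apply hne
    rw [T.pinv_eq_zero fun u => ?_, map_zero, Finsupp.zero_apply]
    rw [stdInner_single_right, star_eq_zero]
    by_contra hc
    exact hh ((Finsupp.mem_supported ℂ _).1 (hS u) (Finsupp.mem_support_iff.2 hc))

/-- A local trivialization is regular for an embedding if its frame is given by vectors in `ℂ[G]`
with regular coordinates. -/
def RegTriv (R : RegClass G X) (e : V.LocalTriv) : Prop :=
  ∀ x ∈ e.base, ∀ k h, R.RegAt (fun y => T.toLin y (e.frame k y) h) x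

theorem regTriv_cont [ContinuousConstSMul G X] [T2Space X] [LocallyCompactSpace X]
    (e : V.LocalTriv) : T.RegTriv (RegClass.cont G X) e := fun _ hx k h =>
  ContinuousAt.comp (f := fun y => V.pt y (e.frame k y)) (T.continuous h).continuousAt
    (e.continuousAt_symm hx continuousAt_id continuousAt_const)

theorem eq_sum_pinv {y : X} {S : Finset G}
    (hS : ∀ w, T.toLin y w ∈ Finsupp.supported ℂ ℂ (S : Set G)) (v : V.fib y) :
    v = ∑ h ∈ S, T.toLin y v h • T.pinv y (Finsupp.single h 1) := by
  have hsub : (T.toLin y v).support ⊆ S := by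
    exact_mod_cast (Finsupp.mem_supported ℂ _).1 (hS v)
  conv_lhs => rw [← T.pinv_toLin y v, ← Finsupp.sum_single (T.toLin y v)]
  rw [Finsupp.sum_of_support_subset _ hsub _ (by simp), map_sum]
  refine Finset.sum_congr rfl fun h _ => ?_
  rw [← map_smul, Finsupp.smul_single, smul_eq_mul, mul_one]

variable [LocallyCompactSpace X]

theorem eventually_supported (x : X) : ∃ S : Finset G, ∀ᶠ y in 𝓝 x, ∀ w,
    T.toLin y w ∈ Finsupp.supported ℂ ℂ (S : Set G) := by
  obtain ⟨K, hK, hxK⟩ := exists_compact_mem_nhds x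
  obtain ⟨S, hS⟩ := T.finite_on K hK
  exact ⟨S, Filter.mem_of_superset hxK fun y hy => hS y hy⟩

variable {R : RegClass G X}

theorem RegTriv.regAt_gram {T : V.Embedding} {e : V.LocalTriv} (he : T.RegTriv R e) {x : X}
    (hx : x ∈ e.base) (a b : Fin e.rank) : R.RegAt (fun y => T.gram e y a b) x := by
  obtain ⟨S, hS⟩ := T.eventually_supported x
  refine R.congr (RegClass.sum S fun h _ => RegClass.mul (RegClass.star (he x hx a h))
    (he x hx b h)) ?_
  filter_upwards [hS] with y hy
  have := (Finsupp.mem_supported ℂ _).1 (hy (e.frame b y))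
  exact (stdInner_eq _ _ S (by exact_mod_cast this)).symm

/-- The coordinates of the pseudo-inverse in a regular local trivialization are regular. -/
theorem RegTriv.regAt_pinv {T : V.Embedding} {e : V.LocalTriv} (he : T.RegTriv R e) {x : X}
    (hx : x ∈ e.base) (h : G) (i : Fin e.rank) :
    R.RegAt (fun y => e.toFun y (T.pinv y (Finsupp.single h 1)) i) x := by
  refine R.congr (RegClass.sum Finset.univ fun a _ => RegClass.mul
    (RegClass.matrix_inv (he.regAt_gram hx) (T.gram_det_ne_zero e hx) i a)
    (RegClass.star (he x hx a h))) ?_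
  filter_upwards [e.eventually_mem hx] with y hy
  have h1 : e.toFun y (T.pinv y (Finsupp.single h 1)) = (T.gram e y)⁻¹.mulVec
      fun a => star (T.toLin y (e.frame a y) h) := by
    have h2 : (T.gram e y).mulVec (e.toFun y (T.pinv y (Finsupp.single h 1))) =
        fun a => star (T.toLin y (e.frame a y) h) := by
      ext a
      rw [gram_mulVec, e.symm_toFun hy, stdInner_pinv, stdInner_single_right]
    rw [← h2, Matrix.mulVec_mulVec,
      Matrix.nonsing_inv_mul _ (isUnit_iff_ne_zero.2 (T.gram_det_ne_zero e hy)),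
      Matrix.one_mulVec]
  rw [h1]
  rfl

/-- A section whose image in `ℂ[G]` is regular has regular coordinates in regular
trivializations. -/
theorem RegTriv.regAt_toFun {T : V.Embedding} {e : V.LocalTriv} (he : T.RegTriv R e) {f : X → X}
    {x : X} (hf : ContinuousAt f x) (hfR : ∀ F, R.RegAt F (f x) → R.RegAt (fun y => F (f y)) x)
    (hx : f x ∈ e.base) {s : ∀ y, V.fib (f y)}
    (hs : ∀ h, R.RegAt (fun y => T.toLin (f y) (s y) h) x) (i : Fin e.rank) :
    R.RegAt (fun y => e.toFun (f y) (s y) i) x := by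
  obtain ⟨S, hS⟩ := T.eventually_supported (f x)
  refine R.congr (RegClass.sum S fun h _ => RegClass.mul (hs h)
    (hfR _ (he.regAt_pinv hx h i))) ?_
  filter_upwards [hf.eventually hS] with y hy
  conv_rhs => rw [T.eq_sum_pinv hy (s y)]
  simp

theorem regAt_toLin_pinv {R : RegClass G X} {T T' : V.Embedding} {x : X} {e : V.LocalTriv}
    (hx : x ∈ e.base) (he : T.RegTriv R e) (he' : T'.RegTriv R e) (g h : G) :
    R.RegAt (fun y => T'.toLin y (T.pinv y (Finsupp.single h 1)) g) x := by
  refine R.congr (RegClass.sum Finset.univ fun i _ => RegClass.mul (he.regAt_pinv hx h i)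
    (he' x hx i g)) ?_
  filter_upwards [e.eventually_mem hx] with y hy
  conv_rhs => rw [e.eq_sum_frame hy (T.pinv y (Finsupp.single h 1))]
  simp

end Embedding

end GBundle

/-! ### Embeddings, projections and isomorphisms -/

open StdBundle in
theorem FinMat.stdInner_toLin {S : Type*} (A : FinMat S) (w z : S →₀ ℂ) :
    stdInner (A.toLin w) z = stdInner w ((star A).toLin z) := by
  rw [← star_stdInner w, stdInner_eq _ _ _ subset_rfl, stdInner_eq _ _ _ subset_rfl]
  simp only [fun i => A.toLin_apply w i w.support fun j _ h => Finsupp.mem_support_iff.2 h,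
    fun i => (star A).toLin_apply z i z.support fun j _ h => Finsupp.mem_support_iff.2 h]
  simp only [star_sum, star_mul', star_star, FinMat.star_apply, Finset.sum_mul]
  rw [Finset.sum_comm]
  refine Finset.sum_congr rfl fun i _ => Finset.sum_congr rfl fun j _ => ?_
  ring

section StdAlg

variable {G : Type v} {X : Type u} [Group G] [TopologicalSpace X] [MulAction G X]
  [ContinuousConstSMul G X] [T2Space X] [LocallyCompactSpace X]
  [CompactSpace (MulAction.orbitRel.Quotient G X)]

theorem StdAlg.ext_toLin {A B : StdAlg G X} (h : ∀ x w, (A.1 x).toLin w = (B.1 x).toLin w) :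
    A = B :=
  Subtype.ext (funext fun x => FinMat.toLin_injective (h x))

theorem StdAlg.toLin_mul (A B : StdAlg G X) (x : X) (w : G →₀ ℂ) :
    ((A * B).1 x).toLin w = (A.1 x).toLin ((B.1 x).toLin w) :=
  FinMat.toLin_mul _ _ _

theorem StdAlg.stdInner_toLin (A : StdAlg G X) (x : X) (w z : G →₀ ℂ) :
    StdBundle.stdInner ((A.1 x).toLin w) z = StdBundle.stdInner w (((star A).1 x).toLin z) :=
  FinMat.stdInner_toLin _ _ _

/-- A projection is determined by its range. -/
theorem Proj.ext_range {P Q : Proj (StdAlg G X)}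
    (h : ∀ x, LinearMap.range (P.1.1 x).toLin = LinearMap.range (Q.1.1 x).toLin) : P = Q := by
  have key : ∀ {P Q : Proj (StdAlg G X)},
      (∀ x, LinearMap.range (P.1.1 x).toLin = LinearMap.range (Q.1.1 x).toLin) →
      Q.1 * P.1 = P.1 := by
    intro P Q h
    refine StdAlg.ext_toLin fun x w => ?_
    have h1 : (P.1.1 x).toLin w ∈ LinearMap.range (Q.1.1 x).toLin := by
      rw [← h]
      exact ⟨w, rfl⟩
    obtain ⟨z, hz⟩ := h1
    rw [StdAlg.toLin_mul, ← hz, ← StdAlg.toLin_mul, Q.2.isIdempotentElem.eq]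
  refine Subtype.ext ?_
  have h1 := congrArg star (key h)
  rw [star_mul, P.2.isSelfAdjoint.star_eq, Q.2.isSelfAdjoint.star_eq,
    key fun x => (h x).symm] at h1
  exact h1.symm

end StdAlg

theorem VectFamily.LocalTriv.frame_eq {X : Type u} [TopologicalSpace X] {V : VectFamily.{u, v} X}
    (e : V.LocalTriv) {x : X} (hx : x ∈ e.base) {k : Fin e.rank} {w : V.fib x}
    (h : e.toFun x w = Pi.single k 1) : e.frame k x = w := by
  rw [← e.symm_toFun hx w, h]
  rfl

namespace GBundle.Embedding

open StdBundle

variable {G : Type v} {X : Type u} [Group G] [TopologicalSpace X] [MulAction G X]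
  [ContinuousConstSMul G X] [T2Space X] [LocallyCompactSpace X]
  [CompactSpace (MulAction.orbitRel.Quotient G X)] {V W : GBundle.{u, v} G X}

/-- The operator `T' T⁺` that maps the range of `T` to that of `T'` and vanishes on the orthogonal
complement of the range of `T`. -/
noncomputable def op (T T' : V.Embedding) : StdAlg G X :=
  let F : X → FinMat G := fun x => ⟨fun g h => T'.toLin x (T.pinv x (Finsupp.single h 1)) g, by
    obtain ⟨S, hS⟩ := T.finite_on {x} isCompact_singleton
    obtain ⟨S', hS'⟩ := T'.finite_on {x} isCompact_singleton
    refine (S' ×ˢ S).finite_toSet.subset fun p hp => ?_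
    simpa using toLin_pinv_single_ne_zero (hS x rfl) (hS' x rfl) hp⟩
  have hfin : ∀ K : Set X, IsCompact K → {p : G × G | ∃ x ∈ K, F x p.1 p.2 ≠ 0}.Finite := by
    intro K hK
    obtain ⟨S, hS⟩ := T.finite_on K hK
    obtain ⟨S', hS'⟩ := T'.finite_on K hK
    refine (S' ×ˢ S).finite_toSet.subset ?_
    rintro p ⟨x, hx, hp⟩
    simpa using toLin_pinv_single_ne_zero (hS x hx) (hS' x hx) hp
  have heq : IsEquivariantFun F := by
    intro k x g h
    change T'.toLin (k • x) (T.pinv (k • x) (Finsupp.single h 1)) g =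
      T'.toLin x (T.pinv x (Finsupp.single (k⁻¹ * h) 1)) (k⁻¹ * g)
    have : Finsupp.single h (1 : ℂ) = leftTranslate k (Finsupp.single (k⁻¹ * h) 1) := by
      simp [leftTranslate]
    rw [this, T.pinv_leftTranslate, T'.map_act, leftTranslate_apply]
  ⟨F, ⟨fun g h => continuous_iff_continuousAt.2 fun x => by
    obtain ⟨e, hx⟩ := V.locallyTrivial x
    exact regAt_toLin_pinv (R := RegClass.cont G X) hx (T.regTriv_cont e) (T'.regTriv_cont e) g h,
    heq.hasCompactSupport hfin, hfin⟩, heq⟩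

theorem op_toLin (T T' : V.Embedding) (x : X) (w : G →₀ ℂ) :
    ((T.op T').1 x).toLin w = T'.toLin x (T.pinv x w) := by
  have : ((T.op T').1 x).toLin = T'.toLin x ∘ₗ T.pinv x := by
    refine Finsupp.lhom_ext fun h c => ?_
    have hc : Finsupp.single h c = c • Finsupp.single h (1 : ℂ) := by simp
    rw [hc, map_smul, map_smul]
    congr 1
    refine Finsupp.ext fun g => ?_
    rw [FinMat.toLin_single]
    rfl
  rw [this]
  rfl

/-- The orthogonal projection onto the range of an embedding. -/
noncomputable def proj (T : V.Embedding) : Proj (StdAlg G X) :=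
  ⟨T.op T, by
    constructor
    · refine StdAlg.ext_toLin fun x w => ?_
      rw [StdAlg.toLin_mul, op_toLin, op_toLin, pinv_toLin]
    · refine Subtype.ext (funext fun x => FinMat.star_eq_of_stdInner fun w z => ?_)
      rw [op_toLin, op_toLin, ← T.stdInner_pinv x _ z, ← star_stdInner w, ← T.stdInner_pinv x _ w,
        star_stdInner]⟩

theorem proj_toLin (T : V.Embedding) (x : X) (w : G →₀ ℂ) :
    (T.proj.1.1 x).toLin w = T.toLin x (T.pinv x w) :=
  op_toLin T T x w

theorem range_proj (T : V.Embedding) (x : X) :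
    LinearMap.range (T.proj.1.1 x).toLin = LinearMap.range (T.toLin x) := by
  refine le_antisymm ?_ ?_
  · rintro _ ⟨w, rfl⟩
    rw [proj_toLin]
    exact ⟨_, rfl⟩
  · rintro _ ⟨v, rfl⟩
    refine ⟨T.toLin x v, ?_⟩
    rw [proj_toLin, pinv_toLin]

theorem eq_proj_of_range {T : V.Embedding} {P : Proj (StdAlg G X)}
    (h : ∀ x, LinearMap.range (P.1.1 x).toLin = LinearMap.range (T.toLin x)) : T.proj = P :=
  Proj.ext_range fun x => (T.range_proj x).trans (h x).symm

/-- Projections obtained from two embeddings of the same bundle are equivalent. -/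
theorem proj_equiv (T T' : V.Embedding) : T.proj ≈ T'.proj := by
  have h1 : T.op T' * T.proj.1 = T.op T' := StdAlg.ext_toLin fun x w => by
    rw [StdAlg.toLin_mul, proj_toLin, op_toLin, op_toLin, pinv_toLin]
  have h2 : T'.proj.1 * T.op T' = T.op T' := StdAlg.ext_toLin fun x w => by
    rw [StdAlg.toLin_mul, proj_toLin, op_toLin, pinv_toLin]
  have h1' : T'.op T * T'.proj.1 = T'.op T := StdAlg.ext_toLin fun x w => by
    rw [StdAlg.toLin_mul, proj_toLin, op_toLin, op_toLin, pinv_toLin]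
  have h2' : T.proj.1 * T'.op T = T'.op T := StdAlg.ext_toLin fun x w => by
    rw [StdAlg.toLin_mul, proj_toLin, op_toLin, pinv_toLin]
  have h3 : T'.op T * T.op T' = T.proj.1 := StdAlg.ext_toLin fun x w => by
    rw [StdAlg.toLin_mul, proj_toLin, op_toLin, op_toLin, pinv_toLin]
  have h4 : T.op T' * T'.op T = T'.proj.1 := StdAlg.ext_toLin fun x w => by
    rw [StdAlg.toLin_mul, proj_toLin, op_toLin, op_toLin, pinv_toLin]
  have hs : star T.proj.1 = T.proj.1 := T.proj.2.isSelfAdjoint.star_eq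
  have hs' : star T'.proj.1 = T'.proj.1 := T'.proj.2.isSelfAdjoint.star_eq
  obtain ⟨W, hW, hW', -⟩ := exists_stdAlg_polar (T := T.op T') h1 h2
    (fun x => by
      rw [map_sub, map_mul, map_star]
      refine isUnit_polar_of_inverse (t' := stdEval x (T'.op T)) (T.proj.eval (stdEval x))
        (T'.proj.eval (stdEval x)) ?_ ?_ ?_ ?_ ?_ <;> rw [← map_mul]
      · rw [h1]
      · rw [h2']
      · rw [h1']
      · rw [h3]
      · rw [h4])
    (fun x => by
      rw [map_sub, map_mul]
      have := isUnit_polar_of_inverse (t := stdEval x (star (T.op T')))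
        (t' := stdEval x (star (T'.op T))) (T'.proj.eval (stdEval x)) (T.proj.eval (stdEval x))
        (by rw [← map_mul, ← hs', ← star_mul, h2]) (by rw [← map_mul, ← hs', ← star_mul, h1'])
        (by rw [← map_mul, ← hs, ← star_mul, h2']) (by rw [← map_mul, ← star_mul, h4, hs'])
        (by rw [← map_mul, ← star_mul, h3, hs])
      rwa [← map_star, star_star] at this)
  exact ⟨W, hW, hW'⟩

theorem isRegular_proj {R : RegClass G X} {T : V.Embedding}
    (h : ∀ x, ∃ e : V.LocalTriv, x ∈ e.base ∧ T.RegTriv R e) : R.IsRegular T.proj.1.1 := by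
  intro g k x
  obtain ⟨e, hx, he⟩ := h x
  exact regAt_toLin_pinv hx he he g k

/-- If the projection onto the range of an embedding is regular, then the bundle has regular
frames: the images of the vectors of an arbitrary frame at a point under the projections at
nearby points. -/
theorem exists_regTriv {R : RegClass G X} {T : V.Embedding} (hT : R.IsRegular T.proj.1.1) (x₀ : X) :
    ∃ e : V.LocalTriv, x₀ ∈ e.base ∧ T.RegTriv R e := by
  obtain ⟨e, hx₀⟩ := V.locallyTrivial x₀
  let b : Fin e.rank → (G →₀ ℂ) := fun k => T.toLin x₀ (e.frame k x₀)
  let a : X → Matrix (Fin e.rank) (Fin e.rank) ℂ := fun y =>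
    Matrix.of fun i k => e.toFun y (T.pinv y (b k)) i
  have ha : ∀ y ∈ e.base, ∀ i k, ContinuousAt (fun y => a y i k) y := by
    intro y hy i k
    have h1 : ContinuousAt (fun y => ∑ h ∈ (b k).support,
        b k h * e.toFun y (T.pinv y (Finsupp.single h 1)) i) y :=
      tendsto_finsetSum _ fun h _ => continuousAt_const.mul
        ((T.regTriv_cont e).regAt_pinv hy h i)
    refine h1.congr (Filter.Eventually.of_forall fun z => ?_)
    change _ = e.toFun z (T.pinv z (b k)) i
    conv_rhs => rw [← Finsupp.sum_single (b k)]
    rw [Finsupp.sum, map_sum, map_sum, Finset.sum_apply]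
    refine Finset.sum_congr rfl fun h _ => ?_
    have : Finsupp.single h (b k h) = b k h • Finsupp.single h (1 : ℂ) := by simp
    rw [this, map_smul, map_smul]
    rfl
  have hax : a x₀ = 1 := by
    ext i k
    change e.toFun x₀ (T.pinv x₀ (T.toLin x₀ (e.frame k x₀))) i = _
    rw [pinv_toLin]
    refine (congrFun (e.toFun_symm hx₀ (Pi.single k 1)) i).trans ?_
    rw [Matrix.one_apply, Pi.single_apply]
  have hd : ContinuousOn (fun y => (a y).det) e.base := fun y hy =>
    ContinuousAt.continuousWithinAt
      (RegClass.det (R := RegClass.cont G X) (a := a) fun i k => ha y hy i k)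
  let U : Set X := e.base ∩ {y | (a y).det ≠ 0}
  have hU : IsOpen U := hd.isOpen_inter_preimage e.isOpen_base isOpen_ne
  have hxU : x₀ ∈ U := ⟨hx₀, by simp [hax]⟩
  refine ⟨e.adjust V.continuous_proj hU Set.inter_subset_left (fun y => (a y)⁻¹)
    (fun y hy i k => RegClass.matrix_inv (R := RegClass.cont G X) (a := a)
      (fun i k => ha y hy.1 i k) hy.2 i k) (fun y hy => ?_), hxU, fun x hx k h => ?_⟩
  · rw [Matrix.det_nonsing_inv, Ring.inverse_eq_inv']
    exact inv_ne_zero hy.2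
  · have h1 : R.RegAt (fun y => ∑ j ∈ (b k).support, T.proj.1.1 y h j * b k j) x :=
      RegClass.sum _ fun j _ => RegClass.mul (hT h j x) (RegClass.const _)
    refine R.congr h1 ?_
    filter_upwards [hU.mem_nhds hx] with y hy
    rw [VectFamily.LocalTriv.frame_eq (w := T.pinv y (b k)) _ hy, ← proj_toLin,
      FinMat.toLin_apply _ _ _ (b k).support fun j _ h => Finsupp.mem_support_iff.2 h]
    have h2 : ∀ k : Fin e.rank,
        (a y)⁻¹.mulVec (e.toFun y (T.pinv y (b k))) = Pi.single k 1 := fun k => by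
      have h3 : e.toFun y (T.pinv y (b k)) = (a y).mulVec (Pi.single k 1) := by
        rw [Matrix.mulVec_single_one]
        rfl
      rw [h3, Matrix.mulVec_mulVec, Matrix.nonsing_inv_mul _ (isUnit_iff_ne_zero.2 hy.2),
        Matrix.one_mulVec]
    exact h2 k

/-- The regular structure defined by an embedding onto the range of a regular projection. -/
def regStructure {R : RegClass G X} (T : V.Embedding) (hT : R.IsRegular T.proj.1.1) :
    R.RegStructure V where
  atlas := {e | T.RegTriv R e}
  cover x := (T.exists_regTriv hT x).imp fun _ h => ⟨h.2, h.1⟩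
  compatible e he e' he' x hx hx' i j :=
    RegTriv.regAt_toFun (f := id) (s := fun y => e.frame j y) he' continuousAt_id
      (fun _ h => h) hx' (fun h => he x hx j h) i
  regular_act g e he e' he' x hx hx' i j := by
    refine RegTriv.regAt_toFun (f := fun y => g • y) (s := fun y => V.act g y (e.frame j y)) he'
      (continuous_const_smul g).continuousAt (fun F hF => R.translate g hF) hx' (fun h => ?_) i
    simp only [T.map_act, leftTranslate_apply]
    exact he x hx j _

theorem eventually_toLin_eq_sum (T : V.Embedding) (A : StdAlg G X) (x : X) :
    ∃ S : Finset G, ∀ᶠ y in 𝓝 x, ∀ v h,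
      (A.1 y).toLin (T.toLin y v) h = ∑ k ∈ S, A.1 y h k * T.toLin y v k := by
  obtain ⟨S, hS⟩ := T.eventually_supported x
  refine ⟨S, hS.mono fun y hy v h => FinMat.toLin_apply _ _ _ S fun k _ hk => ?_⟩
  exact (Finsupp.mem_supported ℂ _).1 (hy v) (Finsupp.mem_support_iff.2 hk)

/-- A bundle map that is given by a regular operator is regular. -/
theorem regIn_of_toLin {R : RegClass G X} {T : V.Embedding} {T' : W.Embedding} {A : StdAlg G X}
    (hA : R.IsRegular A.1) {φ : ∀ x, V.fib x →ₗ[ℂ] W.fib x}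
    (hφ : ∀ x v, T'.toLin x (φ x v) = (A.1 x).toLin (T.toLin x v)) {e : V.LocalTriv}
    {e' : W.LocalTriv} (he : T.RegTriv R e) (he' : T'.RegTriv R e') : R.RegIn e e' id φ := by
  intro x hx hx' i j
  refine RegTriv.regAt_toFun (f := id) (s := fun y => φ y (e.frame j y)) he' continuousAt_id
    (fun _ h => h) hx' (fun h => ?_) i
  obtain ⟨S, hS⟩ := T.eventually_toLin_eq_sum A x
  refine R.congr (RegClass.sum S fun k _ => RegClass.mul (hA h k x) (he x hx j k)) ?_
  filter_upwards [hS] with y hy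
  exact ((congrArg (fun w => w h) (hφ y (e.frame j y))).trans (hy _ h)).symm

section IsoOf

variable {T : V.Embedding} {T' : W.Embedding} {U : StdAlg G X}

theorem toLin_partialIsometry (h1 : star U * U = T.proj.1) (x : X) (v : V.fib x) :
    ((star U).1 x).toLin ((U.1 x).toLin (T.toLin x v)) = T.toLin x v := by
  rw [← StdAlg.toLin_mul, h1, proj_toLin, pinv_toLin]

theorem proj_toLin_partialIsometry (h2 : U * star U = T'.proj.1)
    (h1 : star U * U = T.proj.1) (x : X) (v : V.fib x) :
    T'.toLin x (T'.pinv x ((U.1 x).toLin (T.toLin x v))) = (U.1 x).toLin (T.toLin x v) := by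
  rw [← proj_toLin, ← h2, StdAlg.toLin_mul, toLin_partialIsometry h1]

/-- The isomorphism of bundles defined by a partial isometry between the ranges of two
embeddings. -/
noncomputable def isoOf (T : V.Embedding) (T' : W.Embedding) (U : StdAlg G X)
    (h1 : star U * U = T.proj.1) (h2 : U * star U = T'.proj.1) : V.Iso W :=
  have h1' : star (star U) * star U = T'.proj.1 := by rwa [star_star]
  have h2' : star U * star (star U) = T.proj.1 := by rwa [star_star]
  have hφ : ∀ x v, T'.toLin x (T'.pinv x ((U.1 x).toLin (T.toLin x v))) =
      (U.1 x).toLin (T.toLin x v) := proj_toLin_partialIsometry h2 h1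
  let φ : ∀ x, V.fib x ≃ₗ[ℂ] W.fib x := fun x => LinearEquiv.ofLinearMap
    (T'.pinv x ∘ₗ (U.1 x).toLin ∘ₗ T.toLin x) (T.pinv x ∘ₗ ((star U).1 x).toLin ∘ₗ T'.toLin x)
    (LinearMap.ext fun w => by
      change T'.pinv x ((U.1 x).toLin (T.toLin x (T.pinv x (((star U).1 x).toLin (T'.toLin x w)))))
        = w
      have := toLin_partialIsometry h1' x w
      rw [star_star] at this
      rw [proj_toLin_partialIsometry h2' h1', this, pinv_toLin])
    (LinearMap.ext fun v => by
      change T.pinv x (((star U).1 x).toLin (T'.toLin x (T'.pinv x ((U.1 x).toLin (T.toLin x v)))))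
        = v
      rw [hφ, toLin_partialIsometry h1, pinv_toLin])
  have hc : Continuous fun p : V.Total => W.pt p.1 (φ p.1 p.2) :=
    RegClass.continuous_of_regIn (G := G) (φ := fun x => (φ x).toLinearMap) V.continuous_proj
      fun x => by
        obtain ⟨e, he⟩ := V.locallyTrivial x
        obtain ⟨e', he'⟩ := W.locallyTrivial x
        exact ⟨e, e', he, he', regIn_of_toLin (A := U)
          (fun i j x => (U.2.1.continuous_entry i j).continuousAt) hφ (T.regTriv_cont e)
          (T'.regTriv_cont e')⟩
  { toEquiv := φ
    continuous_toFun := hc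
    continuous_invFun := RegClass.continuous_symm G W.continuous_proj V.locallyTrivial
      W.locallyTrivial hc
    map_act := fun g x v => T'.injective _ <| by
      refine (hφ (g • x) _).trans ?_
      rw [T.map_act, T'.map_act, IsEquivariantFun.toLin_leftTranslate U.2.2]
      exact congrArg _ (hφ x v).symm }

theorem toLin_isoOf (h1 : star U * U = T.proj.1) (h2 : U * star U = T'.proj.1) (x : X)
    (v : V.fib x) : T'.toLin x ((T.isoOf T' U h1 h2).toEquiv x v) = (U.1 x).toLin (T.toLin x v) :=
  proj_toLin_partialIsometry h2 h1 x v

theorem stdInner_isoOf (h1 : star U * U = T.proj.1) (h2 : U * star U = T'.proj.1) (x : X)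
    (v w : V.fib x) :
    stdInner (T'.toLin x ((T.isoOf T' U h1 h2).toEquiv x v))
      (T'.toLin x ((T.isoOf T' U h1 h2).toEquiv x w)) =
    stdInner (T.toLin x v) (T.toLin x w) := by
  rw [toLin_isoOf, toLin_isoOf, StdAlg.stdInner_toLin, toLin_partialIsometry h1]

end IsoOf

/-- The composition of an embedding with an isomorphism of bundles. -/
noncomputable def comap (T : W.Embedding) (φ : V.Iso W) : V.Embedding where
  toLin x := T.toLin x ∘ₗ (φ.toEquiv x).toLinearMap
  injective x := (T.injective x).comp (φ.toEquiv x).injective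
  map_act g x w := by
    change T.toLin (g • x) (φ.toEquiv (g • x) (V.act g x w)) = _
    rw [φ.map_act, T.map_act]
    rfl
  finite_on K hK := (T.finite_on K hK).imp fun _ h x hx w => h x hx _
  continuous h := (T.continuous h).comp φ.continuous_toFun

theorem proj_comap (T : W.Embedding) (φ : V.Iso W) : (T.comap φ).proj = T.proj := by
  refine eq_proj_of_range fun x => ?_
  rw [range_proj]
  exact (LinearMap.range_comp_of_range_eq_top _ (φ.toEquiv x).range).symm

/-- The composition of an embedding with a partial isometry defined on its range. -/
noncomputable def push (T : V.Embedding) (U : StdAlg G X) (h1 : star U * U = T.proj.1) : V.Embedding where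
  toLin x := (U.1 x).toLin ∘ₗ T.toLin x
  injective x v w h := T.injective x <| by
    rw [← toLin_partialIsometry h1, ← toLin_partialIsometry h1 x w]
    exact congrArg _ h
  map_act g x w := by
    change (U.1 (g • x)).toLin (T.toLin (g • x) (V.act g x w)) = _
    rw [T.map_act, IsEquivariantFun.toLin_leftTranslate U.2.2]
    rfl
  finite_on K hK := by
    obtain ⟨S, hS⟩ := U.2.1.exists_finset hK
    refine ⟨S, fun x hx w => (Finsupp.mem_supported ℂ _).2 fun i hi => ?_⟩
    by_contra hiS
    apply Finsupp.mem_support_iff.1 hi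
    change (U.1 x).toLin (T.toLin x w) i = 0
    rw [FinMat.toLin_apply _ _ _ S fun j hj _ => (hS x hx i j hj).2]
    refine Finset.sum_eq_zero fun j _ => ?_
    have : U.1 x i j = 0 := by
      by_contra hne
      exact hiS (hS x hx i j hne).1
    exact mul_eq_zero_of_left this _
  continuous h := by
    rw [continuous_iff_continuousAt]
    intro p
    obtain ⟨S, hS⟩ := T.eventually_toLin_eq_sum U p.1
    have h1 : ContinuousAt (fun q : V.Total => ∑ k ∈ S, U.1 q.1 h k * T.toLin q.1 q.2 k) p :=
      tendsto_finsetSum _ fun k _ => ContinuousAt.mul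
        (((U.2.1.continuous_entry h k).comp V.continuous_proj).continuousAt)
        (T.continuous k).continuousAt
    refine h1.congr ?_
    filter_upwards [V.continuous_proj.continuousAt.eventually hS] with q hq
    exact (hq q.2 h).symm

theorem proj_push (T : V.Embedding) (U : StdAlg G X) (h1 : star U * U = T.proj.1)
    {P : Proj (StdAlg G X)} (h2 : U * star U = P.1) : (T.push U h1).proj = P := by
  refine eq_proj_of_range fun x => le_antisymm ?_ ?_
  · rintro _ ⟨w, rfl⟩
    refine ⟨T.pinv x (((star U).1 x).toLin w), ?_⟩
    change (U.1 x).toLin (T.toLin x (T.pinv x (((star U).1 x).toLin w))) = _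
    have h3 : U * (star U * U) * star U = P.1 := by
      rw [← mul_assoc, mul_assoc, h2]
      exact P.2.isIdempotentElem
    rw [← proj_toLin, ← h1, ← StdAlg.toLin_mul, ← StdAlg.toLin_mul, h3]
  · rintro _ ⟨v, rfl⟩
    refine ⟨(U.1 x).toLin (T.toLin x v), ?_⟩
    rw [← h2, StdAlg.toLin_mul, toLin_partialIsometry h1]
    rfl

end GBundle.Embedding

namespace StdBundle

variable {G : Type v} {X : Type u} [Group G] [TopologicalSpace X] [MulAction G X]

protected theorem ext {E F : StdBundle G X} (h : E.fib = F.fib) : E = F := by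
  obtain ⟨_, _, _⟩ := E
  obtain ⟨_, _, _⟩ := F
  obtain rfl := h
  rfl

variable [ContinuousConstSMul G X] [LocallyCompactSpace X]

/-- The tautological embedding of a standard `G`-bundle. -/
noncomputable def embedding (E : StdBundle G X) : E.toGBundle.Embedding where
  toLin x := (E.fib x).subtype
  injective x := (E.fib x).injective_subtype
  map_act _ _ _ := rfl
  finite_on K hK := (E.isSubbundle K hK).imp fun _ h x hx _ => h.1 x hx (SetLike.coe_mem _)
  continuous h := E.continuous_total_coord h

variable [T2Space X] [CompactSpace (MulAction.orbitRel.Quotient G X)]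

theorem rangeBundle_proj_embedding (E : StdBundle G X) : rangeBundle E.embedding.proj = E := by
  have h : (rangeBundle E.embedding.proj).fib = E.fib := funext fun x =>
    (E.embedding.range_proj x).trans (E.fib x).range_subtype
  exact StdBundle.ext h

theorem proj_embedding_rangeBundle (P : Proj (StdAlg G X)) :
    (rangeBundle P).embedding.proj = P :=
  GBundle.Embedding.eq_proj_of_range fun _ => (Submodule.range_subtype _).symm

end StdBundle

/-! ### Existence of embeddings -/

section

variable {G : Type v} {X : Type u} [Group G] [TopologicalSpace X] [MulAction G X]

/-- Finitely many translates of a finite set in an infinite group can be separated. -/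
theorem exists_separated [Infinite G] {F : Set G} (hF : F.Finite) {ι : Type*} (s : Finset ι) :
    ∃ c : ι → G, ∀ a ∈ s, ∀ b ∈ s, a ≠ b → (c a)⁻¹ * c b ∉ F := by
  classical
  induction s using Finset.induction_on with
  | empty => exact ⟨fun _ => 1, by simp⟩
  | insert a s ha ih =>
    obtain ⟨c, hc⟩ := ih
    have hfin : (⋃ b ∈ s, ((fun f => c b * f) '' F ∪ (fun f => c b * f⁻¹) '' F)).Finite :=
      s.finite_toSet.biUnion fun b _ => (hF.image _).union (hF.image _)
    obtain ⟨γ, hγ⟩ := hfin.exists_notMem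
    have hne : ∀ b ∈ s, b ≠ a := fun b hb h => ha (h ▸ hb)
    refine ⟨Function.update c a γ, fun p hp q hq hpq hmem => ?_⟩
    rcases Finset.mem_insert.1 hp with rfl | hp' <;> rcases Finset.mem_insert.1 hq with rfl | hq'
    · exact hpq rfl
    · rw [Function.update_self, Function.update_of_ne (hne q hq')] at hmem
      exact hγ (Set.mem_iUnion₂.2 ⟨q, hq', Or.inr ⟨_, hmem, by simp⟩⟩)
    · rw [Function.update_self, Function.update_of_ne (hne p hp')] at hmem
      exact hγ (Set.mem_iUnion₂.2 ⟨p, hp', Or.inl ⟨_, hmem, by simp⟩⟩)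
    · rw [Function.update_of_ne (hne p hp'), Function.update_of_ne (hne q hq')] at hmem
      exact hc p hp' q hq' hpq hmem

theorem hasSum_sum_mulRight {ι : Type*} [Fintype ι] (c : ι → G) {f : ι → G → ℂ} {r : ι → ℂ}
    (h : ∀ a, HasSum (f a) (r a)) : HasSum (fun g => ∑ a, f a (g * c a)) (∑ a, r a) :=
  hasSum_sum fun a _ => (Equiv.mulRight (c a)).hasSum_iff.2 (h a)

variable [ContinuousConstSMul G X] [LocallyCompactSpace X]
  [CompactSpace (MulAction.orbitRel.Quotient G X)] [T2Space (MulAction.orbitRel.Quotient G X)]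

/-- Finitely many regular functions with compact support in prescribed neighbourhoods, such that
the squares of their translates form a partition of unity. -/
theorem exists_sq_partition (hX : LocallyProperAction G X) (R : RegClass G X) (U : X → Set X)
    (hU : ∀ x, U x ∈ 𝓝 x) :
    ∃ (t : Finset X) (χ : t → X → ℝ), (∀ k, HasCompactSupport (χ k)) ∧
      (∀ k, tsupport (χ k) ⊆ U k) ∧ (∀ k x, R.RegAt (fun y => (χ k y : ℂ)) x) ∧
      ∀ y, HasSum (fun g : G => ∑ k, (χ k (g⁻¹ • y)) ^ 2) 1 := by
  classical
  obtain ⟨K, hK, hKG⟩ := exists_compact_saturation G X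
  choose f hf0 hfx hfc hfU hfR using fun x => R.bump x _ (hU x)
  have hfcont : ∀ x, Continuous (f x) := fun x => by
    have : Continuous fun z => ((f x z : ℝ) : ℂ) :=
      continuous_iff_continuousAt.2 fun y => R.continuousAt (hfR x y)
    exact (Complex.continuous_re.comp this).congr fun z => Complex.ofReal_re _
  obtain ⟨t, -, ht⟩ := hK.elim_nhds_subcover (fun x => {y | f x y ≠ 0})
    fun x _ => (isOpen_ne.preimage (hfcont x)).mem_nhds (hfx x)
  let q : X → ℝ := fun y => ∑ k : t, (f k y) ^ 2
  have hloc : ∀ L : Set X, IsCompact L →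
      ∃ T : Finset G, ∀ y ∈ L, ∀ g ∉ T, ∀ k : t, f k (g⁻¹ • y) = 0 := by
    intro L hL
    have h1 : ∀ k : t, {g : G | ∃ z ∈ tsupport (f k), g • z ∈ L}.Finite := fun k =>
      hX.finite_inter (hfc k) hL
    refine ⟨Finset.univ.biUnion fun k : t => (h1 k).toFinset, fun y hy g hg k => ?_⟩
    by_contra hne
    refine hg (Finset.mem_biUnion.2 ⟨k, Finset.mem_univ _, (Set.Finite.mem_toFinset _).2
      ⟨g⁻¹ • y, subset_tsupport _ hne, by simpa using hy⟩⟩)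
  have hsum : ∀ (T : Finset G) y, (∀ g ∉ T, ∀ k : t, f k (g⁻¹ • y) = 0) →
      HasSum (fun g : G => q (g⁻¹ • y)) (∑ g ∈ T, q (g⁻¹ • y)) := fun T y h =>
    hasSum_sum_of_ne_finset_zero fun g hg => Finset.sum_eq_zero fun k _ => by
      rw [h g hg k]
      norm_num
  let N : X → ℝ := fun y => ∑' g : G, q (g⁻¹ • y)
  have hq0 : ∀ y, 0 ≤ q y := fun y => Finset.sum_nonneg fun k _ => sq_nonneg _
  have hN : ∀ y, HasSum (fun g : G => q (g⁻¹ • y)) (N y) := fun y => by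
    obtain ⟨T, hT⟩ := hloc {y} isCompact_singleton
    exact (hsum T y (hT y rfl)).summable.hasSum
  have hNpos : ∀ y, 0 < N y := by
    intro y
    obtain ⟨g, hg⟩ := hKG y
    obtain ⟨k, hk, hky⟩ := Set.mem_iUnion₂.1 (ht hg)
    refine (hN y).summable.tsum_pos (fun g => hq0 _) g⁻¹ ?_
    rw [inv_inv]
    exact Finset.sum_pos' (fun k _ => sq_nonneg _)
      ⟨⟨k, hk⟩, Finset.mem_univ _, lt_of_le_of_ne (sq_nonneg _) (pow_ne_zero 2 hky).symm⟩
  have hNg : ∀ (g : G) y, N (g • y) = N y := by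
    intro g y
    refine (((Equiv.mulLeft g).hasSum_iff.2 (hN (g • y)))).unique ?_
    convert hN y using 2 with h
    simp [mul_smul]
  have hRN : ∀ y, R.RegAt (fun z => (N z : ℂ)) y := by
    intro y
    obtain ⟨L, hL, hyL⟩ := exists_compact_mem_nhds y
    obtain ⟨T, hT⟩ := hloc L hL
    refine R.congr (RegClass.sum T fun g _ => RegClass.sum (Finset.univ : Finset t) fun k _ =>
      RegClass.mul (R.translate (f := fun z => (f k z : ℂ)) g⁻¹ (hfR k _))
        (R.translate (f := fun z => (f k z : ℂ)) g⁻¹ (hfR k _))) ?_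
    filter_upwards [hyL] with z hz
    rw [(hN z).unique (hsum T z (hT z hz))]
    push_cast [q]
    simp only [sq]
  let ψ : X → ℝ := fun y => (√(N y))⁻¹
  have hRψ : ∀ y, R.RegAt (fun z => (ψ z : ℂ)) y := by
    intro y
    have h1 : ContDiffAt ℝ ∞ (fun z : ℂ => (((√z.re)⁻¹ : ℝ) : ℂ)) (N y : ℂ) := by
      refine Complex.ofRealCLM.contDiff.contDiffAt.comp _ ?_
      have h2 : ContDiffAt ℝ ∞ (fun z : ℂ => √z.re) (N y : ℂ) :=
        ContDiffAt.sqrt Complex.reCLM.contDiff.contDiffAt (by simpa using (hNpos y).ne')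
      exact h2.inv (by simpa using (Real.sqrt_pos.2 (hNpos y)).ne')
    exact R.congr (RegClass.comp₁ (hRN y) h1) (Filter.Eventually.of_forall fun z => by
      simp [ψ])
  refine ⟨t, fun k y => f k y * ψ y, fun k => (hfc k).mul_right,
    fun k => (tsupport_mul_subset_left).trans (hfU k), fun k x => ?_, fun y => ?_⟩
  · exact R.congr (RegClass.mul (hfR k x) (hRψ x)) (Filter.Eventually.of_forall fun z => by
      push_cast
      rfl)
  · have h1 := (hN y).mul_right (N y)⁻¹
    rw [mul_inv_cancel₀ (hNpos y).ne'] at h1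
    have h2 : ∀ g : G, ψ (g⁻¹ • y) ^ 2 = (N y)⁻¹ := fun g => by
      simp only [ψ, hNg, inv_pow, Real.sq_sqrt (hNpos y).le]
    simpa only [mul_pow, h2, q, Finset.sum_mul] using h1

open StdBundle in
set_option maxHeartbeats 400000 in
/-- Bundles with a regular structure have regular embeddings. For a finite family of bump functions
`χ` whose translates form a partition of unity and trivializations over their supports, the
coordinates of a vector `v`, multiplied with `χ`, define finitely many linear functionals `m a`, and
the coefficient of the image of `v` at `g` is the sum of the values `m a ((g c_a)⁻¹ v)`. As `G` is
infinite, the `c_a` can be chosen so that at most one of the summands is nonzero. -/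
theorem GBundle.exists_embedding [Infinite G] (hX : LocallyProperAction G X) {R : RegClass G X}
    {V : GBundle.{u, v} G X} (s : R.RegStructure V) (B : Set V.LocalTriv)
    (hB : ∀ x, ∃ e ∈ B, x ∈ e.base)
    (hsB : ∀ e ∈ s.atlas, ∀ e' ∈ B, ∀ g : G, R.RegIn e e' (fun x => g • x) (V.act g)) :
    ∃ T : V.Embedding, (∀ e ∈ s.atlas, T.RegTriv R e) ∧
      ∀ m : ∀ x, V.fib x → V.fib x → ℂ,
        (∀ (g : G) x v w, m (g • x) (V.act g x v) (V.act g x w) = m x v w) →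
        (∀ e ∈ B, ∀ x ∈ e.base, ∀ v w, m x v w = star (e.toFun x v) ⬝ᵥ e.toFun x w) →
        ∀ x v w, stdInner (T.toLin x v) (T.toLin x w) = m x v w := by
  classical
  choose e heB hxe using hB
  obtain ⟨t, χ, hχc, hχe, hχR, hχ1⟩ := exists_sq_partition hX R (fun x => (e x).base)
    fun x => (e x).isOpen_base.mem_nhds (hxe x)
  let C : Set X := ⋃ k : t, tsupport (χ k)
  have hC : IsCompact C := isCompact_iUnion fun k => hχc k
  have hχC : ∀ k x, χ k x ≠ 0 → x ∈ C := fun k x h =>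
    Set.mem_iUnion.2 ⟨k, subset_tsupport _ h⟩
  let ι := Σ k : t, Fin (e k).rank
  obtain ⟨c, hc⟩ := exists_separated (hX.finite_inter hC hC) (Finset.univ : Finset ι)
  let μ : ι → V.Total → ℂ := fun a p => (χ a.1 p.1 : ℂ) * (e a.1).toFun p.1 p.2 a.2
  let m : ι → G → ∀ x, V.fib x → ℂ := fun a g x v => μ a (V.pt (g • x) (V.act g x v))
  have hm_mul : ∀ a g h x v, m a (g * h) x v = m a g (h • x) (V.act h x v) := fun a g h x v =>
    congrArg (μ a) (V.act_mul g h x v)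
  have hmC : ∀ a g x v, m a g x v ≠ 0 → g • x ∈ C := fun a g x v h =>
    hχC a.1 _ fun h0 => h (by simp [m, μ, VectFamily.pt, h0])
  -- at most one of the summands is nonzero
  have hsep : ∀ (g : G) a b x, (g * c a)⁻¹ • x ∈ C → (g * c b)⁻¹ • x ∈ C → a = b := by
    intro g a b x ha hb
    by_contra hab
    refine hc b (Finset.mem_univ _) a (Finset.mem_univ _) (Ne.symm hab) ⟨_, ha, ?_⟩
    convert hb using 1
    simp only [mul_inv_rev, mul_smul, smul_inv_smul]
  have hsum : ∀ (g : G) a x v, (g * c a)⁻¹ • x ∈ C →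
      ∑ b, m b (g * c b)⁻¹ x v = m a (g * c a)⁻¹ x v := by
    intro g a x v ha
    refine Finset.sum_eq_single a (fun b _ hb => ?_) (fun h => absurd (Finset.mem_univ _) h)
    by_contra hne
    exact hb (hsep g b a x (hmC _ _ _ _ hne) ha)
  have hfin : ∀ K : Set X, IsCompact K → ∃ S : Finset G, ∀ x ∈ K, ∀ v g,
      ∑ a, m a (g * c a)⁻¹ x v ≠ 0 → g ∈ S := by
    intro K hK
    have h1 := hX.finite_inter hK hC
    refine ⟨Finset.univ.biUnion fun a => h1.toFinset.image fun γ => γ⁻¹ * (c a)⁻¹,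
      fun x hx v g hne => ?_⟩
    obtain ⟨a, -, ha⟩ := Finset.exists_ne_zero_of_sum_ne_zero hne
    exact Finset.mem_biUnion.2 ⟨a, Finset.mem_univ _, Finset.mem_image.2 ⟨(g * c a)⁻¹,
      (Set.Finite.mem_toFinset _).2 ⟨x, hx, hmC _ _ _ _ ha⟩, by simp⟩⟩
  choose S hS using fun x => hfin {x} isCompact_singleton
  have hm_add : ∀ a g x v w, m a g x (v + w) = m a g x v + m a g x w := fun a g x v w => by
    simp only [m, μ, VectFamily.pt, map_add, Pi.add_apply, mul_add]
  have hm_smul : ∀ a g x (r : ℂ) v, m a g x (r • v) = r * m a g x v := fun a g x r v => by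
    simp only [m, μ, VectFamily.pt, map_smul, Pi.smul_apply, smul_eq_mul]
    ring
  let T : ∀ x, V.fib x →ₗ[ℂ] (G →₀ ℂ) := fun x =>
    { toFun := fun v => Finsupp.onFinset (S x) (fun g => ∑ a, m a (g * c a)⁻¹ x v)
        fun g hg => hS x x rfl v g hg
      map_add' := fun v w => Finsupp.ext fun g => by
        simp [hm_add, Finset.sum_add_distrib]
      map_smul' := fun r v => Finsupp.ext fun g => by
        simp [hm_smul, Finset.mul_sum] }
  have hT : ∀ x v g, T x v g = ∑ a, m a (g * c a)⁻¹ x v := fun x v g => rfl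
  have hm_reg : ∀ e' ∈ s.atlas, ∀ a g, ∀ x ∈ e'.base, ∀ k,
      R.RegAt (fun y => m a g y (e'.frame k y)) x := by
    intro e' he' a g x hx k
    by_cases hgx : g • x ∈ tsupport (χ a.1)
    · exact RegClass.mul (R.translate (f := fun y => (χ a.1 y : ℂ)) g (hχR a.1 _))
        (hsB e' he' _ (heB _) g x hx (hχe a.1 hgx) a.2 k)
    · refine R.congr (RegClass.const 0) ?_
      have h1 : ∀ᶠ y in 𝓝 x, g • y ∉ tsupport (χ a.1) :=
        (continuous_const_smul g).continuousAt.eventually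
          ((isClosed_tsupport _).isOpen_compl.mem_nhds hgx)
      filter_upwards [h1] with y hy
      simp [m, μ, VectFamily.pt, image_eq_zero_of_notMem_tsupport hy]
  have hT_reg : ∀ e' ∈ s.atlas, ∀ x ∈ e'.base, ∀ k g,
      R.RegAt (fun y => T y (e'.frame k y) g) x := fun e' he' x hx k g =>
    RegClass.sum Finset.univ fun a _ => hm_reg e' he' a _ x hx k
  refine ⟨⟨T, fun x => ?_, fun g x v => ?_, fun K hK => ?_, fun h => ?_⟩, hT_reg,
    fun m' hm'g hm'e x v w => ?_⟩
  · rw [injective_iff_map_eq_zero]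
    intro v hv
    obtain ⟨γ, k, hγ⟩ : ∃ (γ : G) (k : t), χ k (γ • x) ≠ 0 := by
      by_contra! hcon
      have h1 := hχ1 x
      simp only [hcon] at h1
      norm_num at h1
      exact one_ne_zero (h1.unique hasSum_zero)
    have h1 : ∀ i, (e k).toFun (γ • x) (V.act γ x v) i = 0 := by
      intro i
      have h2 : T x v (γ⁻¹ * (c ⟨k, i⟩)⁻¹) = 0 := by rw [hv]; rfl
      have h3 : (γ⁻¹ * (c ⟨k, i⟩)⁻¹ * c ⟨k, i⟩)⁻¹ = γ := by group
      rw [hT, hsum _ ⟨k, i⟩ _ _ (by rw [h3]; exact hχC _ _ hγ), h3] at h2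
      exact (mul_eq_zero.1 h2).resolve_left (by exact_mod_cast hγ)
    have h2 : γ • x ∈ (e k).base := hχe k (subset_tsupport _ hγ)
    have h3 : V.act γ x v = 0 := ((e k).bijective h2).1 (by rw [map_zero]; exact funext h1)
    have h4 := V.act_mul γ⁻¹ γ x v
    rw [h3, map_zero, inv_mul_cancel] at h4
    have h5 : ∀ y : X, y = x → V.pt x v = V.pt y 0 → v = 0 := by
      rintro y rfl h
      exact eq_of_heq (Sigma.mk.inj h).2
    exact h5 _ (inv_smul_smul γ x) ((V.act_one x v).symm.trans h4)
  · refine Finsupp.ext fun h => ?_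
    rw [leftTranslate_apply, hT, hT]
    refine Finset.sum_congr rfl fun a _ => ?_
    rw [← hm_mul]
    congr 1
    group
  · obtain ⟨S', hS'⟩ := hfin K hK
    exact ⟨S', fun x hx v => (Finsupp.mem_supported ℂ _).2 fun g hg =>
      hS' x hx v g (Finsupp.mem_support_iff.1 hg)⟩
  · rw [continuous_iff_continuousAt]
    intro p
    obtain ⟨e', he', hp⟩ := s.cover p.1
    have h1 : ContinuousAt (fun q : V.Total =>
        ∑ j, e'.toFun q.1 q.2 j * T q.1 (e'.frame j q.1) h) p := by
      refine tendsto_finsetSum _ fun j _ => ContinuousAt.mul ?_ ?_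
      · exact continuousAt_pi.1 (e'.continuousAt_coord V.continuous_proj hp) j
      · exact ContinuousAt.comp (f := fun q : V.Total => q.1)
          (R.continuousAt (hT_reg e' he' p.1 hp j h)) V.continuous_proj.continuousAt
    refine h1.congr ?_
    filter_upwards [V.continuous_proj.continuousAt.eventually (e'.eventually_mem hp)] with q hq
    conv_rhs => rw [e'.eq_sum_frame hq q.2, map_sum]
    simp
  · change stdInner (T x v) (T x w) = _
    have h5 : ∀ g : G, ∑ a, star (m a g⁻¹ x v) * m a g⁻¹ x w =
        ((∑ k, (χ k (g⁻¹ • x)) ^ 2 : ℝ) : ℂ) * m' x v w := by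
      intro g
      rw [Fintype.sum_sigma, Complex.ofReal_sum, Finset.sum_mul]
      refine Finset.sum_congr rfl fun k _ => ?_
      by_cases hk : χ k (g⁻¹ • x) = 0
      · simp [m, μ, VectFamily.pt, hk]
      · rw [← hm'g g⁻¹, hm'e _ (heB k) _ (hχe k (subset_tsupport _ hk)), dotProduct,
          Finset.mul_sum]
        refine Finset.sum_congr rfl fun i _ => ?_
        simp only [m, μ, VectFamily.pt, star_mul', Pi.star_apply]
        have : star ((χ k (g⁻¹ • x) : ℂ)) = (χ k (g⁻¹ • x) : ℂ) := Complex.conj_ofReal _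
        rw [this]
        push_cast
        ring
    clear_value T m
    have h1 : HasSum (fun g => star (T x v g) * T x w g) (stdInner (T x v) (T x w)) := by
      rw [stdInner_eq _ _ _ subset_rfl]
      exact hasSum_sum_of_ne_finset_zero fun g hg => by
        rw [Finsupp.notMem_support_iff.1 hg, mul_zero]
    have h2 : ∀ g, star (T x v g) * T x w g =
        ∑ a, star (m a (g * c a)⁻¹ x v) * m a (g * c a)⁻¹ x w := by
      intro g
      by_cases h : ∃ a, (g * c a)⁻¹ • x ∈ C
      · obtain ⟨a, ha⟩ := h
        rw [hT, hT, hsum g a x v ha, hsum g a x w ha]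
        rw [Finset.sum_eq_single a]
        · intro b _ hb
          by_contra hne
          exact hb (hsep g b a x (hmC _ _ _ _ (right_ne_zero_of_mul hne)) ha)
        · exact fun h => absurd (Finset.mem_univ _) h
      · push Not at h
        have h0 : ∀ a w, m a (g * c a)⁻¹ x w = 0 := fun a w => by
          by_contra hne
          exact h a (hmC _ _ _ _ hne)
        rw [hT, hT]
        simp only [h0, mul_zero, Finset.sum_const_zero]
    have h3 : ∀ a, ∃ r, HasSum (fun g : G => star (m a g⁻¹ x v) * m a g⁻¹ x w) r := by
      intro a
      have h4 : ∃ S : Finset G, ∀ g ∉ S, star (m a g⁻¹ x v) * m a g⁻¹ x w = 0 := by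
        have hf := hX.finite_inter (isCompact_singleton (x := x)) hC
        refine ⟨hf.toFinset.image fun g => g⁻¹, fun g hg => ?_⟩
        by_contra hne
        exact hg (Finset.mem_image.2 ⟨g⁻¹, hf.mem_toFinset.2
          ⟨x, rfl, hmC _ _ _ _ (right_ne_zero_of_mul hne)⟩, inv_inv g⟩)
      obtain ⟨S, hS⟩ := h4
      exact ⟨_, hasSum_sum_of_ne_finset_zero hS⟩
    choose r hr using h3
    have h4 : HasSum (fun g => star (T x v g) * T x w g) (∑ a, r a) := by
      rw [funext h2]
      exact hasSum_sum_mulRight (f := fun a g => star (m a g⁻¹ x v) * m a g⁻¹ x w) c hr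
    have h6 : HasSum (fun g : G => ∑ a, star (m a g⁻¹ x v) * m a g⁻¹ x w) (m' x v w) := by
      simp only [h5]
      simpa using (Complex.hasSum_ofReal.2 (hχ1 x)).mul_right (m' x v w)
    rw [h1.unique h4, (hasSum_sum fun a _ => hr a).unique h6]

end

/-! ### Orthonormal frames -/

section

variable {G : Type v} {X : Type u} [Group G] [TopologicalSpace X] [MulAction G X]

open scoped Matrix.Norms.L2Operator MatrixOrder ComplexOrder in
/-- Positive definite matrices with regular entries have regular square roots. -/
theorem RegClass.exists_matrix_sqrt {R : RegClass G X} {n : ℕ} {B : Set X} (hB : IsOpen B)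
    {h : X → Matrix (Fin n) (Fin n) ℂ} (hpos : ∀ x ∈ B, (h x).PosDef)
    (hR : ∀ x ∈ B, ∀ i j, R.RegAt (fun y => h y i j) x) :
    ∃ q : X → Matrix (Fin n) (Fin n) ℂ, (∀ x ∈ B, ∀ i j, R.RegAt (fun y => q y i j) x) ∧
      ∀ x ∈ B, (q x).conjTranspose * q x = h x := by
  refine ⟨fun x => CFC.sqrt (h x), fun x hx i j => ?_, fun x hx => ?_⟩
  · obtain ⟨g, hg, hg'⟩ := (hpos x hx).isStrictlyPositive.exists_contDiffAt_sqrt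
    let L : (Fin n × Fin n → ℂ) →L[ℂ] Matrix (Fin n) (Fin n) ℂ := LinearMap.toContinuousLinearMap
      { toFun := fun t => Matrix.of fun i j => t (i, j)
        map_add' := fun _ _ => rfl
        map_smul' := fun _ _ => rfl }
    let l : Matrix (Fin n) (Fin n) ℂ →L[ℂ] ℂ := LinearMap.toContinuousLinearMap
      { toFun := fun a => a i j
        map_add' := fun _ _ => rfl
        map_smul' := fun _ _ => rfl }
    have hL : ∀ y, L (fun p => h y p.1 p.2) = h y := fun y => rfl
    have h1 : ContDiffAt ℂ ∞ (fun m => l (g (L m))) (fun p => h x p.1 p.2) :=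
      l.contDiff.contDiffAt.comp _ (ContDiffAt.comp (g := g) _ hg L.contDiff.contDiffAt)
    refine R.congr (RegClass.comp (fun p : Fin n × Fin n => hR x hx p.1 p.2)
      (h1.restrict_scalars ℝ)) ?_
    have hc : ContinuousAt h x := by
      have h2 : ContinuousAt (fun y => L (fun p => h y p.1 p.2)) x :=
        L.continuous.continuousAt.comp
          (continuousAt_pi.2 fun p => R.continuousAt (hR x hx p.1 p.2))
      exact h2
    filter_upwards [hc.eventually hg', hB.mem_nhds hx] with y hy hyB
    rw [hL, hy (hpos y hyB).isStrictlyPositive.nonneg]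
    rfl
  · have h0 : 0 ≤ h x := (hpos x hx).isStrictlyPositive.nonneg
    have h1 : IsSelfAdjoint (CFC.sqrt (h x)) := (CFC.sqrt_nonneg (h x)).isSelfAdjoint
    rw [← Matrix.star_eq_conjTranspose, h1.star_eq]
    exact CFC.sqrt_mul_sqrt_self (h x) h0

end

section Core

variable {F : Type*} [AddCommGroup F] [Module ℂ F] (c : InnerProductSpace.Core ℂ F)

theorem InnerProductSpace.Core.inner_sum_smul {n : ℕ} (f : Fin n → F) (a b : Fin n → ℂ) :
    c.inner (∑ i, a i • f i) (∑ j, b j • f j) =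
      star a ⬝ᵥ (Matrix.of fun i j => c.inner (f i) (f j)).mulVec b := by
  let : NormedAddCommGroup F := c.toNormedAddCommGroup
  let : InnerProductSpace ℂ F := InnerProductSpace.ofCore c.toCore
  change inner ℂ (∑ i, a i • f i) (∑ j, b j • f j) = _
  rw [sum_inner]
  simp only [inner_sum, inner_smul_left, inner_smul_right, dotProduct, Matrix.mulVec,
    Finset.mul_sum, Matrix.of_apply, Pi.star_apply]
  refine Finset.sum_congr rfl fun i _ => Finset.sum_congr rfl fun j _ => ?_
  change _ = star (a i) * (inner ℂ (f i) (f j) * b j)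
  simp
  ring

open scoped ComplexOrder in
theorem InnerProductSpace.Core.inner_self_pos {v : F} (hv : v ≠ 0) : 0 < c.inner v v := by
  let : NormedAddCommGroup F := c.toNormedAddCommGroup
  let : InnerProductSpace ℂ F := InnerProductSpace.ofCore c.toCore
  change 0 < inner ℂ v v
  rw [inner_self_eq_norm_sq_to_K]
  have : (0 : ℝ) < ‖v‖ ^ 2 := by positivity
  exact (Complex.zero_lt_real.2 this).trans_eq (by push_cast; rfl)

end Core

namespace HermBundle

variable {G : Type v} {X : Type u} [Group G] [TopologicalSpace X] [MulAction G X]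
  (V : HermBundle.{u, v} G X)

/-- The Gram matrix of the frame belonging to a local trivialization. -/
noncomputable def gram (e : V.LocalTriv) (x : X) : Matrix (Fin e.rank) (Fin e.rank) ℂ :=
  Matrix.of fun i j => (V.metric x).inner (e.frame i x) (e.frame j x)

theorem inner_eq_gram (e : V.LocalTriv) {x : X} (hx : x ∈ e.base) (v w : V.fib x) :
    (V.metric x).inner v w = star (e.toFun x v) ⬝ᵥ (V.gram e x).mulVec (e.toFun x w) := by
  conv_lhs => rw [e.eq_sum_frame hx v, e.eq_sum_frame hx w]
  exact (V.metric x).inner_sum_smul _ _ _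

open scoped ComplexOrder in
theorem posDef_gram (e : V.LocalTriv) {x : X} (hx : x ∈ e.base) : (V.gram e x).PosDef := by
  refine Matrix.PosDef.of_dotProduct_mulVec_pos ?_ fun c hc => ?_
  · ext i j
    exact (V.metric x).conj_inner_symm _ _
  · have h1 := V.inner_eq_gram e hx (e.symm x c) (e.symm x c)
    rw [e.toFun_symm hx] at h1
    rw [← h1]
    refine (V.metric x).inner_self_pos fun h0 => hc ?_
    rw [← e.toFun_symm hx c, h0, map_zero]

/-- The metric is regular in a local trivialization if its Gram matrix is. -/
def RegMetric (R : RegClass G X) (e : V.LocalTriv) : Prop :=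
  ∀ x ∈ e.base, ∀ i j, R.RegAt (fun y => V.gram e y i j) x

theorem regMetric_cont [ContinuousConstSMul G X] [T2Space X] [LocallyCompactSpace X]
    (e : V.LocalTriv) : V.RegMetric (RegClass.cont G X) e := by
  intro x hx i j
  let f : X → {q : V.Total × V.Total // q.2.1 = q.1.1} := fun y =>
    ⟨(V.pt y (e.frame i y), V.pt y (e.frame j y)), rfl⟩
  have hf : ContinuousAt f x := by
    refine Topology.IsInducing.subtypeVal.continuousAt_iff.2 ?_
    exact (e.continuousAt_symm hx continuousAt_id continuousAt_const).prodMk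
      (e.continuousAt_symm hx continuousAt_id continuousAt_const)
  exact ContinuousAt.comp (f := f) V.continuous_metric.continuousAt hf

open scoped ComplexOrder in
/-- A hermitian bundle with a regular structure for which the metric is regular has a regular
isometric embedding. It is obtained from orthonormal frames, which exist as the Gram matrices have
regular square roots. -/
theorem exists_isometric_embedding [Infinite G] [ContinuousConstSMul G X] [LocallyCompactSpace X]
    [CompactSpace (MulAction.orbitRel.Quotient G X)] [T2Space (MulAction.orbitRel.Quotient G X)]
    (hX : LocallyProperAction G X) {R : RegClass G X} (s : R.RegStructure V.toGBundle)
    (hs : ∀ e ∈ s.atlas, V.RegMetric R e) :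
    ∃ T : V.toGBundle.Embedding, (∀ e ∈ s.atlas, T.RegTriv R e) ∧
      ∀ x v w, StdBundle.stdInner (T.toLin x v) (T.toLin x w) = (V.metric x).inner v w := by
  let B : Set V.LocalTriv := {e' |
    (∀ x ∈ e'.base, ∀ v w, (V.metric x).inner v w = star (e'.toFun x v) ⬝ᵥ e'.toFun x w) ∧
    ∀ e ∈ s.atlas, ∀ g : G, R.RegIn e e' (fun x => g • x) (V.act g)}
  have hB : ∀ x, ∃ e ∈ B, x ∈ e.base := by
    intro x
    obtain ⟨e, he, hx⟩ := s.cover x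
    obtain ⟨q, hqR, hq⟩ := RegClass.exists_matrix_sqrt (R := R) e.isOpen_base
      (fun y hy => V.posDef_gram e hy) (hs e he)
    have hdet : ∀ y ∈ e.base, (q y).det ≠ 0 := by
      intro y hy h0
      have h1 := (V.posDef_gram e hy).det_pos.ne'
      rw [← hq y hy, Matrix.det_mul, h0, mul_zero] at h1
      exact h1 rfl
    refine ⟨e.adjust V.continuous_proj e.isOpen_base subset_rfl q
      (fun y hy i j => R.continuousAt (hqR y hy i j)) hdet, ⟨fun y hy v w => ?_,
      fun e₁ he₁ g y hy hgy i j => ?_⟩, hx⟩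
    · rw [V.inner_eq_gram e hy, ← hq y hy]
      change _ = star ((q y).mulVec (e.toFun y v)) ⬝ᵥ (q y).mulVec (e.toFun y w)
      rw [Matrix.star_mulVec, ← Matrix.dotProduct_mulVec, Matrix.mulVec_mulVec]
    · exact RegClass.sum Finset.univ fun k _ => RegClass.mul
        (R.translate (f := fun y => q y i k) g (hqR _ hgy i k))
        (s.regular_act g e₁ he₁ e he y hy hgy k j)
  obtain ⟨T, hT, hTm⟩ := GBundle.exists_embedding hX s B hB fun e he e' he' g => he'.2 e he g
  exact ⟨T, hT, hTm (fun x v w => (V.metric x).inner v w) (fun g x v w => V.metric_act g x v w)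
    fun e he x hx v w => he.1 x hx v w⟩

end HermBundle

section

variable {G : Type v} {X : Type u} [Group G] [TopologicalSpace X] [MulAction G X]
  [ContinuousConstSMul G X] [T2Space X] [LocallyCompactSpace X]
  [CompactSpace (MulAction.orbitRel.Quotient G X)] [T2Space (MulAction.orbitRel.Quotient G X)]

/-- Every projection in `𝒞(X, G)` is equivalent to a regular one. -/
theorem Proj.exists_regular (hX : LocallyProperAction G X) (R : RegClass G X)
    (P : Proj (StdAlg G X)) : ∃ P' : Proj (StdAlg G X), P ≈ P' ∧ R.IsRegular P'.1.1 := by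
  obtain ⟨P', ⟨w, h1, h2⟩, hR⟩ := exists_regular_proj hX R (P.map (stdAlgToCstarAlg G X))
  exact ⟨P', exists_stdAlg_of_partialIsometry h1 h2, hR⟩

/-- Equivalent regular projections are equivalent via a regular partial isometry. -/
theorem Proj.exists_regular_partialIsometry (hX : LocallyProperAction G X) {R : RegClass G X}
    {P Q : Proj (StdAlg G X)} (hP : R.IsRegular P.1.1) (hQ : R.IsRegular Q.1.1) (h : P ≈ Q) :
    ∃ W : StdAlg G X, star W * W = P.1 ∧ W * star W = Q.1 ∧ R.IsRegular W.1 := by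
  obtain ⟨U, h1, h2⟩ := h
  obtain ⟨A, hA, hAU⟩ := exists_stdAlg_near hX R (stdAlgToCstarAlg G X U)
    (show (0 : ℝ) < 1 / 4 by norm_num)
  obtain ⟨W, hW, hW', hR⟩ := exists_partialIsometry_near h1 h2 hAU
  exact ⟨W, hW, hW', hR R hP hQ hA⟩

end

/-! ### Smooth structures as regular structures -/

section Smooth

variable {E : Type*} [NormedAddCommGroup E] [NormedSpace ℝ E] [FiniteDimensional ℝ E]
  {M : Type*} [TopologicalSpace M] {I : ModelWithCorners ℝ E M} {G : Type v} {X : Type u} [Group G]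
  [TopologicalSpace X] [MulAction G X] [T2Space X] [ChartedSpace M X] [IsManifold I ∞ X]
  {hG : ∀ g : G, ContMDiff I I ∞ fun x : X => g • x}

theorem RegClass.regIn_smooth_iff {V W : VectFamily.{u, v} X} {e : V.LocalTriv} {e' : W.LocalTriv}
    {f : X → X} {φ : ∀ x, V.fib x →ₗ[ℂ] W.fib (f x)} :
    (RegClass.smooth I hG).RegIn e e' f φ ↔ VectFamily.SmoothIn I e e' f φ := by
  constructor
  · intro h x hx hx'
    refine ⟨fun y => Matrix.of fun i j => e'.toFun (f y) (φ y (e.frame j y)) i,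
      fun i j => h x hx hx' i j, ?_⟩
    filter_upwards [e.eventually_mem hx] with y hy w
    exact funext fun i => toFun_eq_sum hy (φ y) w i
  · intro h x hx hx' i j
    obtain ⟨a, ha, ha'⟩ := h x hx hx'
    refine (RegClass.smooth I hG).congr (ha i j) ?_
    filter_upwards [ha', e.eventually_mem hx] with y hy hyb
    have h1 : e.toFun y (e.frame j y) = Pi.single j 1 := e.toFun_symm hyb _
    rw [hy, h1, Matrix.mulVec_single_one]
    rfl

/-- A smooth structure is a regular structure for the class of smooth functions. -/
def SmoothStructure.toRegStructure {V : GBundle.{u, v} G X} (s : SmoothStructure I V) :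
    (RegClass.smooth I hG).RegStructure V where
  atlas := s.atlas
  cover := s.cover
  compatible e he e' he' := RegClass.regIn_smooth_iff.2 (s.compatible e he e' he')
  regular_act g e he e' he' := RegClass.regIn_smooth_iff.2 (s.smooth_act g e he e' he')

/-- A regular structure for the class of smooth functions is a smooth structure. -/
def RegClass.RegStructure.toSmoothStructure {V : GBundle.{u, v} G X}
    (s : (RegClass.smooth I hG).RegStructure V) : SmoothStructure I V where
  atlas := s.atlas
  cover := s.cover
  compatible e he e' he' := RegClass.regIn_smooth_iff.1 (s.compatible e he e' he')
  smooth_act g e he e' he' := RegClass.regIn_smooth_iff.1 (s.regular_act g e he e' he')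

theorem SmoothHermBundle.regMetric (V : SmoothHermBundle.{u, v} I G X) {e : V.LocalTriv}
    (he : e ∈ V.smooth.atlas) : V.toHermBundle.RegMetric (RegClass.smooth I hG) e := by
  intro x hx i j
  obtain ⟨h, hh, h'⟩ := V.smooth_metric e he x hx
  refine (RegClass.smooth I hG).congr (hh i j) ?_
  filter_upwards [h', e.eventually_mem hx] with y hy hyb
  have h1 : ∀ j, e.toFun y (e.frame j y) = Pi.single j 1 := fun j => e.toFun_symm hyb _
  refine Eq.trans ?_ (hy (e.frame i y) (e.frame j y)).symm
  rw [h1, h1, Matrix.mulVec_single_one, ← Pi.single_star, star_one, single_one_dotProduct]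
  rfl

end Smooth

/-! ### The bijections -/

section

variable {G : Type v} {X : Type u} [Group G] [TopologicalSpace X] [MulAction G X]
  [ContinuousConstSMul G X] [T2Space X] [LocallyCompactSpace X]
  [CompactSpace (MulAction.orbitRel.Quotient G X)]

theorem GBundle.Embedding.proj_equiv_of_iso {V W : GBundle.{u, v} G X} (T : V.Embedding)
    (T' : W.Embedding) (φ : V.Iso W) : T.proj ≈ T'.proj := by
  rw [← T'.proj_comap φ]
  exact T.proj_equiv _

theorem HermBundle.isIsometric_isoOf {V W : HermBundle.{u, v} G X} {T : V.toGBundle.Embedding}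
    {T' : W.toGBundle.Embedding}
    (hT : ∀ x v w, StdBundle.stdInner (T.toLin x v) (T.toLin x w) = (V.metric x).inner v w)
    (hT' : ∀ x v w, StdBundle.stdInner (T'.toLin x v) (T'.toLin x w) = (W.metric x).inner v w)
    {U : StdAlg G X} (h1 : star U * U = T.proj.1) (h2 : U * star U = T'.proj.1) :
    HermBundle.IsIsometric (T.isoOf T' U h1 h2) := fun x v w => by
  rw [← hT, ← hT']
  exact GBundle.Embedding.stdInner_isoOf h1 h2 x v w

/-- Standard bundles that are isomorphic are isometrically isomorphic, as one can pass to the polar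
decomposition. -/
theorem StdBundle.toHermBundle_equiv {E F : StdBundle G X}
    (h : E.embedding.proj ≈ F.embedding.proj) : E.toHermBundle ≈ F.toHermBundle := by
  obtain ⟨U, h1, h2⟩ := h
  exact ⟨E.embedding.isoOf F.embedding U h1 h2,
    HermBundle.isIsometric_isoOf (V := E.toHermBundle) (W := F.toHermBundle)
      (fun _ _ _ => rfl) (fun _ _ _ => rfl) h1 h2⟩

theorem StdBundle.proj_equiv_iff {E F : StdBundle G X} :
    E.embedding.proj ≈ F.embedding.proj ↔ E ≈ F :=
  ⟨fun ⟨U, h1, h2⟩ => ⟨E.embedding.isoOf F.embedding U h1 h2⟩,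
    fun ⟨φ⟩ => E.embedding.proj_equiv_of_iso F.embedding φ⟩

theorem HermBundle.exists_stdBundle (V : HermBundle.{u, v} G X) (T : V.toGBundle.Embedding)
    (hT : ∀ x v w, StdBundle.stdInner (T.toLin x v) (T.toLin x w) = (V.metric x).inner v w) :
    (rangeBundle T.proj).toHermBundle ≈ V := by
  have h : (rangeBundle T.proj).embedding.proj = T.proj :=
    StdBundle.proj_embedding_rangeBundle T.proj
  have h1 : star T.proj.1 * T.proj.1 = (rangeBundle T.proj).embedding.proj.1 := by
    rw [h, T.proj.2.isSelfAdjoint.star_eq]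
    exact T.proj.2.isIdempotentElem
  have h2 : T.proj.1 * star T.proj.1 = T.proj.1 := by
    rw [T.proj.2.isSelfAdjoint.star_eq]
    exact T.proj.2.isIdempotentElem
  exact ⟨(rangeBundle T.proj).embedding.isoOf T T.proj.1 h1 h2,
    HermBundle.isIsometric_isoOf (V := (rangeBundle T.proj).toHermBundle) (fun _ _ _ => rfl)
      hT h1 h2⟩

variable [T2Space (MulAction.orbitRel.Quotient G X)]

/-- Every embedding of a bundle can be replaced by an embedding onto the range of a regular
projection, with the same metric. -/
theorem GBundle.Embedding.exists_regular (hX : LocallyProperAction G X) (R : RegClass G X)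
    {V : GBundle.{u, v} G X} (T : V.Embedding) :
    ∃ T' : V.Embedding, R.IsRegular T'.proj.1.1 ∧ ∀ x v w,
      StdBundle.stdInner (T'.toLin x v) (T'.toLin x w) =
        StdBundle.stdInner (T.toLin x v) (T.toLin x w) := by
  obtain ⟨P, ⟨U, h1, h2⟩, hP⟩ := T.proj.exists_regular hX R
  refine ⟨T.push U h1, by rwa [T.proj_push U h1 h2], fun x v w => ?_⟩
  change StdBundle.stdInner ((U.1 x).toLin (T.toLin x v)) ((U.1 x).toLin (T.toLin x w)) = _
  rw [StdAlg.stdInner_toLin, toLin_partialIsometry h1]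

/-- Bundles with equivalent regular embeddings are isomorphic via a regular isomorphism. -/
theorem GBundle.Embedding.exists_regular_isoOf (hX : LocallyProperAction G X) {R : RegClass G X}
    {V W : GBundle.{u, v} G X} (s : R.RegStructure V) (t : R.RegStructure W) {T : V.Embedding}
    {T' : W.Embedding} (hT : ∀ e ∈ s.atlas, T.RegTriv R e) (hT' : ∀ e ∈ t.atlas, T'.RegTriv R e)
    (h : T.proj ≈ T'.proj) :
    ∃ (U : StdAlg G X) (h1 : star U * U = T.proj.1) (h2 : U * star U = T'.proj.1),
      ∀ e ∈ s.atlas, ∀ e' ∈ t.atlas,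
        R.RegIn e e' id fun x => ((T.isoOf T' U h1 h2).toEquiv x).toLinearMap := by
  have h1 : R.IsRegular T.proj.1.1 := isRegular_proj fun x =>
    (s.cover x).imp fun e he => ⟨he.2, hT e he.1⟩
  have h2 : R.IsRegular T'.proj.1.1 := isRegular_proj fun x =>
    (t.cover x).imp fun e he => ⟨he.2, hT' e he.1⟩
  obtain ⟨U, hU, hU', hR⟩ := Proj.exists_regular_partialIsometry hX h1 h2 h
  exact ⟨U, hU, hU', fun e he e' he' =>
    regIn_of_toLin hR (toLin_isoOf hU hU') (hT e he) (hT' e' he')⟩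

end

theorem mainTheorem7 {G : Type v} [Group G] [Countable G] [Infinite G]
    {X : Type u} [TopologicalSpace X] [MulAction G X] [ContinuousConstSMul G X]
    [LocallyCompactSpace X] [T2Space X]
    [CompactSpace (MulAction.orbitRel.Quotient G X)] [T2Space (MulAction.orbitRel.Quotient G X)]
    (hX : LocallyProperAction G X) :
    (∃ (ab : Quotient (Proj.setoid (StdAlg G X)) ≃ Quotient (Proj.setoid (CstarAlg G X)))
      (ac : Quotient (Proj.setoid (StdAlg G X)) ≃ Quotient (StdBundle.setoid (G := G) (X := X)))
      (cd : Quotient (StdBundle.setoid (G := G) (X := X)) ≃ Quotient (HermBundle.setoid G X)),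
      (∀ P : Proj (StdAlg G X), ab ⟦P⟧ = ⟦P.map (stdAlgToCstarAlg G X)⟧) ∧
      (∀ P : Proj (StdAlg G X), ac ⟦P⟧ = ⟦rangeBundle P⟧) ∧
      (∀ F : StdBundle G X, cd ⟦F⟧ = ⟦F.toHermBundle⟧)) ∧
    ∀ {E : Type*} [NormedAddCommGroup E] [NormedSpace ℝ E] [FiniteDimensional ℝ E]
      {M : Type*} [TopologicalSpace M] (I : ModelWithCorners ℝ E M) [ChartedSpace M X]
      [IsManifold I ∞ X], (∀ g : G, ContMDiff I I ∞ fun x : X => g • x) →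
      (∃ ed : Quotient (SmoothHermBundle.setoid (I := I) (G := G) (X := X)) ≃
          Quotient (HermBundle.setoid G X),
        ∀ V : SmoothHermBundle I G X, ed ⟦V⟧ = ⟦V.toHermBundle⟧) ∧
      ∀ V : GBundle G X, Nonempty (SmoothStructure I V) ∧
        ∀ s t : SmoothStructure I V, ∃ φ : V.Iso V, φ.IsSmooth s t := by
  refine ⟨?_, ?_⟩
  · let f := stdAlgToCstarAlg G X
    let ab : Quotient (Proj.setoid (StdAlg G X)) → Quotient (Proj.setoid (CstarAlg G X)) :=
      Quotient.map (fun P => P.map f) fun P Q ⟨w, h1, h2⟩ => ⟨f w, by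
        rw [← map_star, ← map_mul, h1]
        rfl, by
        rw [← map_star, ← map_mul, h2]
        rfl⟩
    let ac : Quotient (Proj.setoid (StdAlg G X)) → Quotient (StdBundle.setoid (G := G) (X := X)) :=
      Quotient.map rangeBundle fun P Q h => StdBundle.proj_equiv_iff.1 (by
        rwa [StdBundle.proj_embedding_rangeBundle, StdBundle.proj_embedding_rangeBundle])
    let cd : Quotient (StdBundle.setoid (G := G) (X := X)) → Quotient (HermBundle.setoid G X) :=
      Quotient.map StdBundle.toHermBundle fun E F h =>
        StdBundle.toHermBundle_equiv (StdBundle.proj_equiv_iff.2 h)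
    refine ⟨Equiv.ofBijective ab ⟨?_, ?_⟩, Equiv.ofBijective ac ⟨?_, ?_⟩,
      Equiv.ofBijective cd ⟨?_, ?_⟩, fun _ => rfl, fun _ => rfl, fun _ => rfl⟩
    -- A partial isometry in `C^*(X, G)` between projections in `𝒞(X, G)` lies in `𝒞(X, G)`.
    · refine Quotient.ind₂ fun P Q h => Quotient.sound ?_
      obtain ⟨w, h1, h2⟩ := Quotient.exact h
      exact exists_stdAlg_of_partialIsometry h1 h2
    · refine Quotient.ind fun P => ?_
      -- Approximation and spectral projections; regularity is not needed beyond continuity.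
      obtain ⟨P', h, -⟩ := exists_regular_proj hX (RegClass.cont G X) P
      exact ⟨⟦P'⟧, (Quotient.sound h).symm⟩
    · refine Quotient.ind₂ fun P Q h => Quotient.sound ?_
      have h1 := StdBundle.proj_equiv_iff.2 (Quotient.exact h)
      rwa [StdBundle.proj_embedding_rangeBundle, StdBundle.proj_embedding_rangeBundle] at h1
    · refine Quotient.ind fun E => ⟨⟦E.embedding.proj⟧, ?_⟩
      exact congrArg _ E.rangeBundle_proj_embedding
    · refine Quotient.ind₂ fun E F h => Quotient.sound ?_
      obtain ⟨φ, -⟩ := Quotient.exact h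
      exact ⟨φ⟩
    · refine Quotient.ind fun V => ?_
      obtain ⟨T, -, hT⟩ := V.exists_isometric_embedding hX (RegClass.RegStructure.cont V.toGBundle)
        fun e _ => V.regMetric_cont e
      exact ⟨⟦rangeBundle T.proj⟧, Quotient.sound (V.exists_stdBundle T hT)⟩
  · intro E _ _ _ M _ I _ _ hG
    let R : RegClass G X := RegClass.smooth I hG
    let ed : Quotient (SmoothHermBundle.setoid (I := I) (G := G) (X := X)) →
        Quotient (HermBundle.setoid G X) :=
      Quotient.map (fun V => V.toHermBundle) fun V W ⟨φ, h, _⟩ => ⟨φ, h⟩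
    refine ⟨⟨Equiv.ofBijective ed ⟨?_, ?_⟩, fun _ => rfl⟩, fun V => ⟨?_, fun s t => ?_⟩⟩
    -- The ranges of smooth isometric embeddings of isomorphic bundles are related by a smooth partial
    -- isometry, which induces a smooth isometric isomorphism.
    · refine Quotient.ind₂ fun V W h => Quotient.sound ?_
      obtain ⟨φ, -⟩ := Quotient.exact h
      let s : R.RegStructure V.toGBundle := V.smooth.toRegStructure
      let t : R.RegStructure W.toGBundle := W.smooth.toRegStructure
      obtain ⟨T, hT, hTm⟩ := V.exists_isometric_embedding hX s fun e he => V.regMetric he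
      obtain ⟨T', hT', hTm'⟩ := W.exists_isometric_embedding hX t fun e he => W.regMetric he
      obtain ⟨U, h1, h2, hU⟩ := T.exists_regular_isoOf hX s t hT hT' (T.proj_equiv_of_iso T' φ)
      exact ⟨T.isoOf T' U h1 h2, HermBundle.isIsometric_isoOf hTm hTm' h1 h2,
        fun e he e' he' => RegClass.regIn_smooth_iff.1 (hU e he e' he'),
        fun e' he' e he => RegClass.regIn_smooth_iff.1 (hU e he e' he').symm⟩
    -- An isometric embedding onto the range of a smooth projection makes the bundle, and its metric,
    -- smooth.
    · refine Quotient.ind fun V => ?_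
      obtain ⟨T, -, hT⟩ := V.exists_isometric_embedding hX (RegClass.RegStructure.cont V.toGBundle)
        fun e _ => V.regMetric_cont e
      obtain ⟨T', hR, hT'⟩ := T.exists_regular hX R
      refine ⟨⟦{ V with
        smooth := (T'.regStructure hR).toSmoothStructure
        smooth_metric := fun e he x hx => ⟨V.gram e, fun i j => ?_, ?_⟩ }⟧, rfl⟩
      · have he' : T'.RegTriv R e := he
        refine R.congr (he'.regAt_gram hx i j) (Filter.Eventually.of_forall fun y => ?_)
        exact (hT' _ _ _).trans (hT _ _ _)
      · filter_upwards [e.eventually_mem hx] with y hy w z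
        exact V.inner_eq_gram e hy w z
    · let s := RegClass.RegStructure.cont V
      obtain ⟨T, -⟩ := V.exists_embedding hX s s.atlas s.cover
        fun e he e' he' g => s.regular_act g e he e' he'
      obtain ⟨T', hR, -⟩ := T.exists_regular hX R
      exact ⟨(T'.regStructure hR).toSmoothStructure⟩
    -- The two structures give embeddings of the same bundle, hence equivalent smooth projections.
    · let s' : R.RegStructure V := s.toRegStructure
      let t' : R.RegStructure V := t.toRegStructure
      obtain ⟨T, hT, -⟩ := V.exists_embedding hX s' s'.atlas s'.cover
        fun e he e' he' g => s'.regular_act g e he e' he'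
      obtain ⟨T', hT', -⟩ := V.exists_embedding hX t' t'.atlas t'.cover
        fun e he e' he' g => t'.regular_act g e he e' he'
      obtain ⟨U, h1, h2, hU⟩ := T.exists_regular_isoOf hX s' t' hT hT' (T.proj_equiv T')
      exact ⟨T.isoOf T' U h1 h2,
        fun e he e' he' => RegClass.regIn_smooth_iff.1 (hU e he e' he'),
        fun e' he' e he => RegClass.regIn_smooth_iff.1 (hU e he e' he').symm⟩
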